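/- For $\nu>0$ let $\mathcal N_{\mathbb C}(0,\nu)$ be the law on $\mathbb C$ with density $\frac{1}{\pi\nu}e^{-|w|^2/\nu}$. For an $n\times n$ complex matrix $W$ put $G_W(z)=\frac1{n!}\operatorname{per}(J+zW)$, where $J$ is the all-ones matrix, and let $\mathbb D(0,r)=\{z\in\mathbb C:|z|<r\}$. For $x,y\in\mathbb C$ and $\eta>0$, call $x$ an $e^{\pm\eta}$-multiplicative approximation to $y$ if $x=e^{w}y$ for some $w\in\mathbb C$ with $|w|\le\eta$. Let $\log G_W$ be the branch near $0$ with $\log G_W(0)=0$, and let $T_{W,m}$ be its degree-$m$ Taylor polynomial at $0$. There are a deterministic algorithm and an absolute constant $A\in\mathbb N$, $A\ge 1$, such that the following holds for every $\varepsilon\in(0,1)$, with a constant $C_\varepsilon$ depending only on $\varepsilon$. Let $\beta\in(0,1/3)$, let $n\ge n_0(\varepsilon,\beta)$ and $\nu>0$, and set $R_n=n^{1/3-\beta}/\sqrt\nu$. (1) If $W\in\mathbb C^{n\times n}$ is random with i.i.d. $\mathcal N_{\mathbb C}(0,\nu)$ entries, then $$\mathbb P\big[G_W\text{ has a zero in }\mathbb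 D(0,(1-\varepsilon)R_n)\big]\le C_\varepsilon n^{-6\beta},\qquad \mathbb P\big[G_W\text{ has a zero in }\mathbb D(0,(1-\tfrac{\varepsilon}{2})R_n)\big]\le C_\varepsilon n^{-6\beta}.$$ (2) If $G_W$ has no zero in $\mathbb D(0,(1-\varepsilon)R_n)$, then every zero $\rho\in\mathbb C$ of $\operatorname{per}(\rho J+W)$ satisfies $|\rho|\le(1-\varepsilon)^{-1}\sqrt\nu\,n^{-1/3+\beta}$. (3) If $G_W$ has no zero in $\mathbb D(0,(1-\varepsilon/2)R_n)$, then for every $\rho\in\mathbb C$ with $|\rho|\ge(1-\varepsilon)^{-1}\sqrt\nu\,n^{-1/3+\beta}$ and every $\eta\in(0,1]$, with $m=\big\lceil\frac{A}{\varepsilon}\log\frac{n}{\eta\varepsilon}\big\rceil$, the Barvinok interpolation approximant $n!\,\rho^n\exp\big(T_{W,m}(1/\rho)\big)$ is an $e^{\pm\eta}$-multiplicative approximation to $\operatorname{per}(\rho J+W)$, and the algorithm, on input $(n,W,\rho,\eta,\varepsilon)$, outputs an $e^{\pm\eta}$-multiplicative approximation to $\operatorname{per}(\rho J+W)$ in at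 most $n^{Am}$ steps. The algorithm is a single program, the same for all inputs, for a random access machine with exact complex arithmetic: a step is one of $+,-,\times,\div$ on complex numbers, a comparison of real parts, writing the constant $1$, or an elementary operation (zero, successor, copy, sum, truncated difference, indirect load or store, comparison) on natural-number counters and addresses. -/

import Mathlib

open MeasureTheory ProbabilityTheory

noncomputable section

/-! ### The random polynomial -/

/-- The complex Gaussian law `N_ℂ(0, ν)`, with density `(π ν)⁻¹ exp (-|w|² / ν)` on `ℂ`. -/
def complexGaussian (ν : ℝ) : Measure ℂ :=
  volume.withDensity fun w => ENNReal.ofReal (Real.exp (-‖w‖ ^ 2 / ν) / (Real.pi * ν))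

/-- The all-ones matrix `J`. -/
def allOnes (n : ℕ) : Matrix (Fin n) (Fin n) ℂ := Matrix.of fun _ _ => 1

/-- `G_W(z) = per (J + z W) / n!`. -/
def permPoly {n : ℕ} (W : Matrix (Fin n) (Fin n) ℂ) (z : ℂ) : ℂ :=
  (allOnes n + z • W).permanent / (n.factorial : ℂ)

/-- `G_W` has a zero in the open disk of radius `r` about the origin. -/
def HasZeroInDisk {n : ℕ} (W : Matrix (Fin n) (Fin n) ℂ) (r : ℝ) : Prop :=
  ∃ z : ℂ, ‖z‖ < r ∧ permPoly W z = 0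

/-- The radius `R_n = n^(1/3 - β) / √ν`. -/
def zeroFreeRadius (β ν : ℝ) (n : ℕ) : ℝ := (n : ℝ) ^ (1 / 3 - β) / Real.sqrt ν

/-! ### Multiplicative approximation and Barvinok interpolation -/

/-- `x` is an `e^{±η}`-multiplicative approximation to the complex number `y`:
`x = e^w y` for some complex `w` with `|w| ≤ η`. -/
def IsMulApprox (η : ℝ) (x y : ℂ) : Prop := ∃ w : ℂ, ‖w‖ ≤ η ∧ x = Complex.exp w * y

/-- The degree-`m` Taylor polynomial at `0` of the branch of `log G_W` with `log G_W(0) = 0`.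
Since `G_W(0) = 1`, near `0` this branch is the principal logarithm of `G_W`. -/
def logTaylor {n : ℕ} (W : Matrix (Fin n) (Fin n) ℂ) (m : ℕ) (z : ℂ) : ℂ :=
  ∑ k ∈ Finset.Icc 1 m,
    iteratedDeriv k (fun t => Complex.log (permPoly W t)) 0 / (k.factorial : ℂ) * z ^ k

/-- Barvinok's degree-`m` interpolation approximant to
`per (ρ J + W) = n! ρ^n G_W(ρ⁻¹)`, for `ρ ≠ 0`. -/
def barvinokApprox {n : ℕ} (W : Matrix (Fin n) (Fin n) ℂ) (m : ℕ) (ρ : ℂ) : ℂ :=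
  (n.factorial : ℂ) * ρ ^ n * Complex.exp (logTaylor W m ρ⁻¹)

/-! ### The machine model

A deterministic random access machine with exact complex arithmetic.  It has a memory of natural
numbers, used for counters and addresses, and a memory of complex numbers, addressed through the
former.  Each instruction and each test costs one step.  The only constants are `0` and `1`, the
natural-number instructions are zero, successor, copy, sum, truncated difference and
indirect load and store, and there is no transcendental instruction. -/

/-- A configuration of the two memories. -/
structure RamState where
  /-- the memory of natural numbers -/
  idx : ℕ → ℕ
  /-- the memory of complex numbers -/
  cell : ℕ → ℂ

/-- The four arithmetic operations. -/
inductive ArithOp where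
  | add | sub | mul | div

/-- The value of an arithmetic operation. -/
def ArithOp.eval : ArithOp → ℂ → ℂ → ℂ
  | .add, x, y => x + y
  | .sub, x, y => x - y
  | .mul, x, y => x * y
  | .div, x, y => x / y

/-- Instructions; `i`, `j`, `k` are fixed addresses in the memory of natural numbers. -/
inductive RamInstr where
  /-- `idx[i] := 0` -/
  | izero (i : ℕ)
  /-- `idx[i] := idx[i] + 1` -/
  | isucc (i : ℕ)
  /-- `idx[i] := idx[j]` -/
  | icopy (i j : ℕ)
  /-- `idx[i] := idx[j] + idx[k]` -/
  | iadd (i j k : ℕ)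
  /-- `idx[i] := max (idx[j] - idx[k]) 0` -/
  | isub (i j k : ℕ)
  /-- `idx[i] := idx[idx[j]]` -/
  | iload (i j : ℕ)
  /-- `idx[idx[i]] := idx[j]` -/
  | istore (i j : ℕ)
  /-- `cell[idx[i]] := 1` -/
  | one (i : ℕ)
  /-- `cell[idx[i]] := cell[idx[j]] op cell[idx[k]]` -/
  | arith (op : ArithOp) (i j k : ℕ)

/-- The effect of an instruction. -/
def RamInstr.apply : RamInstr → RamState → RamState
  | .izero i, s => { s with idx := Function.update s.idx i 0 }
  | .isucc i, s => { s with idx := Function.update s.idx i (s.idx i + 1) }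
  | .icopy i j, s => { s with idx := Function.update s.idx i (s.idx j) }
  | .iadd i j k, s => { s with idx := Function.update s.idx i (s.idx j + s.idx k) }
  | .isub i j k, s => { s with idx := Function.update s.idx i (s.idx j - s.idx k) }
  | .iload i j, s => { s with idx := Function.update s.idx i (s.idx (s.idx j)) }
  | .istore i j, s => { s with idx := Function.update s.idx (s.idx i) (s.idx j) }
  | .one i, s => { s with cell := Function.update s.cell (s.idx i) 1 }
  | .arith op i j k, s =>
      { s with cell := Function.update s.cell (s.idx i)
                (op.eval (s.cell (s.idx j)) (s.cell (s.idx k))) }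

/-- An instruction can be executed unless it is a division by zero. -/
def RamInstr.Defined : RamInstr → RamState → Prop
  | .arith .div _ _ k, s => s.cell (s.idx k) ≠ 0
  | _, _ => True

/-- Tests on the current configuration. -/
inductive RamTest where
  /-- `idx[i] < idx[j]` -/
  | idxLt (i j : ℕ)
  /-- `Re cell[idx[i]] < Re cell[idx[j]]` -/
  | reLt (i j : ℕ)

/-- The truth value of a test. -/
def RamTest.Holds : RamTest → RamState → Prop
  | .idxLt i j, s => s.idx i < s.idx j
  | .reLt i j, s => (s.cell (s.idx i)).re < (s.cell (s.idx j)).re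

/-- Programs. -/
inductive RamProg where
  | instr (a : RamInstr)
  | seq (p q : RamProg)
  | ite (b : RamTest) (p q : RamProg)
  | loop (b : RamTest) (p : RamProg)

/-- `RamExec p s t s'`: started in configuration `s`, the program `p` halts after exactly `t` steps
in configuration `s'`.  Here `loop b p` means: while `b` holds, do `p`. -/
inductive RamExec : RamProg → RamState → ℕ → RamState → Prop where
  | instr (a : RamInstr) (s : RamState) (h : a.Defined s) :
      RamExec (.instr a) s 1 (a.apply s)
  | seq (p q : RamProg) (s s' s'' : RamState) (t t' : ℕ)
      (hp : RamExec p s t s') (hq : RamExec q s' t' s'') :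
      RamExec (.seq p q) s (t + t') s''
  | iteTrue (b : RamTest) (p q : RamProg) (s s' : RamState) (t : ℕ)
      (hb : b.Holds s) (hp : RamExec p s t s') :
      RamExec (.ite b p q) s (t + 1) s'
  | iteFalse (b : RamTest) (p q : RamProg) (s s' : RamState) (t : ℕ)
      (hb : ¬ b.Holds s) (hq : RamExec q s t s') :
      RamExec (.ite b p q) s (t + 1) s'
  | loopTrue (b : RamTest) (p : RamProg) (s s' s'' : RamState) (t t' : ℕ)
      (hb : b.Holds s) (hp : RamExec p s t s') (hl : RamExec (.loop b p) s' t' s'') :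
      RamExec (.loop b p) s (t + t' + 1) s''
  | loopFalse (b : RamTest) (p : RamProg) (s : RamState) (hb : ¬ b.Holds s) :
      RamExec (.loop b p) s 1 s

/-- The initial configuration: `n` is in `idx[0]`, the numbers `ρ`, `η`, `ε` are in
`cell[0]`, `cell[1]`, `cell[2]`, the entry `W i j` is in `cell[3 + n * i + j]`
(rows and columns counted from `0`), and everything else is `0`. -/
def ramInput {n : ℕ} (W : Matrix (Fin n) (Fin n) ℂ) (ρ : ℂ) (η ε : ℝ) : RamState where
  idx := fun i => if i = 0 then n else 0
  cell := fun a =>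
    if a = 0 then ρ
    else if a = 1 then (η : ℂ)
    else if a = 2 then (ε : ℂ)
    else if h : a - 3 < n * n then
      W (finProdFinEquiv.symm ⟨a - 3, h⟩).1 (finProdFinEquiv.symm ⟨a - 3, h⟩).2
    else 0

end

/-! Since per(ρJ + W) = n! ρⁿ G_W(1/ρ), everything reduces to the zeros of G_W and to its Taylor
data.

Probability bound. On the circle |z| = r = R_n put t = νr² and p = t/n = n^(-1/3-2β). The second
moment of G_W there is of order e^t, which is useless by itself. Its size comes from few Gaussian
modes: the total sum of W and the row and column sums. So G_W is multiplied by a zero-free entire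
factor exp q(zW), with q linear in the total and quadratic in these modes, giving `correctedPoly`.
The weight |exp q|² turns the Gaussian law into another Gaussian law (`lintegral_gaussPi_tilt`).
Under it the entries have mean 1 - p, and real and imaginary parts of the modes have different
variances. The coefficients of q are chosen so that the pseudo-covariance E[XY] of entries in
different rows and columns vanishes (`sum_mode_cross`). By Wick's formula the second moment of the
permanent then depends only on the Hermitian covariances. Independent circular noise raises these to
those of a matrix with i.i.d. entries and can only increase the second moment (Jensen), and the
i.i.d. case is a count of fixed points of permutations. In the resulting bound the first and second
orders in p cancel, leaving 1 + O(np³) = 1 + O(n^(-6β)) (`tiltedBound_le_exp`).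

An entire H with H(0) = 1 has circle mean of |H - 1|² equal to that of |H|² minus 1. A zero of H
well inside the circle makes this mean bounded below, by Cauchy's formula for (H - 1)². Markov's
inequality finishes the estimate (`measure_exists_zero_le`).

Interpolation. G_W has at most n roots. If they avoid the larger disk, every inverse root times 1/ρ
has modulus at most 1 - ε/2, so the Taylor tail of the logarithm at 1/ρ is geometric.

Algorithm. The degree-k coefficient of G_W is a normalized sum over k-tuples of matrix positions,
found by enumerating (n²)^k codes. Newton's identities turn coefficients into those of the
logarithm. Having no exponential, the machine uses (1 + T/K)^K. Having no logarithm, it finds its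
degree by multiplying an explicit error bound by 1 - ε/2 until it is at most η. Running times are
bounded by powers of one Y = n^(3m); the total Y¹² gives A = 36. -/

noncomputable section

/-! ### Products of affine forms in independent real Gaussian variables -/

section Isserlis

open scoped NNReal ENNReal

/-- The law of independent centred real Gaussian variables with variances `v m`. -/
def gaussPi {M : Type*} [Fintype M] (v : M → ℝ≥0) : Measure (M → ℝ) :=
  Measure.pi fun m => gaussianReal 0 (v m)

instance {M : Type*} [Fintype M] (v : M → ℝ≥0) : IsProbabilityMeasure (gaussPi v) := by
  unfold gaussPi; infer_instance

/-- Resampling one coordinate independently does not change a product law. This reduces integration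
by parts in many variables to a single one. -/
theorem map_update_prod_pi {M : Type*} [Fintype M] [DecidableEq M] {X : M → Type*}
    [∀ m, MeasurableSpace (X m)] (μ : ∀ m, Measure (X m)) [∀ m, IsProbabilityMeasure (μ m)]
    (m : M) :
    MeasurePreserving (fun p : (∀ m, X m) × X m => Function.update p.1 m p.2)
      ((Measure.pi μ).prod (μ m)) (Measure.pi μ) := by
  have hmeas : Measurable (fun p : (∀ m, X m) × X m => Function.update p.1 m p.2) := by
    refine measurable_pi_iff.2 fun k => ?_
    by_cases h : k = m
    · subst h; simpa using measurable_snd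
    · simp only [Function.update_of_ne h]
      exact (measurable_pi_apply k).comp measurable_fst
  refine ⟨hmeas, ?_⟩
  refine (Measure.pi_eq fun s hs => ?_).symm
  rw [Measure.map_apply hmeas (MeasurableSet.univ_pi hs)]
  have : (fun p : (∀ m, X m) × X m => Function.update p.1 m p.2) ⁻¹' Set.univ.pi s
      = (Set.univ.pi (Function.update s m Set.univ)) ×ˢ s m := by
    ext p
    simp only [Set.mem_preimage, Set.mem_pi, Set.mem_univ, true_imp_iff, Set.mem_prod]
    constructor
    · intro h
      refine ⟨fun k => ?_, by simpa using h m⟩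
      by_cases hk : k = m
      · subst hk; simp
      · simpa [Function.update_of_ne hk] using h k
    · rintro ⟨h, h'⟩ k
      by_cases hk : k = m
      · subst hk; simpa using h'
      · simpa [Function.update_of_ne hk] using h k
  rw [this, Measure.prod_prod, Measure.pi_pi, ← Finset.mul_prod_erase _ _ (Finset.mem_univ m),
    ← Finset.mul_prod_erase _ (fun i => μ i (s i)) (Finset.mem_univ m), mul_comm]
  simp only [Function.update_self, measure_univ, one_mul]
  congr 1
  refine Finset.prod_congr rfl fun k hk => ?_
  rw [Function.update_of_ne (Finset.ne_of_mem_erase hk)]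

/-- An affine form in real variables, with complex coefficients. -/
def affForm {M : Type*} [Fintype M] (a : ℂ) (α : M → ℂ) (x : M → ℝ) : ℂ :=
  a + ∑ m, α m * (x m : ℂ)

theorem memLp_affForm {M : Type*} [Fintype M] (v : M → ℝ≥0) (a : ℂ) (α : M → ℂ) (p : ℝ≥0∞)
    (hp : p ≠ ∞) : MemLp (affForm a α) p (gaussPi v) := by
  have h : MemLp (fun x : M → ℝ => ∑ m, α m * (x m : ℂ)) p (gaussPi v) := by
    refine memLp_finsetSum _ fun m _ => MemLp.const_mul ?_ _
    have h1 : MemLp (fun x : M → ℝ => x m) p (gaussPi v) :=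
      (memLp_id_gaussianReal' (μ := 0) (v := v m) p hp).comp_measurePreserving
        (measurePreserving_eval (fun m => gaussianReal 0 (v m)) m)
    exact h1.ofReal
  exact (memLp_const a).add h

theorem integrable_prod_of_memLp {X ι : Type*} [MeasurableSpace X] {μ : Measure X}
    [IsProbabilityMeasure μ] {f : ι → X → ℂ} (h : ∀ i (p : ℝ≥0∞), p ≠ ∞ → MemLp (f i) p μ)
    (S : Finset ι) : Integrable (fun x => ∏ i ∈ S, f i x) μ := by
  rw [← memLp_one_iff_integrable]
  -- Hölder with every factor in L^(|S|+1). The extra 1 keeps the exponent nonzero for empty `S`,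
  -- and the resulting exponent is still at least 1.
  have h1 : MemLp (fun x => ∏ i ∈ S, f i x) (∑ i ∈ S, ((S.card : ℝ≥0∞) + 1)⁻¹)⁻¹ μ :=
    by
      have := MemLp.prod' (𝕜 := ℂ) (s := S) (f := f) (μ := μ)
        (p := fun _ => (S.card : ℝ≥0∞) + 1) (fun i _ => h i _ (by simp))
      simpa using this
  refine h1.mono_exponent ?_
  rw [ENNReal.one_le_inv]
  simp only [Finset.sum_const, nsmul_eq_mul]
  rw [← div_eq_mul_inv]
  refine ENNReal.div_le_of_le_mul ?_
  simp

theorem integrable_prod_affForm {M ι : Type*} [Fintype M] (v : M → ℝ≥0) (a : ι → ℂ)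
    (α : ι → M → ℂ) (S : Finset ι) :
    Integrable (fun x => ∏ i ∈ S, affForm (a i) (α i) x) (gaussPi v) :=
  integrable_prod_of_memLp (fun i p hp => memLp_affForm v (a i) (α i) p hp) S

/-- Gaussian integration by parts in one variable. -/
theorem integral_mul_gaussianReal {v : ℝ≥0} {u u' : ℝ → ℂ}
    (hu : ∀ x, HasDerivAt u (u' x) x)
    (h0 : Integrable u (gaussianReal 0 v)) (h1 : Integrable (fun x : ℝ => (x : ℂ) * u x) (gaussianReal 0 v))
    (h2 : Integrable u' (gaussianReal 0 v)) :
    ∫ x : ℝ, (x : ℂ) * u x ∂gaussianReal 0 v = v * ∫ x, u' x ∂gaussianReal 0 v := by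
  by_cases hv : v = 0
  · subst hv
    simp [gaussianReal_zero_var]
  have hv' : (v : ℝ) ≠ 0 := by exact_mod_cast hv
  have conv : ∀ f : ℝ → ℂ, Integrable f (gaussianReal 0 v) →
      Integrable (fun x => f x * (gaussianPDFReal 0 v x : ℂ)) := by
    intro f hf
    rw [gaussianReal_of_var_ne_zero 0 hv, integrable_withDensity_iff_integrable_smul'
      (measurable_gaussianPDF 0 v) (ae_of_all _ fun x => gaussianPDF_lt_top)] at hf
    refine hf.congr (ae_of_all _ fun x => ?_)
    simp only [toReal_gaussianPDF, Complex.real_smul]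
    ring
  have hpdf : ∀ x : ℝ, HasDerivAt (fun x => (gaussianPDFReal 0 v x : ℂ))
      (-((x : ℂ) / (v : ℝ)) * (gaussianPDFReal 0 v x : ℂ)) x := by
    intro x
    have : HasDerivAt (gaussianPDFReal 0 v) (-(x / v) * gaussianPDFReal 0 v x) x := by
      have h3 : HasDerivAt (fun x : ℝ => -(x - 0) ^ 2 / (2 * (v : ℝ))) (-(x / v)) x := by
        have := (((hasDerivAt_id x).sub_const 0).pow 2).neg.div_const (2 * (v : ℝ))
        convert! this using 1
        simp
        field_simp
      have := (h3.exp).const_mul (√(2 * Real.pi * v))⁻¹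
      rw [gaussianPDFReal_def]
      convert! this using 1
      ring
    convert! this.ofReal_comp using 1
    push_cast
    rfl
  have key := integral_mul_deriv_eq_deriv_mul_of_integrable
    (u := u) (v := fun x => (gaussianPDFReal 0 v x : ℂ)) (u' := u')
    (v' := fun x : ℝ => -((x : ℂ) / (v : ℝ)) * (gaussianPDFReal 0 v x : ℂ))
    (fun x _ => hu x) (fun x _ => hpdf x) ?_ (conv _ h2) (conv _ h0)
  · rw [integral_gaussianReal_eq_integral_smul hv, integral_gaussianReal_eq_integral_smul hv]
    simp only [Complex.real_smul]
    have e1 : ∫ x, (gaussianPDFReal 0 v x : ℂ) * u' x = ∫ x, u' x * (gaussianPDFReal 0 v x : ℂ) := by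
      congr 1; ext x; ring
    have e2 : ∫ x, (gaussianPDFReal 0 v x : ℂ) * ((x : ℂ) * u x)
        = -(v : ℂ) * ∫ x, u x * (-((x : ℂ) / (v : ℝ)) * (gaussianPDFReal 0 v x : ℂ)) := by
      rw [← integral_const_mul]
      congr 1; ext x
      have : ((v : ℝ) : ℂ) ≠ 0 := by exact_mod_cast hv'
      have e : ((v : ℝ≥0) : ℂ) = ((v : ℝ) : ℂ) := rfl
      rw [e]
      field_simp
    rw [e1, e2, key]; ring
  · have := (conv _ h1).const_mul (-(1 / (v : ℝ) : ℂ))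
    refine this.congr (ae_of_all _ fun x => ?_)
    simp only [Pi.mul_apply]
    ring

theorem integral_mul_prod_affine_gaussianReal {ι : Type*} [DecidableEq ι] {v : ℝ≥0} (b α : ι → ℂ) (S : Finset ι) :
    ∫ x, (x : ℂ) * ∏ i ∈ S, (b i + α i * x) ∂gaussianReal 0 v
      = v * ∑ i ∈ S, α i * ∫ x, ∏ j ∈ S.erase i, (b j + α j * (x : ℂ)) ∂gaussianReal 0 v := by
  have hL : ∀ (b α : ℂ) (p : ℝ≥0∞), p ≠ ∞ →
      MemLp (fun x : ℝ => b + α * (x : ℂ)) p (gaussianReal 0 v) := fun b α p hp =>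
    (memLp_const b).add (((memLp_id_gaussianReal' (μ := 0) (v := v) p hp).ofReal).const_mul α)
  have hI : ∀ S : Finset ι, Integrable (fun x : ℝ => ∏ i ∈ S, (b i + α i * (x : ℂ))) (gaussianReal 0 v) :=
    fun S => integrable_prod_of_memLp (fun i p hp => hL (b i) (α i) p hp) S
  rw [integral_mul_gaussianReal (u' := fun x => ∑ i ∈ S, α i * ∏ j ∈ S.erase i, (b j + α j * (x : ℂ)))]
  · rw [integral_finsetSum _ fun i _ => (hI _).const_mul _]
    simp only [integral_const_mul]
  · intro x
    have := HasDerivAt.fun_finsetProd (u := S) (f := fun i (x : ℝ) => b i + α i * (x : ℂ)) (f' := α) (x := x)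
      (fun i _ => by
        simpa using ((Complex.ofRealCLM.hasDerivAt (x := x)).const_mul (α i)).const_add (b i))
    convert! this using 1
    refine Finset.sum_congr rfl fun i _ => ?_
    rw [smul_eq_mul, mul_comm]
  · exact hI S
  -- The bare factor x counts as one more affine form, carried by the index `none`.
  · have := integrable_prod_of_memLp (μ := gaussianReal 0 v)
      (f := fun (i : Option ι) (x : ℝ) => i.elim (0 : ℂ) b + i.elim (1 : ℂ) α * (x : ℂ))
      (fun i p hp => hL _ _ p hp) (insert none (S.map Function.Embedding.some))
    rw [show (fun x : ℝ => (x : ℂ) * ∏ i ∈ S, (b i + α i * (x : ℂ))) = _ from ?_]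
    · exact this
    · ext x
      rw [Finset.prod_insert (by simp)]
      simp
  · exact integrable_finsetSum _ fun i _ => (hI _).const_mul _

theorem integral_gaussPi_update {M : Type*} [Fintype M] [DecidableEq M] (v : M → ℝ≥0) (m : M)
    {f : (M → ℝ) → ℂ} (hf : Integrable f (gaussPi v)) :
    ∫ x, f x ∂gaussPi v
      = ∫ x, ∫ a, f (Function.update x m a) ∂gaussianReal 0 (v m) ∂gaussPi v := by
  have h := map_update_prod_pi (fun m => gaussianReal 0 (v m)) m
  have h1 := h.map_eq
  have hf' : AEStronglyMeasurable f (Measure.map (fun p : (M → ℝ) × ℝ => Function.update p.1 m p.2)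
      ((Measure.pi fun m => gaussianReal 0 (v m)).prod (gaussianReal 0 (v m)))) := by
    rw [h1]; exact hf.aestronglyMeasurable
  have h2 := integral_map h.measurable.aemeasurable hf'
  rw [h1] at h2
  unfold gaussPi
  rw [h2, integral_prod]
  exact h.integrable_comp_of_integrable hf

theorem affForm_update {M : Type*} [Fintype M] [DecidableEq M] (a : ℂ) (α : M → ℂ) (x : M → ℝ)
    (m : M) (y : ℝ) :
    affForm a α (Function.update x m y)
      = (a + ∑ k ∈ Finset.univ.erase m, α k * (x k : ℂ)) + α m * (y : ℂ) := by
  unfold affForm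
  rw [← Finset.add_sum_erase _ _ (Finset.mem_univ m), Function.update_self]
  have : ∑ k ∈ Finset.univ.erase m, α k * ((Function.update x m y k : ℝ) : ℂ)
      = ∑ k ∈ Finset.univ.erase m, α k * (x k : ℂ) :=
    Finset.sum_congr rfl fun k hk => by rw [Function.update_of_ne (Finset.ne_of_mem_erase hk)]
  rw [this]; ring

theorem integrable_coord_mul_prod {M ι : Type*} [Fintype M] (v : M → ℝ≥0) (m : M)
    (a : ι → ℂ) (α : ι → M → ℂ) (S : Finset ι) :
    Integrable (fun x => (x m : ℂ) * ∏ i ∈ S, affForm (a i) (α i) x) (gaussPi v) := by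
  classical
  have := integrable_prod_affForm v (fun i : Option ι => i.elim (0 : ℂ) a)
    (fun i : Option ι => i.elim (Pi.single m (1 : ℂ)) α) (insert none (S.map Function.Embedding.some))
  rw [show (fun x : M → ℝ => (x m : ℂ) * ∏ i ∈ S, affForm (a i) (α i) x) = _ from ?_]
  · exact this
  · ext x
    rw [Finset.prod_insert (by simp)]
    simp [affForm, Pi.single_apply]

theorem integral_coord_mul_prod {M ι : Type*} [Fintype M] [DecidableEq ι] (v : M → ℝ≥0) (m : M)
    (a : ι → ℂ) (α : ι → M → ℂ) (S : Finset ι) :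
    ∫ x, (x m : ℂ) * ∏ i ∈ S, affForm (a i) (α i) x ∂gaussPi v
      = ∑ i ∈ S, (v m * α i m) * ∫ x, ∏ j ∈ S.erase i, affForm (a j) (α j) x ∂gaussPi v := by
  classical
  rw [integral_gaussPi_update v m (integrable_coord_mul_prod v m a α S)]
  simp only [Function.update_self, affForm_update]
  simp only [integral_mul_prod_affine_gaussianReal, Finset.mul_sum]
  have hE : ∀ i, Integrable (fun x : M → ℝ => ∫ y, ∏ j ∈ S.erase i,
      affForm (a j) (α j) (Function.update x m y) ∂gaussianReal 0 (v m)) (gaussPi v) := by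
    intro i
    have h := map_update_prod_pi (fun m => gaussianReal 0 (v m)) m
    exact (h.integrable_comp_of_integrable (integrable_prod_affForm v a α (S.erase i))).integral_prod_left
  simp only [affForm_update] at hE
  rw [integral_finsetSum _ fun i _ => ((hE i).const_mul _).const_mul _]
  refine Finset.sum_congr rfl fun i _ => ?_
  rw [integral_const_mul, integral_const_mul,
    integral_gaussPi_update v m (integrable_prod_affForm v a α (S.erase i))]
  simp only [affForm_update]
  ring

/-- Wick's recursion. -/
theorem integral_affForm_mul_prod {M ι : Type*} [Fintype M] [DecidableEq ι] (v : M → ℝ≥0)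
    (b : ℂ) (β : M → ℂ) (a : ι → ℂ) (α : ι → M → ℂ) (S : Finset ι) :
    ∫ x, affForm b β x * ∏ i ∈ S, affForm (a i) (α i) x ∂gaussPi v
      = b * ∫ x, ∏ i ∈ S, affForm (a i) (α i) x ∂gaussPi v
        + ∑ i ∈ S, (∑ m, v m * β m * α i m)
            * ∫ x, ∏ j ∈ S.erase i, affForm (a j) (α j) x ∂gaussPi v := by
  have e : ∀ x : M → ℝ, affForm b β x * ∏ i ∈ S, affForm (a i) (α i) x
      = b * ∏ i ∈ S, affForm (a i) (α i) x
        + ∑ m, β m * ((x m : ℂ) * ∏ i ∈ S, affForm (a i) (α i) x) := by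
    intro x
    rw [affForm, add_mul, Finset.sum_mul]
    simp only [mul_assoc]
  simp only [e]
  rw [integral_add ((integrable_prod_affForm v a α S).const_mul _)
    (integrable_finsetSum _ fun m _ => (integrable_coord_mul_prod v m a α S).const_mul _),
    integral_const_mul, integral_finsetSum _ fun m _ => (integrable_coord_mul_prod v m a α S).const_mul _]
  congr 1
  simp only [integral_const_mul, integral_coord_mul_prod, Finset.mul_sum, Finset.sum_mul]
  rw [Finset.sum_comm]
  refine Finset.sum_congr rfl fun i _ => Finset.sum_congr rfl fun m _ => ?_
  ring

/-- The expectation of a product of affine forms in independent Gaussian variables depends only on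
the constant terms and on the covariances of distinct factors. -/
theorem integral_prod_affForm_congr {M M' ι : Type*} [Fintype M] [Fintype M']
    (v : M → ℝ≥0) (v' : M' → ℝ≥0) (a : ι → ℂ) (α : ι → M → ℂ) (α' : ι → M' → ℂ) (S : Finset ι)
    (h : ∀ i ∈ S, ∀ j ∈ S, i ≠ j → ∑ m, v m * α i m * α j m = ∑ m, v' m * α' i m * α' j m) :
    ∫ x, ∏ i ∈ S, affForm (a i) (α i) x ∂gaussPi v
      = ∫ x, ∏ i ∈ S, affForm (a i) (α' i) x ∂gaussPi v' := by
  classical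
  induction S using Finset.strongInduction with
  | H S ih =>
    rcases S.eq_empty_or_nonempty with rfl | ⟨k, hk⟩
    · simp
    · simp only [← Finset.mul_prod_erase S _ hk]
      rw [integral_affForm_mul_prod, integral_affForm_mul_prod]
      have sub : ∀ T ⊂ S, ∫ x, ∏ i ∈ T, affForm (a i) (α i) x ∂gaussPi v
          = ∫ x, ∏ i ∈ T, affForm (a i) (α' i) x ∂gaussPi v' := fun T hT =>
        ih T hT fun i hi j hj hij => h i (hT.1 hi) j (hT.1 hj) hij
      rw [sub _ (Finset.erase_ssubset hk)]
      congr 1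
      refine Finset.sum_congr rfl fun i hi => ?_
      rw [h k hk i (Finset.mem_of_mem_erase hi) (Finset.ne_of_mem_erase hi).symm,
        sub _ ((Finset.erase_subset _ _).trans_ssubset (Finset.erase_ssubset hk))]

end Isserlis

/-! ### Second moments of permanents of Gaussian matrices -/

section PermanentMoments

open scoped NNReal ENNReal ComplexConjugate

theorem conj_affForm {M : Type*} [Fintype M] (a : ℂ) (α : M → ℂ) (x : M → ℝ) :
    conj (affForm a α x) = affForm (conj a) (fun m => conj (α m)) x := by
  simp [affForm]

/-- The matrix of affine forms with constant term `A` and coefficients `α`. -/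
def affMatrix {M ι : Type*} [Fintype M] (A : Matrix ι ι ℂ) (α : ι → ι → M → ℂ) (x : M → ℝ) :
    Matrix ι ι ℂ :=
  Matrix.of fun i j => affForm (A i j) (α i j) x

theorem integrable_permanent_affMatrix {M ι : Type*} [Fintype M] [Fintype ι] [DecidableEq ι]
    (v : M → ℝ≥0) (A : Matrix ι ι ℂ) (α : ι → ι → M → ℂ) :
    Integrable (fun x => (affMatrix A α x).permanent) (gaussPi v) := by
  unfold Matrix.permanent
  exact integrable_finsetSum _ fun σ _ => integrable_prod_affForm v (fun i => A (σ i) i)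
    (fun i => α (σ i) i) Finset.univ

theorem permanent_mul_conj_affMatrix {M ι : Type*} [Fintype M] [Fintype ι] [DecidableEq ι]
    (A : Matrix ι ι ℂ) (α : ι → ι → M → ℂ) (x : M → ℝ) :
    (affMatrix A α x).permanent * conj (affMatrix A α x).permanent
      = ∑ σ : Equiv.Perm ι, ∑ τ : Equiv.Perm ι, ∏ i ∈ Finset.univ.disjSum Finset.univ,
          affForm (Sum.elim (fun i => A (σ i) i) (fun i => conj (A (τ i) i)) i)
            (Sum.elim (fun i => α (σ i) i) (fun i m => conj (α (τ i) i m)) i) x := by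
  simp only [Finset.prod_disjSum, Sum.elim_inl, Sum.elim_inr, Matrix.permanent, map_sum, map_prod,
    Finset.sum_mul_sum, affMatrix, Matrix.of_apply, conj_affForm]

theorem integral_permanent_mul_conj {M ι : Type*} [Fintype M] [Fintype ι] [DecidableEq ι]
    (v : M → ℝ≥0) (A : Matrix ι ι ℂ) (α : ι → ι → M → ℂ) :
    ∫ x, (affMatrix A α x).permanent * conj (affMatrix A α x).permanent ∂gaussPi v
      = ∑ σ : Equiv.Perm ι, ∑ τ : Equiv.Perm ι, ∫ x, ∏ i ∈ Finset.univ.disjSum Finset.univ,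
          affForm (Sum.elim (fun i => A (σ i) i) (fun i => conj (A (τ i) i)) i)
            (Sum.elim (fun i => α (σ i) i) (fun i m => conj (α (τ i) i m)) i) x ∂gaussPi v := by
  simp only [permanent_mul_conj_affMatrix]
  rw [integral_finsetSum _ fun σ _ => integrable_finsetSum _ fun τ _ =>
    integrable_prod_affForm v _ _ _]
  refine Finset.sum_congr rfl fun σ _ => ?_
  rw [integral_finsetSum _ fun τ _ => integrable_prod_affForm v _ _ _]

theorem integrable_normSq_permanent {M ι : Type*} [Fintype M] [Fintype ι] [DecidableEq ι]
    (v : M → ℝ≥0) (A : Matrix ι ι ℂ) (α : ι → ι → M → ℂ) :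
    Integrable (fun x => ‖(affMatrix A α x).permanent‖ ^ 2) (gaussPi v) := by
  have h : Integrable (fun x => (affMatrix A α x).permanent * conj (affMatrix A α x).permanent)
      (gaussPi v) := by
    simp only [permanent_mul_conj_affMatrix]
    exact integrable_finsetSum _ fun σ _ => integrable_finsetSum _ fun τ _ =>
      integrable_prod_affForm v _ _ _
  refine h.re.congr (ae_of_all _ fun x => ?_)
  simp only [Complex.mul_conj, RCLike.re_to_complex, Complex.ofReal_re, Complex.normSq_eq_norm_sq]

theorem integral_normSq_permanent {M ι : Type*} [Fintype M] [Fintype ι] [DecidableEq ι]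
    (v : M → ℝ≥0) (A : Matrix ι ι ℂ) (α : ι → ι → M → ℂ) :
    ((∫ x, ‖(affMatrix A α x).permanent‖ ^ 2 ∂gaussPi v : ℝ) : ℂ)
      = ∫ x, (affMatrix A α x).permanent * conj (affMatrix A α x).permanent ∂gaussPi v := by
  rw [← integral_complex_ofReal]
  simp only [Complex.mul_conj, Complex.normSq_eq_norm_sq]

/-- The forms `α i j` and `α k l` are uncorrelated, without conjugation, whenever `(i, j)` and
`(k, l)` lie in different rows and different columns. -/
def PseudoUncorrelated {M ι : Type*} [Fintype M] (v : M → ℝ≥0) (α : ι → ι → M → ℂ) : Prop :=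
  ∀ i j k l, i ≠ k → j ≠ l → ∑ m, v m * α i j m * α k l m = 0

theorem PseudoUncorrelated.conj {M ι : Type*} [Fintype M] {v : M → ℝ≥0} {α : ι → ι → M → ℂ}
    (h : PseudoUncorrelated v α) {i j k l : ι} (hik : i ≠ k) (hjl : j ≠ l) :
    ∑ m, v m * conj (α i j m) * conj (α k l m) = 0 := by
  have := congrArg conj (h i j k l hik hjl)
  simpa using this

/-- Each term of |per|² pairs a permutation with the conjugate of another. Two distinct entries
taken from the same permutation lie in different rows and columns, so their Wick contraction
vanishes by pseudo-uncorrelatedness. Only contractions of an entry with a conjugate entry survive.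
-/
theorem integral_normSq_permanent_congr {M M' ι : Type*} [Fintype M] [Fintype M'] [Fintype ι]
    [DecidableEq ι] {v : M → ℝ≥0} {v' : M' → ℝ≥0} (A : Matrix ι ι ℂ) {α : ι → ι → M → ℂ}
    {α' : ι → ι → M' → ℂ} (h : PseudoUncorrelated v α) (h' : PseudoUncorrelated v' α')
    (hc : ∀ i j k l, ∑ m, v m * α i j m * conj (α k l m) = ∑ m, v' m * α' i j m * conj (α' k l m)) :
    ∫ x, ‖(affMatrix A α x).permanent‖ ^ 2 ∂gaussPi v
      = ∫ x, ‖(affMatrix A α' x).permanent‖ ^ 2 ∂gaussPi v' := by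
  rw [← Complex.ofReal_inj, integral_normSq_permanent, integral_normSq_permanent,
    integral_permanent_mul_conj, integral_permanent_mul_conj]
  refine Finset.sum_congr rfl fun σ _ => Finset.sum_congr rfl fun τ _ =>
    integral_prod_affForm_congr v v' _ _ _ _ ?_
  have hsymm : ∀ i j k l, ∑ m, v m * conj (α k l m) * α i j m
      = ∑ m, v' m * conj (α' k l m) * α' i j m := by
    intro i j k l
    have := hc i j k l
    simp only [mul_right_comm] at this ⊢
    exact this
  rintro (i | i) - (j | j) - hij
  · have hij' : i ≠ j := fun h => hij (by rw [h])
    simp only [Sum.elim_inl]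
    rw [h _ _ _ _ (σ.injective.ne hij') hij', h' _ _ _ _ (σ.injective.ne hij') hij']
  · exact hc _ _ _ _
  · exact hsymm _ _ _ _
  · have hij' : i ≠ j := fun h => hij (by rw [h])
    simp only [Sum.elim_inr]
    rw [h.conj (τ.injective.ne hij') hij', h'.conj (τ.injective.ne hij') hij']

/-- The mean of the permanent of a circular perturbation. -/
theorem integral_permanent_of_pseudoUncorrelated {M ι : Type*} [Fintype M] [Fintype ι]
    [DecidableEq ι] {v : M → ℝ≥0} (A : Matrix ι ι ℂ) {α : ι → ι → M → ℂ}
    (h : PseudoUncorrelated v α) :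
    ∫ x, (affMatrix A α x).permanent ∂gaussPi v = A.permanent := by
  unfold Matrix.permanent
  rw [integral_finsetSum _ fun σ _ => integrable_prod_affForm v (fun i => A (σ i) i)
    (fun i => α (σ i) i) Finset.univ]
  refine Finset.sum_congr rfl fun σ _ => ?_
  have := integral_prod_affForm_congr v v (fun i => A (σ i) i) (fun i => α (σ i) i)
    (fun _ _ => 0) Finset.univ (fun i _ j _ hij => by
      rw [h _ _ _ _ (σ.injective.ne hij) hij]; simp)
  simp only [affMatrix, Matrix.of_apply]
  rw [this]
  simp [affForm]

theorem normSq_integral_le {X : Type*} [MeasurableSpace X] {μ : Measure X} [IsProbabilityMeasure μ]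
    {f : X → ℂ} (hf : Integrable f μ) (hf2 : Integrable (fun x => ‖f x‖ ^ 2) μ) :
    ‖∫ x, f x ∂μ‖ ^ 2 ≤ ∫ x, ‖f x‖ ^ 2 ∂μ := by
  have h1 : ‖∫ x, f x ∂μ‖ ≤ ∫ x, ‖f x‖ ∂μ := norm_integral_le_integral_norm f
  have h2 : (∫ x, ‖f x‖ ∂μ) ^ 2 ≤ ∫ x, ‖f x‖ ^ 2 ∂μ := by
    have := (convexOn_pow 2).map_integral_le (μ := μ) (f := fun x => ‖f x‖)
      (continuous_pow 2).continuousOn isClosed_Ici (ae_of_all _ fun x => norm_nonneg (f x))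
      hf.norm hf2
    simpa using this
  exact (pow_le_pow_left₀ (norm_nonneg _) h1 2).trans h2

theorem gaussPi_sum {M M' : Type*} [Fintype M] [Fintype M'] (v : M → ℝ≥0) (v' : M' → ℝ≥0) :
    MeasurePreserving (fun p : (M → ℝ) × (M' → ℝ) => (Sum.elim p.1 p.2 : M ⊕ M' → ℝ))
      ((gaussPi v).prod (gaussPi v')) (gaussPi (Sum.elim v v')) := by
  have := (measurePreserving_sumPiEquivProdPi_symm
    (fun i : M ⊕ M' => gaussianReal 0 (Sum.elim v v' i)))
  convert! this using 1

/-- Adding independent circular noise increases the second moment of a permanent. -/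
theorem integral_normSq_permanent_le_add_noise {M M' ι : Type*} [Fintype M] [Fintype M']
    [Fintype ι] [DecidableEq ι] (v : M → ℝ≥0) (v' : M' → ℝ≥0) (A : Matrix ι ι ℂ)
    (α : ι → ι → M → ℂ) {α' : ι → ι → M' → ℂ} (h' : PseudoUncorrelated v' α') :
    ∫ x, ‖(affMatrix A α x).permanent‖ ^ 2 ∂gaussPi v
      ≤ ∫ x, ‖(affMatrix A (fun i j => Sum.elim (α i j) (α' i j)) x).permanent‖ ^ 2
          ∂gaussPi (Sum.elim v v') := by
  have hmp := gaussPi_sum v v'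
  have hI := integrable_normSq_permanent (Sum.elim v v') A (fun i j => Sum.elim (α i j) (α' i j))
  have e1 : ∫ x, ‖(affMatrix A (fun i j => Sum.elim (α i j) (α' i j)) x).permanent‖ ^ 2
          ∂gaussPi (Sum.elim v v')
      = ∫ p, ‖(affMatrix A (fun i j => Sum.elim (α i j) (α' i j)) (Sum.elim p.1 p.2)).permanent‖ ^ 2
          ∂((gaussPi v).prod (gaussPi v')) := by
    rw [← hmp.map_eq] at hI ⊢
    exact integral_map hmp.measurable.aemeasurable hI.aestronglyMeasurable
  have hI' : Integrable (fun p : (M → ℝ) × (M' → ℝ) => ‖(affMatrix A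
      (fun i j => Sum.elim (α i j) (α' i j)) (Sum.elim p.1 p.2)).permanent‖ ^ 2)
      ((gaussPi v).prod (gaussPi v')) := hmp.integrable_comp_of_integrable hI
  rw [e1, integral_prod _ hI']
  have split : ∀ x y, affMatrix A (fun i j => Sum.elim (α i j) (α' i j)) (Sum.elim x y)
      = affMatrix (affMatrix A α x) α' y := by
    intro x y
    ext i j
    simp [affMatrix, affForm, add_assoc]
  -- With the original variables fixed, the noisy permanent has mean equal to the original one, so
  -- Jensen applies pointwise in `x`.
  refine integral_mono (integrable_normSq_permanent v A α) hI'.integral_prod_left fun x => ?_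
  simp only [split]
  rw [← integral_permanent_of_pseudoUncorrelated (affMatrix A α x) h']
  exact normSq_integral_le (integrable_permanent_affMatrix v' _ _)
    (integrable_normSq_permanent v' _ _)

/-- The form `inl k` can be contracted only with `inr k`, so the Wick sum factors over k: each pair
is either left uncontracted or contracted. -/
theorem integral_prod_paired {M ι : Type*} [Fintype M] [DecidableEq ι] (v : M → ℝ≥0)
    (a : ι ⊕ ι → ℂ) (α : ι ⊕ ι → M → ℂ) (τ : ι → ℂ) (S : Finset ι)
    (hl : ∀ i j, i ≠ j → ∑ m, v m * α (.inl i) m * α (.inl j) m = 0)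
    (hr : ∀ i j, i ≠ j → ∑ m, v m * α (.inr i) m * α (.inr j) m = 0)
    (hlr : ∀ i j, ∑ m, v m * α (.inl i) m * α (.inr j) m = if i = j then τ i else 0) :
    ∫ x, ∏ i ∈ S.disjSum S, affForm (a i) (α i) x ∂gaussPi v
      = ∏ i ∈ S, (a (.inl i) * a (.inr i) + τ i) := by
  induction S using Finset.induction_on with
  | empty => simp
  | insert k S hk ih =>
    have hrl : ∀ i j, ∑ m, v m * α (.inr i) m * α (.inl j) m = if i = j then τ i else 0 := by
      intro i j
      have := hlr j i
      simp only [mul_right_comm] at this ⊢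
      rw [this]
      by_cases h : i = j
      · subst h; rfl
      · rw [if_neg h, if_neg (Ne.symm h)]
    have e1 : (insert k S).disjSum (insert k S)
        = insert (Sum.inl k) (insert (Sum.inr k) (S.disjSum S)) := by
      ext (i | i) <;> simp
    have n1 : Sum.inl k ∉ insert (Sum.inr k) (S.disjSum S) := by simp [hk]
    have n2 : Sum.inr k ∉ S.disjSum S := by simp [hk]
    rw [e1]
    simp only [Finset.prod_insert n1]
    rw [integral_affForm_mul_prod, Finset.sum_insert n2, Finset.erase_insert n2, hlr, if_pos rfl, ih]
    have z : ∑ i ∈ S.disjSum S, (∑ m, v m * α (.inl k) m * α i m)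
        * ∫ x, ∏ j ∈ (insert (Sum.inr k) (S.disjSum S)).erase i, affForm (a j) (α j) x ∂gaussPi v = 0 := by
      refine Finset.sum_eq_zero ?_
      rintro (i | i) hi
      · rw [hl k i (by rintro rfl; simp [hk] at hi), zero_mul]
      · rw [hlr k i, if_neg (by rintro rfl; simp [hk] at hi), zero_mul]
    have z2 : ∑ i ∈ S.disjSum S, (∑ m, v m * α (.inr k) m * α i m)
        * ∫ x, ∏ j ∈ (S.disjSum S).erase i, affForm (a j) (α j) x ∂gaussPi v = 0 := by
      refine Finset.sum_eq_zero ?_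
      rintro (i | i) hi
      · rw [hrl k i, if_neg (by rintro rfl; simp [hk] at hi), zero_mul]
      · rw [hr k i (by rintro rfl; simp [hk] at hi), zero_mul]
    rw [z]
    simp only [Finset.prod_insert n2]
    rw [integral_affForm_mul_prod, z2, ih, Finset.prod_insert hk]
    ring

theorem card_perm_fixing {ι : Type*} [Fintype ι] [DecidableEq ι] (A : Finset ι) :
    (Finset.univ.filter fun π : Equiv.Perm ι => ∀ i ∈ A, π i = i).card
      = (Fintype.card ι - A.card).factorial := by
  have e := Fintype.card_congr (Equiv.Perm.subtypeEquivSubtypePerm (fun i => i ∉ A))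
  rw [Fintype.card_perm, Fintype.card_subtype_compl, Fintype.card_coe] at e
  rw [e, Fintype.card_subtype]
  simp

/-- Expand the product over the subset A of positions where T is chosen. The (n - |A|)! permutations
fixing A contribute, and C(n,k) (n-k)! T^k c^(n-k) = n! c^n (T/c)^k / k! sums to a partial
exponential series. -/
theorem sum_perm_prod_fixed_le {ι : Type*} [Fintype ι] [DecidableEq ι] {c T : ℝ} (hc : 0 < c)
    (hT : 0 ≤ T) :
    ∑ π : Equiv.Perm ι, ∏ i, (c + if π i = i then T else 0)
      ≤ (Fintype.card ι).factorial * c ^ Fintype.card ι * Real.exp (T / c) := by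
  have e1 : ∀ π : Equiv.Perm ι, ∏ i, (c + if π i = i then T else 0)
      = ∑ A ∈ (Finset.univ : Finset ι).powerset,
          if ∀ i ∈ A, π i = i then T ^ A.card * c ^ (Fintype.card ι - A.card) else 0 := by
    intro π
    rw [show ∏ i, (c + if π i = i then T else 0) = ∏ i, ((if π i = i then T else 0) + c) from
      Finset.prod_congr rfl fun i _ => add_comm _ _, Finset.prod_add]
    refine Finset.sum_congr rfl fun A _ => ?_
    split_ifs with h
    · rw [Finset.prod_congr rfl fun i hi => if_pos (h i hi), Finset.prod_const, Finset.prod_const,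
        Finset.card_sdiff_of_subset (Finset.subset_univ A), Finset.card_univ]
    · push Not at h
      obtain ⟨i, hi, h⟩ := h
      rw [Finset.prod_eq_zero hi (if_neg h), zero_mul]
  simp only [e1]
  rw [Finset.sum_comm]
  have e2 : ∀ A ∈ (Finset.univ : Finset ι).powerset, ∑ π : Equiv.Perm ι,
      (if ∀ i ∈ A, π i = i then T ^ A.card * c ^ (Fintype.card ι - A.card) else 0)
      = (fun k => (Fintype.card ι - k).factorial * (T ^ k * c ^ (Fintype.card ι - k))) A.card := by
    intro A _
    rw [← Finset.sum_filter, Finset.sum_const, card_perm_fixing, nsmul_eq_mul]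
  rw [Finset.sum_congr rfl e2, Finset.sum_powerset_apply_card
    (fun k => (Fintype.card ι - k).factorial * (T ^ k * c ^ (Fintype.card ι - k))), Finset.card_univ]
  have e3 : ∀ k ∈ Finset.range (Fintype.card ι + 1),
      (Fintype.card ι).choose k • ((Fintype.card ι - k).factorial * (T ^ k * c ^ (Fintype.card ι - k)))
      = (Fintype.card ι).factorial * c ^ Fintype.card ι * ((T / c) ^ k / k.factorial) := by
    intro k hk
    have hk' : k ≤ Fintype.card ι := Nat.lt_succ_iff.1 (Finset.mem_range.1 hk)
    have h1 := Nat.choose_mul_factorial_mul_factorial hk'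
    have h2 : c ^ Fintype.card ι = c ^ k * c ^ (Fintype.card ι - k) := by
      rw [← pow_add, Nat.add_sub_cancel' hk']
    rw [← h1, h2, nsmul_eq_mul, div_pow]
    push_cast
    have : (k.factorial : ℝ) ≠ 0 := by positivity
    field_simp
  rw [Finset.sum_congr rfl e3, ← Finset.mul_sum]
  exact mul_le_mul_of_nonneg_left (Real.sum_le_exp_of_nonneg (by positivity) _) (by positivity)

/-- The coefficients expressing the entries of a matrix of independent circular Gaussian variables
through their real and imaginary parts. -/
def ginibreCoeff {ι : Type*} [DecidableEq ι] (i j : ι) (m : (ι × ι) × Bool) : ℂ :=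
  if m.1 = (i, j) then (if m.2 then Complex.I else 1) else 0

theorem sum_ginibreCoeff {ι : Type*} [Fintype ι] [DecidableEq ι] (T : ℝ≥0) (i j k l : ι) :
    ∑ m, ((T / 2 : ℝ≥0) : ℂ) * ginibreCoeff i j m * ginibreCoeff k l m = 0 := by
  rw [Fintype.sum_prod_type, Finset.sum_eq_single (i, j)]
  · simp only [ginibreCoeff, Fintype.sum_bool]
    by_cases h : (i, j) = (k, l)
    · simp [h, mul_assoc]
    · simp [h]
  · intro b _ hb
    simp [ginibreCoeff, hb]
  · simp

theorem sum_ginibreCoeff_conj {ι : Type*} [Fintype ι] [DecidableEq ι] (T : ℝ≥0) (i j k l : ι) :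
    ∑ m, ((T / 2 : ℝ≥0) : ℂ) * ginibreCoeff i j m * conj (ginibreCoeff k l m)
      = if (i, j) = (k, l) then (T : ℂ) else 0 := by
  rw [Fintype.sum_prod_type, Finset.sum_eq_single (i, j)]
  · simp only [ginibreCoeff, Fintype.sum_bool]
    by_cases h : (i, j) = (k, l)
    · simp only [if_true, h]
      simp [mul_assoc]
    · simp [h]
  · intro b _ hb
    simp [ginibreCoeff, hb]
  · simp

/-- For independent entries, column i contributes c², plus T when both permutations pick the same
row there. Writing τ = σπ reduces the double sum to n! times a sum over the fixed points of π. -/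
theorem integral_normSq_permanent_ginibre_le {ι : Type*} [Fintype ι] [DecidableEq ι] {c : ℝ}
    (hc : 0 < c) (T : ℝ≥0) :
    ∫ x, ‖(affMatrix (Matrix.of fun _ _ : ι => (c : ℂ)) ginibreCoeff x).permanent‖ ^ 2
        ∂gaussPi (fun _ => T / 2)
      ≤ ((Fintype.card ι).factorial * c ^ Fintype.card ι) ^ 2 * Real.exp (T / c ^ 2) := by
  have e : ∫ x, ‖(affMatrix (Matrix.of fun _ _ : ι => (c : ℂ)) ginibreCoeff x).permanent‖ ^ 2
        ∂gaussPi (fun _ => T / 2)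
      = ∑ σ : Equiv.Perm ι, ∑ τ : Equiv.Perm ι, ∏ i, (c ^ 2 + if σ i = τ i then (T : ℝ) else 0) := by
    rw [← Complex.ofReal_inj, integral_normSq_permanent, integral_permanent_mul_conj]
    push_cast
    refine Finset.sum_congr rfl fun σ _ => Finset.sum_congr rfl fun τ _ => ?_
    rw [integral_prod_paired (fun _ => T / 2) _ _ (fun i => if σ i = τ i then (T : ℂ) else 0)]
    · refine Finset.prod_congr rfl fun i _ => ?_
      split_ifs <;> simp [sq]
    · intro i j _
      exact sum_ginibreCoeff T _ _ _ _
    · intro i j hij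
      exact PseudoUncorrelated.conj (v := fun _ => T / 2)
        (fun i j k l _ _ => sum_ginibreCoeff T i j k l) (τ.injective.ne hij) hij
    · intro i j
      simp only [Sum.elim_inl, Sum.elim_inr]
      rw [sum_ginibreCoeff_conj]
      by_cases h : i = j
      · subst h; simp
      · simp [h]
  rw [e]
  have e2 : ∀ σ : Equiv.Perm ι, ∑ τ : Equiv.Perm ι, ∏ i, (c ^ 2 + if σ i = τ i then (T : ℝ) else 0)
      = ∑ π : Equiv.Perm ι, ∏ i, (c ^ 2 + if π i = i then (T : ℝ) else 0) := by
    intro σ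
    rw [← Equiv.sum_comp (Equiv.mulLeft σ)]
    refine Finset.sum_congr rfl fun π _ => Finset.prod_congr rfl fun i _ => ?_
    simp only [Equiv.coe_mulLeft, Equiv.Perm.coe_mul, Function.comp_apply, σ.injective.eq_iff,
      eq_comm (a := i)]
  rw [Finset.sum_congr rfl fun σ _ => e2 σ, Finset.sum_const, Finset.card_univ, Fintype.card_perm,
    nsmul_eq_mul]
  have := sum_perm_prod_fixed_le (ι := ι) (c := c ^ 2) (T := T) (by positivity) T.2
  calc ((Fintype.card ι).factorial : ℝ) * _ ≤ (Fintype.card ι).factorial * _ :=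
        mul_le_mul_of_nonneg_left this (by positivity)
    _ = _ := by ring

/-- A Gaussian matrix that becomes, after adding circular noise, as correlated as one with
independent entries of variance `T`. -/
theorem integral_normSq_permanent_le {M M' ι : Type*} [Fintype M] [Fintype M'] [Fintype ι]
    [DecidableEq ι] {v : M → ℝ≥0} {v' : M' → ℝ≥0} {α : ι → ι → M → ℂ} {α' : ι → ι → M' → ℂ}
    {c : ℝ} (hc : 0 < c) (T : ℝ≥0) (h : PseudoUncorrelated v α) (h' : PseudoUncorrelated v' α')
    (hT : ∀ i j k l, ∑ m, v m * α i j m * conj (α k l m) + ∑ m, v' m * α' i j m * conj (α' k l m)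
      = if (i, j) = (k, l) then (T : ℂ) else 0) :
    ∫ x, ‖(affMatrix (Matrix.of fun _ _ : ι => (c : ℂ)) α x).permanent‖ ^ 2 ∂gaussPi v
      ≤ ((Fintype.card ι).factorial * c ^ Fintype.card ι) ^ 2 * Real.exp (T / c ^ 2) := by
  refine (integral_normSq_permanent_le_add_noise v v' _ α h').trans ?_
  rw [integral_normSq_permanent_congr (v' := fun _ => T / 2) (α' := ginibreCoeff)]
  · exact integral_normSq_permanent_ginibre_le hc T
  · intro i j k l hik hjl
    simp only [Fintype.sum_sum_type, Sum.elim_inl, Sum.elim_inr]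
    rw [h i j k l hik hjl, h' i j k l hik hjl, add_zero]
  · intro i j k l _ _
    exact sum_ginibreCoeff T i j k l
  · intro i j k l
    simp only [Fintype.sum_sum_type, Sum.elim_inl, Sum.elim_inr]
    rw [hT, sum_ginibreCoeff_conj]

end PermanentMoments

/-! ### Exponential tilting of Gaussian measures -/

section Tilt

open scoped NNReal ENNReal

/-- Completing the square: the hypothesis `h` says 1/v' = 1/v - 2c, and the linear term moves the
mean to -2lv'. -/
theorem withDensity_gaussianReal {v v' : ℝ≥0} (hv : v ≠ 0) (hv' : v' ≠ 0) (l c : ℝ)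
    (h : (v' : ℝ) * (1 - 2 * c * v) = v) :
    (gaussianReal 0 v).withDensity
        (fun x => ENNReal.ofReal (Real.exp (-2 * l * x + c * x ^ 2)))
      = ENNReal.ofReal (√(v' / v) * Real.exp (2 * l ^ 2 * v'))
          • gaussianReal (-2 * l * v') v' := by
  rw [gaussianReal_of_var_ne_zero _ hv, gaussianReal_of_var_ne_zero _ hv',
    ← withDensity_mul _ (measurable_gaussianPDF 0 v) (by fun_prop),
    ← withDensity_smul _ (measurable_gaussianPDF _ _)]
  congr 1
  ext x
  have p : (0 : ℝ) < v := by positivity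
  have p' : (0 : ℝ) < v' := by positivity
  simp only [Pi.mul_apply, Pi.smul_apply, smul_eq_mul, gaussianPDF_def]
  rw [← ENNReal.ofReal_mul (gaussianPDFReal_nonneg _ _ _), ← ENNReal.ofReal_mul (by positivity)]
  congr 1
  rw [gaussianPDFReal_def, gaussianPDFReal_def]
  have e1 : √((v' : ℝ) / v) * (√(2 * Real.pi * v'))⁻¹ = (√(2 * Real.pi * v))⁻¹ := by
    rw [Real.sqrt_div p'.le, Real.sqrt_mul (by positivity) (v' : ℝ),
      Real.sqrt_mul (by positivity) (v : ℝ)]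
    have := (Real.sqrt_pos.2 p').ne'
    field_simp
  have e2 : -(x - 0) ^ 2 / (2 * (v : ℝ)) + (-2 * l * x + c * x ^ 2)
      = 2 * l ^ 2 * v' + -(x - -2 * l * v') ^ 2 / (2 * (v' : ℝ)) := by
    have h2 : c = (1 / v - 1 / v') / 2 := by
      field_simp
      linarith
    rw [h2]
    field_simp
    ring
  simp only []
  rw [mul_assoc, ← Real.exp_add, e2, Real.exp_add, ← e1]
  ring

theorem withDensity_pi_prod {M : Type*} [Fintype M] {X : M → Type*} [∀ m, MeasurableSpace (X m)]
    (μ μ' : ∀ m, Measure (X m)) [∀ m, IsProbabilityMeasure (μ m)]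
    [∀ m, IsProbabilityMeasure (μ' m)] {w : ∀ m, X m → ℝ≥0∞} (hw : ∀ m, Measurable (w m))
    (N : M → ℝ≥0∞) (hN : ∀ m, N m ≠ ∞) (h : ∀ m, (μ m).withDensity (w m) = N m • μ' m) :
    (Measure.pi μ).withDensity (fun x => ∏ m, w m (x m)) = (∏ m, N m) • Measure.pi μ' := by
  have hfin : ∀ m, IsFiniteMeasure (N m • μ' m) := fun m => Measure.smul_finite _ (hN m)
  have h1 : Measure.pi (fun m => N m • μ' m) = (∏ m, N m) • Measure.pi μ' := by
    refine Measure.pi_eq fun s hs => ?_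
    simp [Measure.pi_pi, Finset.prod_mul_distrib]
  rw [← h1]
  refine (Measure.pi_eq fun s hs => ?_).symm
  rw [withDensity_apply _ (MeasurableSet.univ_pi hs),
    ← lintegral_indicator (MeasurableSet.univ_pi hs)]
  have e : (Set.univ.pi s).indicator (fun x : ∀ m, X m => ∏ m, w m (x m))
      = fun x => ∏ m, (s m).indicator (w m) (x m) := by
    ext x
    by_cases hx : x ∈ Set.univ.pi s
    · rw [Set.indicator_of_mem hx]
      exact Finset.prod_congr rfl fun m _ => (Set.indicator_of_mem (hx m trivial) _).symm
    · rw [Set.indicator_of_notMem hx]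
      simp only [Set.mem_pi, Set.mem_univ, true_imp_iff, not_forall] at hx
      obtain ⟨m, hm⟩ := hx
      rw [Finset.prod_eq_zero (Finset.mem_univ m) (Set.indicator_of_notMem hm _)]
  rw [e]
  have hind := iIndepFun_pi (μ := μ) (X := fun m => (s m).indicator (w m))
    (fun m => ((hw m).indicator (hs m)).aemeasurable)
  have := lintegral_prod_eq_prod_lintegral_of_indepFun Finset.univ
    (fun m (x : ∀ m, X m) => (s m).indicator (w m) (x m)) hind
    (fun m => ((hw m).indicator (hs m)).comp (measurable_pi_apply m))
  rw [this]
  refine Finset.prod_congr rfl fun m _ => ?_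
  rw [← h m, withDensity_apply _ (hs m), ← lintegral_indicator (hs m)]
  exact (measurePreserving_eval μ m).lintegral_comp ((hw m).indicator (hs m))

/-- Change of measure coordinate by coordinate. The new mean is moved into the argument of `g`, so
that the law on the right is again centred. -/
theorem lintegral_gaussPi_tilt {M : Type*} [Fintype M] {v v' : M → ℝ≥0} (hv : ∀ m, v m ≠ 0)
    (hv' : ∀ m, v' m ≠ 0) (l c : M → ℝ) (h : ∀ m, (v' m : ℝ) * (1 - 2 * c m * v m) = v m)
    {g : (M → ℝ) → ℝ≥0∞} (hg : Measurable g) :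
    ∫⁻ x, g x * ENNReal.ofReal (Real.exp (∑ m, (-2 * l m * x m + c m * x m ^ 2))) ∂gaussPi v
      = ENNReal.ofReal (∏ m, (√(v' m / v m) * Real.exp (2 * l m ^ 2 * v' m)))
        * ∫⁻ x, g (fun m => x m + -2 * l m * v' m) ∂gaussPi v' := by
  have h1 := withDensity_pi_prod (fun m => gaussianReal 0 (v m))
    (fun m => gaussianReal (-2 * l m * v' m) (v' m))
    (w := fun m x => ENNReal.ofReal (Real.exp (-2 * l m * x + c m * x ^ 2))) (fun m => by fun_prop)
    (fun m => ENNReal.ofReal (√(v' m / v m) * Real.exp (2 * l m ^ 2 * v' m)))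
    (fun m => ENNReal.ofReal_ne_top)
    (fun m => withDensity_gaussianReal (hv m) (hv' m) (l m) (c m) (h m))
  have e : ∀ x : M → ℝ, ENNReal.ofReal (Real.exp (∑ m, (-2 * l m * x m + c m * x m ^ 2)))
      = ∏ m, ENNReal.ofReal (Real.exp (-2 * l m * x m + c m * x m ^ 2)) := by
    intro x
    rw [Real.exp_sum, ENNReal.ofReal_prod_of_nonneg fun _ _ => (Real.exp_pos _).le]
  have h2 : MeasurePreserving (fun (x : M → ℝ) m => x m + -2 * l m * v' m) (gaussPi v')
      (Measure.pi fun m => gaussianReal (-2 * l m * v' m) (v' m)) := by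
    refine measurePreserving_pi (fun m => gaussianReal 0 (v' m)) _
      (f := fun m x => x + -2 * l m * v' m) fun m => ⟨by fun_prop, ?_⟩
    rw [gaussianReal_map_add_const, zero_add]
  rw [ENNReal.ofReal_prod_of_nonneg fun _ _ => by positivity, h2.lintegral_comp hg,
    ← smul_eq_mul, ← lintegral_smul_measure, ← h1,
    lintegral_withDensity_eq_lintegral_mul _ (by fun_prop) hg]
  refine lintegral_congr fun x => ?_
  rw [e, Pi.mul_apply, mul_comm]

theorem affForm_add {M : Type*} [Fintype M] (a : ℂ) (α : M → ℂ) (x d : M → ℝ) :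
    affForm a α (fun m => x m + d m) = affForm (a + ∑ m, α m * (d m : ℂ)) α x := by
  simp only [affForm, Complex.ofReal_add, mul_add, Finset.sum_add_distrib]
  ring

end Tilt

/-! ### The tilted second moment in orthogonal coordinates -/

section Modes

open scoped NNReal ENNReal ComplexConjugate


/-- Coefficients of the entry `(i, j)` of `O w Oᵀ` in the real and imaginary parts of `w`. -/
def modeCoeff {ι : Type*} (O : Matrix ι ι ℝ) (i j : ι) (m : (ι × ι) × Bool) : ℂ :=
  (O i m.1.1 * O j m.1.2 : ℝ) * (if m.2 then Complex.I else 1)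

theorem sum_modeCoeff {ι : Type*} [Fintype ι] [DecidableEq ι] (O : Matrix ι ι ℝ) (v : (ι × ι) × Bool → ℝ≥0) (i j k l : ι) :
    ∑ m, v m * modeCoeff O i j m * modeCoeff O k l m
      = ((∑ a, ∑ b, O i a * O k a * (O j b * O l b)
          * ((v ((a, b), false) : ℝ) - v ((a, b), true)) : ℝ) : ℂ) := by
  simp only [Fintype.sum_prod_type, Fintype.sum_bool, modeCoeff]
  push_cast
  refine Finset.sum_congr rfl fun a _ => Finset.sum_congr rfl fun b _ => ?_
  have hI : Complex.I * Complex.I = -1 := Complex.I_mul_I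
  linear_combination ((v ((a, b), true) : ℂ) * (O i a * O j b) * (O k a * O l b)) * hI

theorem sum_modeCoeff_conj {ι : Type*} [Fintype ι] [DecidableEq ι] (O : Matrix ι ι ℝ) (v : (ι × ι) × Bool → ℝ≥0) (i j k l : ι) :
    ∑ m, v m * modeCoeff O i j m * conj (modeCoeff O k l m)
      = ((∑ a, ∑ b, O i a * O k a * (O j b * O l b)
          * ((v ((a, b), false) : ℝ) + v ((a, b), true)) : ℝ) : ℂ) := by
  simp only [Fintype.sum_prod_type, Fintype.sum_bool, modeCoeff, map_mul, Complex.conj_ofReal]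
  push_cast
  refine Finset.sum_congr rfl fun a _ => Finset.sum_congr rfl fun b _ => ?_
  have hI : Complex.I * Complex.I = -1 := Complex.I_mul_I
  simp only [Complex.conj_I, map_one]
  linear_combination -((v ((a, b), true) : ℂ) * (O i a * O j b) * (O k a * O l b)) * hI

theorem sum_orthogonal {ι : Type*} [Fintype ι] [DecidableEq ι] {O : Matrix ι ι ℝ} (hO : O * O.transpose = 1) (i k : ι) :
    ∑ a, O i a * O k a = if i = k then 1 else 0 := by
  have := congrFun (congrFun hO i) k
  simpa [Matrix.mul_apply, Matrix.one_apply] using this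

/-- The relative tilt of the modes. -/
def modeTilt {ι : Type*} [DecidableEq ι] (a₀ : ι) (p y : ℝ) (ab : ι × ι) : ℝ :=
  if ab.1 = a₀ then (if ab.2 = a₀ then y else p) else if ab.2 = a₀ then p else 0

theorem modeTilt_nonneg {ι : Type*} [DecidableEq ι] {a₀ : ι} {p y : ℝ} (hp : 0 ≤ p) (hy : 0 ≤ y) (ab : ι × ι) :
    0 ≤ modeTilt a₀ p y ab := by
  unfold modeTilt; split_ifs <;> simp [hp, hy]

theorem modeTilt_le {ι : Type*} [DecidableEq ι] {a₀ : ι} {p y : ℝ} (hp : 0 ≤ p) (hy : p ≤ y) (ab : ι × ι) :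
    modeTilt a₀ p y ab ≤ y := by
  unfold modeTilt; split_ifs <;> linarith

/-- The quadratic exponent by which the modes are tilted. -/
def modeExponent {ι : Type*} [Fintype ι] [DecidableEq ι] (a₀ : ι) (t p y : ℝ) (x : (ι × ι) × Bool → ℝ) : ℝ :=
  -2 * (1 - y) * x ((a₀, a₀), false)
    + ∑ ab, modeTilt a₀ p y ab / t * (x (ab, false) ^ 2 - x (ab, true) ^ 2)

/-- The variances of the tilted modes. -/
def tiltedVar {ι : Type*} [DecidableEq ι] (a₀ : ι) (t p y : ℝ) (m : (ι × ι) × Bool) : ℝ :=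
  if m.2 then t / 2 / (1 + modeTilt a₀ p y m.1) else t / 2 / (1 - modeTilt a₀ p y m.1)

/-- The bound for the tilted second moment. -/
def tiltedBound (n : ℕ) (t p y : ℝ) : ℝ :=
  (1 - p ^ 2)⁻¹ ^ (n - 1) * √(1 - y ^ 2)⁻¹ * Real.exp ((1 - y) * t) * (1 - p) ^ (2 * n)
    * Real.exp (t / (1 - y ^ 2) / (1 - p) ^ 2)

theorem prod_modeTilt {ι : Type*} [Fintype ι] [DecidableEq ι] (a₀ : ι) (p y : ℝ) (F : ℝ → ℝ) (hF : F 0 = 1) :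
    ∏ ab, F (modeTilt a₀ p y ab) = F y * F p ^ (2 * (Fintype.card ι - 1)) := by
  rw [Fintype.prod_prod_type, ← Finset.mul_prod_erase _ _ (Finset.mem_univ a₀),
    ← Finset.mul_prod_erase _ _ (Finset.mem_univ a₀)]
  have h1 : ∀ b ∈ Finset.univ.erase a₀, F (modeTilt a₀ p y (a₀, b)) = F p := fun b hb => by
    simp [modeTilt, Finset.ne_of_mem_erase hb]
  have h2 : ∀ a ∈ Finset.univ.erase a₀, ∏ b, F (modeTilt a₀ p y (a, b)) = F p := fun a ha => by
    rw [Finset.prod_eq_single a₀ (fun b _ hb => by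
      simp [modeTilt, Finset.ne_of_mem_erase ha, hb, hF]) (by simp)]
    simp [modeTilt, Finset.ne_of_mem_erase ha]
  rw [Finset.prod_congr rfl h1, Finset.prod_congr rfl h2, Finset.prod_const,
    Finset.card_erase_of_mem (Finset.mem_univ a₀), Finset.card_univ]
  simp only [modeTilt, if_true]
  ring

theorem sum_mode_const {ι : Type*} [Fintype ι] [DecidableEq ι] {O : Matrix ι ι ℝ} (hO : O * O.transpose = 1) (T : ℝ) (i j k l : ι) :
    ∑ a, ∑ b, O i a * O k a * (O j b * O l b) * T = if (i, j) = (k, l) then T else 0 := by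
  simp only [mul_assoc (_ * _) (_ * _) T, ← Finset.mul_sum, ← Finset.sum_mul, sum_orthogonal hO]
  by_cases h : i = k <;> by_cases h' : j = l <;> simp [h, h']

/-- A weight depending on a alone leaves the sum over b free, and orthogonality makes that sum
vanish for j ≠ l; symmetrically with i ≠ k. Hence pseudo-variances of this additive shape correlate
only entries sharing a row or a column, which a permanent never multiplies. -/
theorem sum_mode_cross {ι : Type*} [Fintype ι] [DecidableEq ι] {O : Matrix ι ι ℝ} (hO : O * O.transpose = 1) (a₀ : ι) (κ : ℝ)
    {i j k l : ι} (hik : i ≠ k) (hjl : j ≠ l) :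
    ∑ a, ∑ b, O i a * O k a * (O j b * O l b)
      * (κ * ((if a = a₀ then 1 else 0) + if b = a₀ then 1 else 0)) = 0 := by
  have e : ∀ a b, O i a * O k a * (O j b * O l b)
      * (κ * ((if a = a₀ then 1 else 0) + if b = a₀ then 1 else 0))
      = (κ * (if a = a₀ then 1 else 0) * (O i a * O k a)) * (O j b * O l b)
        + (O i a * O k a) * (κ * (if b = a₀ then 1 else 0) * (O j b * O l b)) := fun a b => by ring
  simp only [e, Finset.sum_add_distrib, ← Finset.mul_sum, sum_orthogonal hO, if_neg hjl]
  simp only [mul_zero, Finset.sum_const_zero]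
  rw [zero_add, ← Finset.sum_mul, sum_orthogonal hO, if_neg hik, zero_mul]

/-- The vector by which the tilt shifts the modes. -/
def modeShift {ι : Type*} [DecidableEq ι] (a₀ : ι) (y : ℝ) (m : (ι × ι) × Bool) : ℝ :=
  if m = ((a₀, a₀), false) then 1 - y else 0

/-- The coefficients of the squares in the exponent of the tilt. -/
def modeCurvature {ι : Type*} [DecidableEq ι] (a₀ : ι) (t p y : ℝ) (m : (ι × ι) × Bool) : ℝ :=
  if m.2 then -(modeTilt a₀ p y m.1 / t) else modeTilt a₀ p y m.1 / t

theorem modeExponent_eq_sum {ι : Type*} [Fintype ι] [DecidableEq ι] (a₀ : ι) (t p y : ℝ) (x : (ι × ι) × Bool → ℝ) :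
    modeExponent a₀ t p y x
      = ∑ m, (-2 * modeShift a₀ y m * x m + modeCurvature a₀ t p y m * x m ^ 2) := by
  rw [Finset.sum_add_distrib, modeExponent]
  congr 1
  · refine Eq.trans ?_ (Finset.sum_eq_single ((a₀, a₀), false) ?_ ?_).symm
    · simp [modeShift]
    · intro b _ hb
      simp [modeShift, hb]
    · simp
  · conv_rhs => rw [Fintype.sum_prod_type]
    refine Fintype.sum_congr _ _ fun ab => ?_
    simp only [Fintype.sum_bool, modeCurvature, if_true, Bool.false_eq_true, if_false]
    ring

theorem continuous_permanent_affMatrix {M ι : Type*} [Fintype M] [Fintype ι] [DecidableEq ι] (A : Matrix ι ι ℂ)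
    (α : ι → ι → M → ℂ) : Continuous fun x => (affMatrix A α x).permanent := by
  simp only [Matrix.permanent, affMatrix, affForm, Matrix.of_apply]
  fun_prop

theorem tiltedVar_pos {ι : Type*} [DecidableEq ι] {a₀ : ι} {t p y : ℝ} (ht : 0 < t) (hp : 0 ≤ p) (hpy : p ≤ y) (hy : y < 1)
    (m : (ι × ι) × Bool) : 0 < tiltedVar a₀ t p y m := by
  have h0 := modeTilt_nonneg (a₀ := a₀) hp (hp.trans hpy) m.1
  have h1 := modeTilt_le (a₀ := a₀) hp hpy m.1
  unfold tiltedVar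
  split_ifs
  · positivity
  · have : 0 < 1 - modeTilt a₀ p y m.1 := by linarith
    positivity

/-- The real and imaginary parts of a mode with tilt τ contribute (1 - τ)^(-1/2) (1 + τ)^(-1/2).
There are 2(n - 1) modes of tilt p and one of tilt y. The linear term lives only in the mode (a₀,
a₀) and gives 2(1 - y)² · (t/2)/(1 - y). -/
theorem prod_tilt_normalization {ι : Type*} [Fintype ι] [DecidableEq ι] {a₀ : ι} {t p y : ℝ} (ht : 0 < t) (hp : 0 ≤ p) (hpy : p ≤ y)
    (hy : y < 1) :
    ∏ m, (√(tiltedVar a₀ t p y m / (t / 2))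
        * Real.exp (2 * modeShift a₀ y m ^ 2 * tiltedVar a₀ t p y m))
      = (1 - p ^ 2)⁻¹ ^ (Fintype.card ι - 1) * √(1 - y ^ 2)⁻¹ * Real.exp ((1 - y) * t) := by
  rw [Finset.prod_mul_distrib, ← Real.exp_sum]
  congr 1
  · rw [Fintype.prod_prod_type]
    have e : ∀ ab : ι × ι, ∏ s, √(tiltedVar a₀ t p y (ab, s) / (t / 2))
        = √(1 - modeTilt a₀ p y ab ^ 2)⁻¹ := by
      intro ab
      have h0 := modeTilt_nonneg (a₀ := a₀) hp (hp.trans hpy) ab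
      have h1 : 0 < 1 - modeTilt a₀ p y ab := by
        linarith [modeTilt_le (a₀ := a₀) hp hpy ab]
      rw [Fintype.prod_bool, ← Real.sqrt_mul
        (div_nonneg (tiltedVar_pos ht hp hpy hy _).le (by positivity))]
      congr 1
      have h2 : 1 - modeTilt a₀ p y ab ^ 2 ≠ 0 := by nlinarith
      simp only [tiltedVar, if_true, Bool.false_eq_true, if_false]
      field_simp
      ring
    rw [Finset.prod_congr rfl fun ab _ => e ab,
      prod_modeTilt a₀ p y (fun τ => √(1 - τ ^ 2)⁻¹) (by simp), pow_mul, Real.sq_sqrt, mul_comm]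
    rw [inv_nonneg]
    nlinarith
  · rw [Finset.sum_eq_single ((a₀, a₀), false)]
    · have : 1 - y ≠ 0 := by linarith
      simp only [modeShift, tiltedVar, modeTilt, if_true, Bool.false_eq_true, if_false]
      field_simp
    · intro b _ hb
      simp [modeShift, hb]
    · simp

/-- Under the tilted law a mode of tilt τ has Hermitian variance t/(1 - τ²) and pseudo-variance
tτ/(1 - τ²). The equation `hy` makes the pseudo-variance at (a₀, a₀) twice that of the other modes
having one index a₀, which is the additive shape required by `sum_mode_cross`. -/
theorem lintegral_tilted_permanent_le {ι : Type*} [Fintype ι] [DecidableEq ι] {O : Matrix ι ι ℝ} (hO : O * O.transpose = 1) {a₀ : ι}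
    (hcol : ∀ i, O i a₀ * √(Fintype.card ι) = 1) {t p y : ℝ} (ht : 0 < t)
    (hp : p * Fintype.card ι = t) (hp1 : p < 1) (hpy : p ≤ y) (hy1 : y < 1)
    (hy : y / (1 - y ^ 2) = 2 * (p / (1 - p ^ 2))) :
    ∫⁻ x, ENNReal.ofReal (‖(affMatrix (Matrix.of fun _ _ => 1) (modeCoeff O) x).permanent‖ ^ 2)
        * ENNReal.ofReal (Real.exp (modeExponent a₀ t p y x)) ∂gaussPi (fun _ => (t / 2).toNNReal)
      ≤ ENNReal.ofReal ((Fintype.card ι).factorial ^ 2 * tiltedBound (Fintype.card ι) t p y) := by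
  have hn : (0 : ℝ) < Fintype.card ι := by
    have : 0 < Fintype.card ι := Fintype.card_pos_iff.2 ⟨a₀⟩
    exact_mod_cast this
  have hp0 : 0 ≤ p := by
    by_contra h
    have := mul_neg_of_neg_of_pos (not_le.1 h) hn
    linarith
  have ht2 : (((t / 2).toNNReal : ℝ≥0) : ℝ) = t / 2 := Real.coe_toNNReal _ (by positivity)
  have hv' : ∀ m, (((tiltedVar a₀ t p y m).toNNReal : ℝ≥0) : ℝ) = tiltedVar a₀ t p y m := fun m =>
    Real.coe_toNNReal _ (tiltedVar_pos ht hp0 hpy hy1 m).le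
  simp only [modeExponent_eq_sum]
  have hcont := continuous_permanent_affMatrix (Matrix.of fun _ _ => 1 : Matrix ι ι ℂ) (modeCoeff O)
  rw [lintegral_gaussPi_tilt (v' := fun m => (tiltedVar a₀ t p y m).toNNReal)
    (fun m => by simpa using ht)
    (fun m => by simpa using tiltedVar_pos ht hp0 hpy hy1 m) _ _ ?_
    (g := fun x => ENNReal.ofReal
      (‖(affMatrix (Matrix.of fun _ _ => 1) (modeCoeff O) x).permanent‖ ^ 2))
    (by have := hcont.measurable; fun_prop)]
  · simp only [ht2, hv']
    rw [prod_tilt_normalization ht hp0 hpy hy1]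
    -- The tilt shifts the real part of the mode (a₀, a₀) by -2(1 - y) · (t/2)/(1 - y) = -t. This
    -- mode enters every matrix entry with coefficient 1/n, so the mean drops from 1 to 1 - t/n = 1
    -- - p.
    have hmean : ∀ x : (ι × ι) × Bool → ℝ, affMatrix (Matrix.of fun _ _ => 1) (modeCoeff O)
        (fun m => x m + -2 * modeShift a₀ y m * tiltedVar a₀ t p y m)
        = affMatrix (Matrix.of fun _ _ => ((1 - p : ℝ) : ℂ)) (modeCoeff O) x := by
      intro x
      ext i j
      simp only [affMatrix, Matrix.of_apply]
      rw [affForm_add (d := fun m => -2 * modeShift a₀ y m * tiltedVar a₀ t p y m)]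
      congr 1
      rw [Finset.sum_eq_single ((a₀, a₀), false)]
      · simp only [modeCoeff, modeShift, tiltedVar, modeTilt, if_true, Bool.false_eq_true, if_false,
          mul_one, ← Complex.ofReal_mul]
        rw [← Complex.ofReal_one, ← Complex.ofReal_add]
        congr 1
        have h1 : 1 - y ≠ 0 := by linarith
        have h2 : O i a₀ * O j a₀ * Fintype.card ι = 1 := by
          have := congrArg₂ (· * ·) (hcol i) (hcol j)
          rw [mul_mul_mul_comm, Real.mul_self_sqrt hn.le] at this
          linarith
        rw [← hp]
        field_simp
        linear_combination (-p) * h2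
      · intro b _ hb
        simp [modeShift, hb]
      · simp
    simp only [hmean]
    rw [← ofReal_integral_eq_lintegral_ofReal (integrable_normSq_permanent _ _ _)
      (ae_of_all _ fun x => by positivity), ← ENNReal.ofReal_mul (by
        have : 0 < 1 - p ^ 2 := by nlinarith
        positivity)]
    refine ENNReal.ofReal_le_ofReal ?_
    have hy2 : 0 < 1 - y ^ 2 := by nlinarith
    have hT : (((t / (1 - y ^ 2)).toNNReal : ℝ≥0) : ℝ) = t / (1 - y ^ 2) :=
      Real.coe_toNNReal _ (by positivity)
    have hd : ∀ ab, 0 ≤ (t / (1 - y ^ 2) - t / (1 - modeTilt a₀ p y ab ^ 2)) / 2 := by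
      intro ab
      have h0 := modeTilt_nonneg (a₀ := a₀) hp0 (hp0.trans hpy) ab
      have h1 := modeTilt_le (a₀ := a₀) hp0 hpy ab
      have : t / (1 - modeTilt a₀ p y ab ^ 2) ≤ t / (1 - y ^ 2) := by
        gcongr
      linarith
    -- The target variance T = t/(1 - y²) is the largest among the modes. Circular noise, split
    -- equally between real and imaginary parts, fills each of the other modes up to T.
    have main := integral_normSq_permanent_le (v := fun m => (tiltedVar a₀ t p y m).toNNReal)
      (v' := fun m => ((t / (1 - y ^ 2) - t / (1 - modeTilt a₀ p y m.1 ^ 2)) / 2).toNNReal)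
      (α := modeCoeff O) (α' := modeCoeff O) (c := 1 - p) (by linarith)
      (t / (1 - y ^ 2)).toNNReal ?_ ?_ ?_
    · rw [hT] at main
      calc _ ≤ (1 - p ^ 2)⁻¹ ^ (Fintype.card ι - 1) * √(1 - y ^ 2)⁻¹ * Real.exp ((1 - y) * t)
            * (((Fintype.card ι).factorial * (1 - p) ^ Fintype.card ι) ^ 2
              * Real.exp (t / (1 - y ^ 2) / (1 - p) ^ 2)) := by
            refine mul_le_mul_of_nonneg_left main ?_
            have : 0 < 1 - p ^ 2 := by nlinarith
            positivity
        _ = _ := by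
            unfold tiltedBound
            ring
    · intro i j k l hik hjl
      rw [sum_modeCoeff]
      have e : ∀ a b, (((tiltedVar a₀ t p y ((a, b), false)).toNNReal : ℝ≥0) : ℝ)
          - (tiltedVar a₀ t p y ((a, b), true)).toNNReal
          = (t * (p / (1 - p ^ 2))) * ((if a = a₀ then 1 else 0) + if b = a₀ then 1 else 0) := by
        intro a b
        rw [hv', hv']
        have key : ∀ τ : ℝ, 0 ≤ τ → τ < 1 → t / 2 / (1 - τ) - t / 2 / (1 + τ)
            = t * (τ / (1 - τ ^ 2)) := by
          intro τ h0 h1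
          have h2 : 1 - τ ≠ 0 := by linarith
          have h3 : 1 + τ ≠ 0 := by linarith
          have h4 : 1 - τ ^ 2 ≠ 0 := by nlinarith
          field_simp
          ring
        simp only [tiltedVar, if_true, Bool.false_eq_true, if_false]
        rw [key _ (modeTilt_nonneg hp0 (hp0.trans hpy) _)
          ((modeTilt_le hp0 hpy _).trans_lt hy1)]
        unfold modeTilt
        by_cases ha : a = a₀ <;> by_cases hb : b = a₀ <;> simp [ha, hb]
        rw [hy]; ring
      simp only [e]
      rw [sum_mode_cross hO a₀ _ hik hjl, Complex.ofReal_zero]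
    · intro i j k l _ _
      rw [sum_modeCoeff]
      simp
    · intro i j k l
      rw [sum_modeCoeff_conj, sum_modeCoeff_conj, ← Complex.ofReal_add]
      simp only [← Finset.sum_add_distrib, ← mul_add]
      have e : ∀ a b, (((tiltedVar a₀ t p y ((a, b), false)).toNNReal : ℝ≥0) : ℝ)
          + (tiltedVar a₀ t p y ((a, b), true)).toNNReal
          + ((((t / (1 - y ^ 2) - t / (1 - modeTilt a₀ p y (a, b) ^ 2)) / 2).toNNReal : ℝ≥0)
          + (((t / (1 - y ^ 2) - t / (1 - modeTilt a₀ p y (a, b) ^ 2)) / 2).toNNReal : ℝ≥0) : ℝ)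
          = t / (1 - y ^ 2) := by
        intro a b
        have h0 := modeTilt_nonneg (a₀ := a₀) hp0 (hp0.trans hpy) (a, b)
        have h1 : modeTilt a₀ p y (a, b) < 1 := (modeTilt_le hp0 hpy _).trans_lt hy1
        rw [hv', hv', Real.coe_toNNReal _ (hd (a, b))]
        have h2 : 1 - modeTilt a₀ p y (a, b) ≠ 0 := by linarith
        have h4 : 1 - modeTilt a₀ p y (a, b) ^ 2 ≠ 0 := by nlinarith
        simp only [tiltedVar, if_true, Bool.false_eq_true, if_false]
        field_simp
        ring
      simp only [e]
      rw [sum_mode_const hO]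
      have e' : ((t / (1 - y ^ 2)).toNNReal : ℂ) = ((t / (1 - y ^ 2) : ℝ) : ℂ) :=
        congrArg _ hT
      rw [e']
      split_ifs <;> simp
  · intro m
    rw [hv', ht2]
    have h0 := modeTilt_nonneg (a₀ := a₀) hp0 (hp0.trans hpy) m.1
    have h1 : modeTilt a₀ p y m.1 < 1 := (modeTilt_le hp0 hpy _).trans_lt hy1
    have h2 : 1 - modeTilt a₀ p y m.1 ≠ 0 := by linarith
    unfold tiltedVar modeCurvature
    split_ifs
    · field_simp
      ring
    · field_simp

end Modes

/-! ### Gaussian matrices in orthogonal coordinates -/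

section Law

open scoped NNReal ENNReal ComplexConjugate

theorem map_prod_gaussianReal_eq_complexGaussian {ν : ℝ} (hν : 0 < ν) :
    ((gaussianReal 0 (ν / 2).toNNReal).prod (gaussianReal 0 (ν / 2).toNNReal)).map
      Complex.measurableEquivRealProd.symm = complexGaussian ν := by
  have hv : (ν / 2).toNNReal ≠ 0 := by simpa using hν
  have hv2 : (((ν / 2).toNNReal : ℝ≥0) : ℝ) = ν / 2 := Real.coe_toNNReal _ (by positivity)
  rw [gaussianReal_of_var_ne_zero _ hv, prod_withDensity (measurable_gaussianPDF _ _)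
    (measurable_gaussianPDF _ _)]
  have hvol : Measure.map Complex.measurableEquivRealProd.symm
      ((volume : Measure ℝ).prod (volume : Measure ℝ)) = (volume : Measure ℂ) :=
    (Complex.volume_preserving_equiv_real_prod.symm _).map_eq
  unfold complexGaussian
  refine Measure.ext fun s hs => ?_
  have hm : Measurable (fun w : ℂ => ENNReal.ofReal (Real.exp (-‖w‖ ^ 2 / ν) / (Real.pi * ν))) := by
    fun_prop
  rw [Measure.map_apply Complex.measurableEquivRealProd.symm.measurable hs,
    withDensity_apply _ (Complex.measurableEquivRealProd.symm.measurable hs),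
    withDensity_apply _ hs, ← hvol,
    setLIntegral_map hs hm Complex.measurableEquivRealProd.symm.measurable]
  refine lintegral_congr fun p => ?_
  rw [gaussianPDF_def, ← ENNReal.ofReal_mul (gaussianPDFReal_nonneg _ _ _)]
  congr 1
  rw [gaussianPDFReal_def]
  simp only []
  have e : ‖Complex.measurableEquivRealProd.symm p‖ ^ 2 = p.1 ^ 2 + p.2 ^ 2 := by
    rw [← Complex.normSq_eq_norm_sq, Complex.normSq_apply]
    simp only [Complex.measurableEquivRealProd_symm_apply]
    ring
  rw [e, hv2, mul_mul_mul_comm, ← Real.exp_add, ← mul_inv, Real.mul_self_sqrt (by positivity)]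
  rw [div_eq_inv_mul (Real.exp _)]
  congr 1
  · field_simp
  · congr 1
    field_simp
    ring

/-- A pair of real coordinates as a complex number. -/
def boolToComplex (x : Bool → ℝ) : ℂ := x false + x true * Complex.I

theorem measurable_boolToComplex : Measurable boolToComplex := by
  unfold boolToComplex; fun_prop

theorem measurePreserving_boolToComplex {ν : ℝ} (hν : 0 < ν) :
    MeasurePreserving boolToComplex (Measure.pi fun _ => gaussianReal 0 (ν / 2).toNNReal)
      (complexGaussian ν) := by
  refine ⟨measurable_boolToComplex, ?_⟩
  have hind := (iIndepFun_pi (μ := fun _ : Bool => gaussianReal 0 (ν / 2).toNNReal)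
    (X := fun _ x => x) (fun _ => by fun_prop)).indepFun (i := false) (j := true) (by decide)
  have hev : ∀ b : Bool, AEMeasurable (fun ω : Bool → ℝ => ω b)
      (Measure.pi fun _ : Bool => gaussianReal 0 (ν / 2).toNNReal) := fun b =>
    (measurable_pi_apply b).aemeasurable
  rw [indepFun_iff_map_prod_eq_prod_map_map (hev _) (hev _),
    (measurePreserving_eval (fun _ : Bool => gaussianReal 0 (ν / 2).toNNReal) false).map_eq,
    (measurePreserving_eval (fun _ : Bool => gaussianReal 0 (ν / 2).toNNReal) true).map_eq] at hind
  rw [← map_prod_gaussianReal_eq_complexGaussian hν, ← hind, Measure.map_map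
    Complex.measurableEquivRealProd.symm.measurable (by fun_prop)]
  congr 1
  ext x
  apply Complex.ext <;> simp [boolToComplex, Complex.measurableEquivRealProd_symm_apply]

theorem measurePreserving_curry_pi {I K X : Type*} [Fintype I] [Fintype K] [MeasurableSpace X]
    (μ : Measure X) [IsProbabilityMeasure μ] :
    MeasurePreserving (fun (x : I × K → X) i k => x (i, k)) (Measure.pi fun _ => μ)
      (Measure.pi fun _ => Measure.pi fun _ => μ) := by
  refine ⟨by fun_prop, ?_⟩
  have := Measure.infinitePi_map_curry (ι := I) (κ := K) (μ := fun _ _ => μ)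
  simp only [Measure.infinitePi_eq_pi] at this
  exact this

theorem map_gaussPi_eq_pi_complexGaussian {I : Type*} [Fintype I] {ν : ℝ} (hν : 0 < ν) :
    MeasurePreserving (fun (x : I × Bool → ℝ) i => (x (i, false) : ℂ) + x (i, true) * Complex.I)
      (gaussPi fun _ => (ν / 2).toNNReal) (Measure.pi fun _ => complexGaussian ν) := by
  have : IsProbabilityMeasure (complexGaussian ν) := by
    rw [← (measurePreserving_boolToComplex hν).map_eq]
    exact Measure.isProbabilityMeasure_map measurable_boolToComplex.aemeasurable
  exact (measurePreserving_pi _ _ fun _ : I => measurePreserving_boolToComplex hν).comp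
    (measurePreserving_curry_pi _)

/-- Rotation invariance, transported from `stdGaussian` on the Euclidean space, where `Q` is a
linear isometry. -/
theorem measurePreserving_mulVec_std {M : Type*} [Fintype M] [DecidableEq M] {Q : Matrix M M ℝ}
    (hQ : Q.transpose * Q = 1) :
    MeasurePreserving Q.mulVec (gaussPi fun _ : M => 1) (gaussPi fun _ => 1) := by
  refine ⟨by fun_prop, ?_⟩
  let li : EuclideanSpace ℝ M →ₗᵢ[ℝ] EuclideanSpace ℝ M :=
    ⟨Matrix.toEuclideanLin Q, fun x => by
      have h1 : ‖Matrix.toEuclideanLin Q x‖ ^ 2 = ‖x‖ ^ 2 := by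
        rw [EuclideanSpace.real_norm_sq_eq, EuclideanSpace.real_norm_sq_eq]
        have h2 : ∀ z : M → ℝ, ∑ i, z i ^ 2 = dotProduct z z := fun z => by
          simp [dotProduct, sq]
        rw [h2 (x.ofLp), h2 ((Matrix.toEuclideanLin Q x).ofLp)]
        rw [Matrix.ofLp_toLpLin, Matrix.toLin'_apply, Matrix.dotProduct_mulVec,
          Matrix.vecMul_mulVec, hQ, Matrix.vecMul_one]
      exact (sq_eq_sq₀ (norm_nonneg _) (norm_nonneg _)).1 h1⟩
  have h1 := stdGaussian_map (li.toLinearIsometryEquiv rfl)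
  rw [← map_pi_eq_stdGaussian, Measure.map_map (by fun_prop) (by fun_prop)] at h1
  have h2 := congrArg (Measure.map (WithLp.ofLp : EuclideanSpace ℝ M → M → ℝ)) h1
  rw [Measure.map_map (by fun_prop) (by fun_prop), Measure.map_map (by fun_prop) (by fun_prop)] at h2
  convert! h2 using 1
  exact Measure.map_id.symm

theorem measurePreserving_scale_std {M : Type*} [Fintype M] (v : ℝ≥0) :
    MeasurePreserving (fun (x : M → ℝ) m => √v * x m) (gaussPi fun _ : M => 1)
      (gaussPi fun _ => v) := by
  refine measurePreserving_pi (fun _ => gaussianReal 0 1) (fun _ => gaussianReal 0 v)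
    (f := fun _ x => √v * x) fun m => ⟨by fun_prop, ?_⟩
  rw [gaussianReal_map_const_mul]
  congr 1
  · simp
  · ext; simp

/-- The entries of `O w Oᵀ` in terms of the real and imaginary parts of `w`. -/
def modeEntry {ι : Type*} [Fintype ι] (O : Matrix ι ι ℝ) (x : (ι × ι) × Bool → ℝ) (ij : ι × ι) : ℂ :=
  ∑ m, modeCoeff O ij.1 ij.2 m * (x m : ℂ)

/-- A matrix of independent circular Gaussians is invariant under phases and under orthogonal
conjugation. Both act on the real coordinates as one orthogonal matrix, the Kronecker product of O,
O and a plane rotation; only the modulus of z remains, in the variance. -/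
theorem lintegral_gaussian_matrix {ι Ω : Type*} [Fintype ι] [DecidableEq ι] [MeasurableSpace Ω]
    {μ : Measure Ω} {ν : ℝ} (hν : 0 < ν) {W : Ω → ι × ι → ℂ}
    (hW : HasLaw W (Measure.pi fun _ => complexGaussian ν) μ)
    {O : Matrix ι ι ℝ} (hO : O * O.transpose = 1) {z : ℂ} (hz : z ≠ 0)
    {g : (ι × ι → ℂ) → ℝ≥0∞} (hg : Measurable g) :
    ∫⁻ ω, g (fun ij => z * W ω ij) ∂μ
      = ∫⁻ x, g (modeEntry O x) ∂gaussPi (fun _ => (ν * ‖z‖ ^ 2 / 2).toNNReal) := by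
  have hr : 0 < ‖z‖ := norm_pos_iff.2 hz
  have hO' : O.transpose * O = 1 := mul_eq_one_comm.1 hO
  have hcs : (z.re / ‖z‖) * (z.re / ‖z‖) + (z.im / ‖z‖) * (z.im / ‖z‖) = 1 := by
    have := Complex.normSq_eq_norm_sq z
    rw [Complex.normSq_apply] at this
    field_simp
    linarith
  -- This is multiplication by conj(z)/|z| on pairs (real part, imaginary part); it cancels the
  -- phase of z.
  let Rot : Matrix Bool Bool ℝ := Matrix.of fun s s' =>
    if s = s' then z.re / ‖z‖ else if s' then z.im / ‖z‖ else -(z.im / ‖z‖)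
  have hRot : Rot.transpose * Rot = 1 := by
    ext s s'
    cases s <;> cases s' <;>
      simp [Rot, Matrix.mul_apply] <;> linarith
  let Q : Matrix ((ι × ι) × Bool) ((ι × ι) × Bool) ℝ :=
    Matrix.kronecker (Matrix.kronecker O O) Rot
  have hQ : Q.transpose * Q = 1 := by
    simp only [Q, Matrix.kronecker, ← Matrix.kroneckerMap_transpose]
    rw [← Matrix.mul_kronecker_mul, ← Matrix.mul_kronecker_mul, hO', hRot]
    simp
  have hg' : Measurable fun y : ι × ι → ℂ => g fun ij => z * y ij := hg.comp (by fun_prop)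
  have h1 : ∫⁻ ω, g (fun ij => z * W ω ij) ∂μ
      = ∫⁻ y, g (fun ij => z * y ij) ∂(Measure.pi fun _ => complexGaussian ν) := by
    rw [← hW.map_eq, lintegral_map' hg'.aemeasurable hW.aemeasurable]
  have hsq : √(((ν * ‖z‖ ^ 2 / 2).toNNReal : ℝ≥0) : ℝ) = ‖z‖ * √(((ν / 2).toNNReal : ℝ≥0) : ℝ) := by
    rw [Real.coe_toNNReal _ (by positivity), Real.coe_toNNReal _ (by positivity),
      show ν * ‖z‖ ^ 2 / 2 = ‖z‖ ^ 2 * (ν / 2) by ring, Real.sqrt_mul (by positivity),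
      Real.sqrt_sq hr.le]
  have h2 := (map_gaussPi_eq_pi_complexGaussian (I := ι × ι) hν).lintegral_comp hg'
  have hg2 : Measurable fun x : (ι × ι) × Bool → ℝ => g fun ij =>
      z * ((x (ij, false) : ℂ) + x (ij, true) * Complex.I) := hg.comp (by fun_prop)
  have h3 := (measurePreserving_scale_std (M := (ι × ι) × Bool) (ν / 2).toNNReal).lintegral_comp hg2
  have hg3 : Measurable fun x : (ι × ι) × Bool → ℝ => g fun ij =>
      z * (((√(((ν / 2).toNNReal : ℝ≥0) : ℝ) * x (ij, false) : ℝ) : ℂ)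
        + (√(((ν / 2).toNNReal : ℝ≥0) : ℝ) * x (ij, true) : ℝ) * Complex.I) := hg.comp (by fun_prop)
  have h4 := (measurePreserving_mulVec_std hQ).lintegral_comp hg3
  have hg5 : Measurable fun x => g (modeEntry O x) := hg.comp (by unfold modeEntry; fun_prop)
  have h5 := (measurePreserving_scale_std (M := (ι × ι) × Bool)
    (ν * ‖z‖ ^ 2 / 2).toNNReal).lintegral_comp hg5
  rw [h1, ← h2, ← h3, ← h4, ← h5]
  refine lintegral_congr fun x => ?_
  congr 1
  ext ij
  obtain ⟨i, j⟩ := ij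
  simp only [modeEntry, Matrix.mulVec, dotProduct, Q, Matrix.kronecker, Matrix.kroneckerMap_apply,
    Fintype.sum_prod_type, Fintype.sum_bool, Rot, Matrix.of_apply, modeCoeff, hsq]
  push_cast
  simp only [Finset.mul_sum, Finset.sum_mul, ← Finset.sum_add_distrib]
  refine Finset.sum_congr rfl fun a _ => Finset.sum_congr rfl fun b _ => ?_
  have hz' : (‖z‖ : ℂ) ≠ 0 := by exact_mod_cast hr.ne'
  have hz2 : (z.re : ℂ) * z.re + z.im * z.im = ‖z‖ ^ 2 := by
    have := Complex.normSq_eq_norm_sq z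
    rw [Complex.normSq_apply] at this
    exact_mod_cast this
  have hI : Complex.I * Complex.I = -1 := Complex.I_mul_I
  have hzz : z * (z.re - z.im * Complex.I) = ‖z‖ ^ 2 := by
    nth_rewrite 1 [← Complex.re_add_im z]
    linear_combination hz2 - (z.im : ℂ) * z.im * hI
  field_simp
  generalize (√(((ν / 2).toNNReal : ℝ≥0) : ℝ) : ℂ) = q
  linear_combination q * O i a * O j b * (x ((a, b), false) + x ((a, b), true) * Complex.I) * hzz
    + q * z * O i a * O j b * z.im * x ((a, b), true) * hI

end Law

/-! ### The corrected polynomial and its second moment -/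

section Correction

open scoped NNReal ENNReal ComplexConjugate

/-- With this basis the mode (a₀, a₀) is the sum of all entries divided by n, and the other modes
with one index a₀ are combinations of row sums or of column sums. -/
theorem exists_orthogonal_constant_column {ι : Type*} [Fintype ι] [DecidableEq ι] (a₀ : ι) :
    ∃ O : Matrix ι ι ℝ, O * O.transpose = 1 ∧ ∀ i, O i a₀ * √(Fintype.card ι) = 1 := by
  have hn : (0 : ℝ) < Fintype.card ι := by
    have : 0 < Fintype.card ι := Fintype.card_pos_iff.2 ⟨a₀⟩
    exact_mod_cast this
  let e : EuclideanSpace ℝ ι := WithLp.toLp 2 fun _ => (√(Fintype.card ι))⁻¹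
  have he : ‖e‖ = 1 := by
    have h : ‖e‖ ^ 2 = 1 := by
      rw [EuclideanSpace.real_norm_sq_eq]
      simp only [e, inv_pow, Real.sq_sqrt hn.le, Finset.sum_const, Finset.card_univ, nsmul_eq_mul]
      exact mul_inv_cancel₀ hn.ne'
    exact (pow_eq_one_iff_of_nonneg (norm_nonneg _) two_ne_zero).1 h
  obtain ⟨b, hb⟩ := Orthonormal.exists_orthonormalBasis_extension_of_card_eq (𝕜 := ℝ)
    (E := EuclideanSpace ℝ ι) (ι := ι) (by simp) (v := fun _ => e) (s := {a₀})
    ⟨fun i => he, fun i j hij => absurd (Subsingleton.elim i j) hij⟩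
  refine ⟨Matrix.of fun i a => b a i, ?_, fun i => ?_⟩
  · rw [mul_eq_one_comm]
    ext a c
    have := orthonormal_iff_ite.1 b.orthonormal c a
    rw [PiLp.inner_apply] at this
    simp only [Matrix.mul_apply, Matrix.transpose_apply, Matrix.of_apply, Matrix.one_apply]
    simp only [RCLike.inner_apply, conj_trivial] at this
    rw [this]
    simp only [eq_comm]
  · rw [Matrix.of_apply, hb a₀ rfl]
    exact inv_mul_cancel₀ (Real.sqrt_pos.2 hn).ne'

/-- The entry `(a, b)` of `Oᵀ X O`. -/
def modeOf {ι : Type*} [Fintype ι] (O : Matrix ι ι ℝ) (X : ι × ι → ℂ) (ab : ι × ι) : ℂ :=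
  ∑ ij, ((O ij.1 ab.1 * O ij.2 ab.2 : ℝ) : ℂ) * X ij

/-- The exponent of the quadratic correction. -/
def correctionExponent {ι : Type*} [Fintype ι] [DecidableEq ι] (O : Matrix ι ι ℝ) (a₀ : ι)
    (t p y : ℝ) (X : ι × ι → ℂ) : ℂ :=
  -((1 - y : ℝ) : ℂ) * modeOf O X (a₀, a₀)
    + ∑ ab, ((modeTilt a₀ p y ab / t / 2 : ℝ) : ℂ) * modeOf O X ab ^ 2

theorem modeOf_modeEntry {ι : Type*} [Fintype ι] [DecidableEq ι] {O : Matrix ι ι ℝ}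
    (hO : O * O.transpose = 1) (x : (ι × ι) × Bool → ℝ) (ab : ι × ι) :
    modeOf O (modeEntry O x) ab = x (ab, false) + x (ab, true) * Complex.I := by
  have hO' : ∀ a c, ∑ i, (O i a : ℂ) * O i c = if a = c then 1 else 0 := by
    intro a c
    have h : O.transpose * O.transpose.transpose = 1 := by
      rw [Matrix.transpose_transpose]; exact mul_eq_one_comm.1 hO
    have := sum_orthogonal h a c
    have h2 := congrArg (fun r : ℝ => (r : ℂ)) this
    simp only [Matrix.transpose_apply] at h2
    push_cast at h2
    rw [h2]
    split_ifs <;> rfl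
  obtain ⟨a, b⟩ := ab
  have e : modeOf O (modeEntry O x) (a, b)
      = ∑ c, ∑ d, (∑ i, (O i a : ℂ) * O i c) * (∑ j, (O j b : ℂ) * O j d)
          * (x ((c, d), false) + x ((c, d), true) * Complex.I) := by
    have e1 : ∀ c d, (∑ i, (O i a : ℂ) * O i c) * (∑ j, (O j b : ℂ) * O j d)
          * (x ((c, d), false) + x ((c, d), true) * Complex.I)
        = ∑ ij : ι × ι, ((O ij.1 a : ℂ) * O ij.1 c) * ((O ij.2 b : ℂ) * O ij.2 d)
          * (x ((c, d), false) + x ((c, d), true) * Complex.I) := by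
      intro c d
      rw [Finset.sum_mul_sum, ← Fintype.sum_prod_type', Finset.sum_mul]
    simp only [e1]
    rw [← Fintype.sum_prod_type', Finset.sum_comm]
    unfold modeOf modeEntry
    refine Finset.sum_congr rfl fun ij _ => ?_
    rw [Finset.mul_sum, Fintype.sum_prod_type]
    refine Finset.sum_congr rfl fun cd _ => ?_
    rw [Fintype.sum_bool]
    simp only [modeCoeff, if_true, Bool.false_eq_true, if_false]
    push_cast
    ring
  rw [e]
  simp [hO', Finset.sum_ite_eq]

/-- Twice the real part is the exponent of the squared modulus of the correction. As Re w² = (Re w)²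
- (Im w)², a holomorphic quadratic term tilts real and imaginary parts in opposite directions. -/
theorem two_mul_re_correctionExponent {ι : Type*} [Fintype ι] [DecidableEq ι] {O : Matrix ι ι ℝ}
    (hO : O * O.transpose = 1) (a₀ : ι) (t p y : ℝ) (x : (ι × ι) × Bool → ℝ) :
    2 * (correctionExponent O a₀ t p y (modeEntry O x)).re = modeExponent a₀ t p y x := by
  simp only [correctionExponent, modeOf_modeEntry hO, modeExponent, Complex.add_re, Complex.re_sum,
    mul_add, Finset.mul_sum]
  congr 1
  · rw [← Complex.ofReal_neg, Complex.re_ofReal_mul]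
    simp
    ring
  · refine Finset.sum_congr rfl fun ab _ => ?_
    rw [Complex.re_ofReal_mul]
    simp [sq]
    ring

theorem continuous_correctionExponent {ι : Type*} [Fintype ι] [DecidableEq ι] (O : Matrix ι ι ℝ)
    (a₀ : ι) (t p y : ℝ) : Continuous (correctionExponent O a₀ t p y) := by
  unfold correctionExponent modeOf
  fun_prop

/-- The polynomial `G_W` multiplied by the correction. -/
def correctedPoly {n : ℕ} (O : Matrix (Fin n) (Fin n) ℝ) (a₀ : Fin n) (t p y : ℝ)
    (W : Matrix (Fin n) (Fin n) ℂ) (z : ℂ) : ℂ :=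
  permPoly W z * Complex.exp (correctionExponent O a₀ t p y fun ij => z * W ij.1 ij.2)

/-- The parameters t, p, y depend on z only through its modulus. One and the same entire function is
therefore controlled on a whole circle. -/
theorem lintegral_correctedPoly_le {n : ℕ} {Ω : Type*} [MeasurableSpace Ω] {μ : Measure Ω}
    {ν : ℝ} (hν : 0 < ν) {W : Ω → Matrix (Fin n) (Fin n) ℂ}
    (hW : HasLaw (fun ω (ij : Fin n × Fin n) => W ω ij.1 ij.2)
      (Measure.pi fun _ => complexGaussian ν) μ)
    {O : Matrix (Fin n) (Fin n) ℝ} (hO : O * O.transpose = 1) {a₀ : Fin n}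
    (hcol : ∀ i, O i a₀ * √n = 1) {z : ℂ} (hz : z ≠ 0) {t p y : ℝ} (ht : t = ν * ‖z‖ ^ 2)
    (hp : p * n = t) (hp1 : p < 1) (hpy : p ≤ y) (hy1 : y < 1)
    (hy : y / (1 - y ^ 2) = 2 * (p / (1 - p ^ 2))) :
    ∫⁻ ω, ENNReal.ofReal (‖correctedPoly O a₀ t p y (W ω) z‖ ^ 2) ∂μ
      ≤ ENNReal.ofReal (tiltedBound n t p y) := by
  have ht0 : 0 < t := by
    have := norm_pos_iff.2 hz
    rw [ht]; positivity
  have hper : Continuous fun X : Fin n × Fin n → ℂ =>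
      (Matrix.of fun i j => 1 + X (i, j) : Matrix (Fin n) (Fin n) ℂ).permanent := by
    simp only [Matrix.permanent, Matrix.of_apply]
    fun_prop
  have hexp := continuous_correctionExponent O a₀ t p y
  have hg : Measurable fun X : Fin n × Fin n → ℂ =>
      ENNReal.ofReal (‖(Matrix.of fun i j => 1 + X (i, j) : Matrix (Fin n) (Fin n) ℂ).permanent‖ ^ 2)
        * ENNReal.ofReal (Real.exp (2 * (correctionExponent O a₀ t p y X).re)) := by
    have h1 : Continuous fun X : Fin n × Fin n → ℂ => ENNReal.ofReal
        (‖(Matrix.of fun i j => 1 + X (i, j) : Matrix (Fin n) (Fin n) ℂ).permanent‖ ^ 2) :=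
      ENNReal.continuous_ofReal.comp (hper.norm.pow 2)
    have h2 : Continuous fun X : Fin n × Fin n → ℂ =>
        ENNReal.ofReal (Real.exp (2 * (correctionExponent O a₀ t p y X).re)) :=
      ENNReal.continuous_ofReal.comp (Real.continuous_exp.comp
        (continuous_const.mul (Complex.continuous_re.comp hexp)))
    exact h1.measurable.mul h2.measurable
  have e1 : ∀ ω, ENNReal.ofReal (‖correctedPoly O a₀ t p y (W ω) z‖ ^ 2)
      = ENNReal.ofReal (((n.factorial : ℝ) ^ 2)⁻¹)
        * (ENNReal.ofReal (‖(Matrix.of fun i j => 1 + z * W ω i j :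
            Matrix (Fin n) (Fin n) ℂ).permanent‖ ^ 2)
          * ENNReal.ofReal (Real.exp (2 * (correctionExponent O a₀ t p y
              fun ij => z * W ω ij.1 ij.2).re))) := by
    intro ω
    rw [← ENNReal.ofReal_mul (by positivity), ← ENNReal.ofReal_mul (by positivity)]
    congr 1
    unfold correctedPoly permPoly
    rw [norm_mul, norm_div, Complex.norm_exp, mul_pow, div_pow, ← Real.exp_nat_mul, Complex.norm_natCast]
    have : allOnes n + z • W ω = Matrix.of fun i j => 1 + z * W ω i j := by
      ext i j; simp [allOnes]
    rw [this]
    push_cast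
    ring
  simp only [e1]
  rw [lintegral_const_mul' _ _ ENNReal.ofReal_ne_top,
    lintegral_gaussian_matrix hν hW hO hz hg]
  have main := lintegral_tilted_permanent_le (ι := Fin n) hO (a₀ := a₀) (by simpa using hcol) ht0
    (by simpa using hp) hp1 hpy hy1 hy
  have e2 : ∫⁻ x, ENNReal.ofReal (‖(Matrix.of fun i j => 1 + modeEntry O x (i, j) :
        Matrix (Fin n) (Fin n) ℂ).permanent‖ ^ 2)
        * ENNReal.ofReal (Real.exp (2 * (correctionExponent O a₀ t p y (modeEntry O x)).re))
          ∂gaussPi (fun _ => (ν * ‖z‖ ^ 2 / 2).toNNReal)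
      = ∫⁻ x, ENNReal.ofReal (‖(affMatrix (Matrix.of fun _ _ => 1) (modeCoeff O) x).permanent‖ ^ 2)
        * ENNReal.ofReal (Real.exp (modeExponent a₀ t p y x))
          ∂gaussPi (fun _ => (t / 2).toNNReal) := by
    rw [← ht]
    refine lintegral_congr fun x => ?_
    rw [two_mul_re_correctionExponent hO]
    rfl
  rw [e2]
  refine (mul_le_mul_right main _).trans ?_
  rw [← ENNReal.ofReal_mul (by positivity), Fintype.card_fin]
  refine ENNReal.ofReal_le_ofReal (le_of_eq ?_)
  have : ((n.factorial : ℝ) ^ 2) ≠ 0 := by positivity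
  field_simp

end Correction

/-! ### Zeros of the random polynomial -/

section Zeros

open scoped NNReal ENNReal

/-- At a zero of h the function (h - 1)² equals 1. Cauchy's formula expresses this value through the
circle, where the kernel w/(w - z₀) has modulus at most r/(r - ρ). Squaring before applying the
formula yields an L² quantity directly. -/
theorem le_integral_norm_sub_one_sq_of_zero {h : ℂ → ℂ} (hh : Differentiable ℂ h) {z₀ : ℂ} {ρ r : ℝ}
    (hz₀ : ‖z₀‖ ≤ ρ) (hρ : ρ < r) (h0 : h z₀ = 0) :
    2 * Real.pi * ((r - ρ) / r) ≤ ∫ θ in 0..2 * Real.pi, ‖h (circleMap 0 r θ) - 1‖ ^ 2 := by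
  have hr : 0 < r := ((norm_nonneg _).trans hz₀).trans_lt hρ
  have hg : Differentiable ℂ fun z => (h z - 1) ^ 2 := by fun_prop
  have key := DiffContOnCl.circleAverage_smul_div (c := 0) (R := r) (w := z₀)
    (f := fun z => (h z - 1) ^ 2) hg.diffContOnCl (by
      rw [abs_of_pos hr]; simpa using hz₀.trans_lt hρ)
  simp only [h0, zero_sub, sub_zero] at key
  rw [Real.circleAverage_def] at key
  have hn := congrArg norm key
  rw [norm_smul, Real.norm_of_nonneg (by positivity)] at hn
  have hn1 : ‖((-1 : ℂ) ^ 2)‖ = 1 := by simp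
  rw [hn1] at hn
  have hcont : Continuous fun θ : ℝ => ‖h (circleMap 0 r θ) - 1‖ ^ 2 := by
    have := hh.continuous.comp (continuous_circleMap 0 r)
    exact (this.sub continuous_const).norm.pow 2
  have hle : ‖∫ θ in 0..2 * Real.pi, (circleMap 0 r θ / (circleMap 0 r θ - z₀)) •
        (h (circleMap 0 r θ) - 1) ^ 2‖
      ≤ ∫ θ in 0..2 * Real.pi, r / (r - ρ) * ‖h (circleMap 0 r θ) - 1‖ ^ 2 := by
    refine intervalIntegral.norm_integral_le_of_norm_le Real.two_pi_pos.le
      (Filter.Eventually.of_forall fun θ _ => ?_) ((hcont.const_mul _).intervalIntegrable _ _)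
    rw [norm_smul, norm_pow, norm_div]
    have h1 : ‖circleMap 0 r θ‖ = r := by simp [abs_of_pos hr]
    have h2 : r - ρ ≤ ‖circleMap 0 r θ - z₀‖ := by
      have := norm_sub_norm_le (circleMap 0 r θ) z₀
      rw [h1] at this
      linarith
    rw [h1]
    have : 0 < r - ρ := sub_pos.2 hρ
    gcongr
  rw [intervalIntegral.integral_const_mul] at hle
  have hd : 0 < r - ρ := sub_pos.2 hρ
  have hpi := Real.two_pi_pos
  have e : ‖∫ θ in 0..2 * Real.pi, (circleMap 0 r θ / (circleMap 0 r θ - z₀)) •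
        (h (circleMap 0 r θ) - 1) ^ 2‖ = 2 * Real.pi := by
    have hne : 2 * Real.pi ≠ 0 := hpi.ne'
    field_simp at hn
    linarith
  rw [e] at hle
  rw [← mul_div_assoc, div_le_iff₀ hr]
  have := mul_le_mul_of_nonneg_left hle hd.le
  calc 2 * Real.pi * (r - ρ) = (r - ρ) * (2 * Real.pi) := by ring
    _ ≤ _ := this
    _ = _ := by field_simp

/-- Pointwise |h|² = |h - 1|² + 2 Re h - 1, and the mean value property gives Re h the circle
average 1. -/
theorem integral_norm_sq_eq_of_differentiable {h : ℂ → ℂ} (hh : Differentiable ℂ h) (h0 : h 0 = 1)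
    (r : ℝ) : ∫ θ in 0..2 * Real.pi, ‖h (circleMap 0 r θ)‖ ^ 2
      = (∫ θ in 0..2 * Real.pi, ‖h (circleMap 0 r θ) - 1‖ ^ 2) + 2 * Real.pi := by
  have hc : Continuous fun θ : ℝ => h (circleMap 0 r θ) :=
    hh.continuous.comp (continuous_circleMap 0 r)
  have key := DiffContOnCl.circleAverage (c := 0) (R := r) hh.diffContOnCl
  rw [Real.circleAverage_def, h0] at key
  have hpi := Real.two_pi_pos
  have e1 : ∫ θ in 0..2 * Real.pi, h (circleMap 0 r θ) = ((2 * Real.pi : ℝ) : ℂ) := by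
    have := congrArg (fun z : ℂ => (2 * Real.pi) • z) key
    simp only [smul_smul, mul_inv_cancel₀ hpi.ne', one_smul] at this
    rw [this]
    simp
  have e2 : ∫ θ in 0..2 * Real.pi, (h (circleMap 0 r θ)).re = 2 * Real.pi := by
    have := intervalIntegral.intervalIntegral_re (𝕜 := ℂ) (μ := volume) (hc.intervalIntegrable 0 (2 * Real.pi))
    simp only [RCLike.re_to_complex] at this
    rw [this, e1, Complex.ofReal_re]
  have e3 : ∀ z : ℂ, ‖z‖ ^ 2 = ‖z - 1‖ ^ 2 + (2 * z.re - 1) := by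
    intro z
    rw [Complex.sq_norm, Complex.sq_norm, Complex.normSq_apply, Complex.normSq_apply]
    simp
    ring
  have hre : Continuous fun θ : ℝ => (h (circleMap 0 r θ)).re := Complex.continuous_re.comp hc
  have hsq : Continuous fun θ : ℝ => ‖h (circleMap 0 r θ) - 1‖ ^ 2 :=
    (hc.sub continuous_const).norm.pow 2
  calc ∫ θ in 0..2 * Real.pi, ‖h (circleMap 0 r θ)‖ ^ 2
      = ∫ θ in 0..2 * Real.pi, (‖h (circleMap 0 r θ) - 1‖ ^ 2 + (2 * (h (circleMap 0 r θ)).re - 1)) :=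
        intervalIntegral.integral_congr fun θ _ => e3 _
    _ = _ := by
        rw [intervalIntegral.integral_add (hsq.intervalIntegrable _ _)
          (Continuous.intervalIntegrable (by fun_prop) _ _),
          intervalIntegral.integral_sub (Continuous.intervalIntegrable (by fun_prop) _ _)
          (Continuous.intervalIntegrable (by fun_prop) _ _), intervalIntegral.integral_const_mul, e2]
        simp
        ring

/-! ### Regularity of G_W and of its corrected version. -/

theorem permPoly_zero {n : ℕ} (W : Matrix (Fin n) (Fin n) ℂ) : permPoly W 0 = 1 := by
  unfold permPoly
  have : ((n.factorial : ℕ) : ℂ) ≠ 0 := by exact_mod_cast n.factorial_ne_zero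
  simp [allOnes, Matrix.permanent, Fintype.card_perm, this]

theorem continuous_permPoly_uncurry {n : ℕ} :
    Continuous fun q : (Fin n × Fin n → ℂ) × ℂ => permPoly (Matrix.of fun i j => q.1 (i, j)) q.2 := by
  unfold permPoly
  simp only [Matrix.permanent, Matrix.add_apply, Matrix.smul_apply, Matrix.of_apply, smul_eq_mul]
  fun_prop

theorem differentiable_permPoly {n : ℕ} (W : Matrix (Fin n) (Fin n) ℂ) :
    Differentiable ℂ (permPoly W) := by
  unfold permPoly
  simp only [Matrix.permanent, Matrix.add_apply, Matrix.smul_apply, smul_eq_mul]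
  fun_prop

theorem differentiable_correctedPoly {n : ℕ} (O : Matrix (Fin n) (Fin n) ℝ) (a₀ : Fin n) (t p y : ℝ)
    (W : Matrix (Fin n) (Fin n) ℂ) : Differentiable ℂ (correctedPoly O a₀ t p y W) := by
  have := differentiable_permPoly W
  unfold correctedPoly correctionExponent modeOf
  fun_prop

theorem correctedPoly_zero {n : ℕ} (O : Matrix (Fin n) (Fin n) ℝ) (a₀ : Fin n) (t p y : ℝ)
    (W : Matrix (Fin n) (Fin n) ℂ) : correctedPoly O a₀ t p y W 0 = 1 := by
  simp [correctedPoly, permPoly_zero, correctionExponent, modeOf]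

theorem continuous_correctedPoly_uncurry {n : ℕ} (O : Matrix (Fin n) (Fin n) ℝ) (a₀ : Fin n)
    (t p y : ℝ) : Continuous fun q : (Fin n × Fin n → ℂ) × ℂ =>
      correctedPoly O a₀ t p y (Matrix.of fun i j => q.1 (i, j)) q.2 := by
  have h1 := continuous_permPoly_uncurry (n := n)
  have h2 := continuous_correctionExponent O a₀ t p y
  unfold correctedPoly
  refine h1.mul (Complex.continuous_exp.comp (h2.comp ?_))
  simp only [Matrix.of_apply]
  fun_prop

/-- By Fubini the expected circle mean of |H - 1|² is at most B, while a zero in the smaller disk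
forces that mean to be at least (r - ρ)/r; Markov's inequality compares the two. A single circle
handles all possible zeros, with no union bound over the disk. -/
theorem measure_exists_zero_le {E : Type*} [MeasurableSpace E] {Q : Measure E} [IsProbabilityMeasure Q]
    {H : E → ℂ → ℂ} {ρ r : ℝ} (hr0 : 0 < r) (hρr : ρ < r)
    (hm : Measurable fun q : E × ℝ => H q.1 (circleMap 0 r q.2))
    (hd : ∀ X, Differentiable ℂ (H X)) (h0 : ∀ X, H X 0 = 1) {B : ℝ} (hB0 : 0 ≤ B)
    (hB : ∀ z, ‖z‖ = r → ∫⁻ X, ENNReal.ofReal (‖H X z‖ ^ 2) ∂Q ≤ ENNReal.ofReal (1 + B)) :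
    Q {X | ∃ z, ‖z‖ < ρ ∧ H X z = 0} ≤ ENNReal.ofReal (B / ((r - ρ) / r)) := by
  have hc1 : ∀ X, Continuous fun θ : ℝ => H X (circleMap 0 r θ) := fun X =>
    (hd X).continuous.comp (continuous_circleMap 0 r)
  have hc2 : ∀ X, Continuous fun θ : ℝ => ‖H X (circleMap 0 r θ)‖ ^ 2 := fun X => (hc1 X).norm.pow 2
  have hc3 : ∀ X, Continuous fun θ : ℝ => ‖H X (circleMap 0 r θ) - 1‖ ^ 2 := fun X =>
    ((hc1 X).sub continuous_const).norm.pow 2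
  have hI : ∀ f : ℝ → ℝ, Continuous f → (∀ θ, 0 ≤ f θ) →
      ∫⁻ θ in Set.Ioc 0 (2 * Real.pi), ENNReal.ofReal (f θ)
        = ENNReal.ofReal (∫ θ in 0..2 * Real.pi, f θ) := by
    intro f hf hf0
    rw [intervalIntegral.integral_of_le Real.two_pi_pos.le]
    refine (ofReal_integral_eq_lintegral_ofReal ?_ (Filter.Eventually.of_forall hf0)).symm
    exact (hf.intervalIntegrable 0 (2 * Real.pi)).1
  obtain ⟨Y, hY⟩ : ∃ Y : E → ℝ≥0∞, ∀ X, Y X = ∫⁻ θ in Set.Ioc 0 (2 * Real.pi),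
    ENNReal.ofReal (‖H X (circleMap 0 r θ) - 1‖ ^ 2) := ⟨_, fun _ => rfl⟩
  have hYm : Measurable Y := by
    rw [show Y = _ from funext hY]
    refine Measurable.lintegral_prod_right' (f := fun q : E × ℝ =>
      ENNReal.ofReal (‖H q.1 (circleMap 0 r q.2) - 1‖ ^ 2)) ?_
    exact ((hm.sub_const 1).norm.pow_const 2).ennreal_ofReal
  have hsum : ∀ X, ∫⁻ θ in Set.Ioc 0 (2 * Real.pi), ENNReal.ofReal (‖H X (circleMap 0 r θ)‖ ^ 2)
      = Y X + ENNReal.ofReal (2 * Real.pi) := by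
    intro X
    rw [hY, hI _ (hc2 X) (fun _ => by positivity),
      hI _ (hc3 X) (fun _ => by positivity),
      integral_norm_sq_eq_of_differentiable (hd X) (h0 X),
      ENNReal.ofReal_add (intervalIntegral.integral_nonneg Real.two_pi_pos.le fun _ _ => by positivity)
        Real.two_pi_pos.le]
  have hEY : ∫⁻ X, Y X ∂Q ≤ ENNReal.ofReal (2 * Real.pi * B) := by
    have h1 : ∫⁻ X, Y X ∂Q + ENNReal.ofReal (2 * Real.pi)
        ≤ ENNReal.ofReal (2 * Real.pi * B) + ENNReal.ofReal (2 * Real.pi) := by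
      calc ∫⁻ X, Y X ∂Q + ENNReal.ofReal (2 * Real.pi)
          = ∫⁻ X, (Y X + ENNReal.ofReal (2 * Real.pi)) ∂Q := by
            rw [lintegral_add_right _ measurable_const, lintegral_const, measure_univ, mul_one]
        _ = ∫⁻ X, (∫⁻ θ in Set.Ioc 0 (2 * Real.pi), ENNReal.ofReal (‖H X (circleMap 0 r θ)‖ ^ 2)) ∂Q :=
            lintegral_congr fun X => (hsum X).symm
        _ = ∫⁻ θ in Set.Ioc 0 (2 * Real.pi), ∫⁻ X, ENNReal.ofReal (‖H X (circleMap 0 r θ)‖ ^ 2) ∂Q := by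
            refine lintegral_lintegral_swap ?_
            exact (hm.norm.pow_const 2).ennreal_ofReal.aemeasurable
        _ ≤ ∫⁻ θ in Set.Ioc 0 (2 * Real.pi), ENNReal.ofReal (1 + B) := by
            refine lintegral_mono fun θ => hB _ ?_
            simp [abs_of_pos hr0]
        _ = _ := by
            have := Real.two_pi_pos
            rw [lintegral_const, Measure.restrict_apply_univ, Real.volume_Ioc, sub_zero,
              ← ENNReal.ofReal_add (by positivity) (by positivity), ← ENNReal.ofReal_mul (by positivity)]
            congr 1
            ring
    exact (ENNReal.add_le_add_iff_right ENNReal.ofReal_ne_top).1 h1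
  have hδ : 0 < (r - ρ) / r := div_pos (sub_pos.2 hρr) hr0
  have hsub : {X | ∃ z, ‖z‖ < ρ ∧ H X z = 0}
      ⊆ {X | ENNReal.ofReal (2 * Real.pi * ((r - ρ) / r)) ≤ Y X} := by
    rintro X ⟨z, hz, hz0⟩
    rw [Set.mem_ofPred_eq, hY, hI _ (hc3 X) (fun _ => by positivity)]
    exact ENNReal.ofReal_le_ofReal (le_integral_norm_sub_one_sq_of_zero (hd X) hz.le hρr hz0)
  have hpi := Real.two_pi_pos
  calc Q {X | ∃ z, ‖z‖ < ρ ∧ H X z = 0}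
      ≤ Q {X | ENNReal.ofReal (2 * Real.pi * ((r - ρ) / r)) ≤ Y X} := measure_mono hsub
    _ ≤ (∫⁻ X, Y X ∂Q) / ENNReal.ofReal (2 * Real.pi * ((r - ρ) / r)) :=
        meas_ge_le_lintegral_div hYm.aemeasurable (by simp; positivity) ENNReal.ofReal_ne_top
    _ ≤ ENNReal.ofReal (2 * Real.pi * B) / ENNReal.ofReal (2 * Real.pi * ((r - ρ) / r)) := by gcongr
    _ = _ := by
        rw [← ENNReal.ofReal_div_of_pos (by positivity)]
        congr 1
        rw [mul_div_mul_left _ _ hpi.ne']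

theorem measure_hasZeroInDisk_le {n : ℕ} {Ω : Type*} [MeasurableSpace Ω] {μ : Measure Ω}
    [IsProbabilityMeasure μ] {ν : ℝ} (hν : 0 < ν) {W : Ω → Matrix (Fin n) (Fin n) ℂ}
    (hW : HasLaw (fun ω (ij : Fin n × Fin n) => W ω ij.1 ij.2)
      (Measure.pi fun _ => complexGaussian ν) μ) (hn : 0 < n)
    {ρ r : ℝ} (hr0 : 0 < r) (hρr : ρ < r) {t p y : ℝ} (ht : t = ν * r ^ 2)
    (hp : p * n = t) (hp1 : p < 1) (hpy : p ≤ y) (hy1 : y < 1)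
    (hy : y / (1 - y ^ 2) = 2 * (p / (1 - p ^ 2))) {B : ℝ} (hB0 : 0 ≤ B)
    (hB : tiltedBound n t p y ≤ 1 + B) :
    μ {ω | HasZeroInDisk (W ω) ρ} ≤ ENNReal.ofReal (B / ((r - ρ) / r)) := by
  obtain ⟨Q, hQ⟩ : ∃ Q : Measure (Fin n × Fin n → ℂ), Q = Measure.pi fun _ => complexGaussian ν :=
    ⟨_, rfl⟩
  have hQP : IsProbabilityMeasure Q := by
    rw [hQ, ← hW.map_eq]; exact Measure.isProbabilityMeasure_map hW.aemeasurable
  obtain ⟨a₀⟩ : Nonempty (Fin n) := ⟨⟨0, hn⟩⟩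
  obtain ⟨O, hO, hcol⟩ := exists_orthogonal_constant_column a₀
  rw [Fintype.card_fin] at hcol
  have hlaw : HasLaw (fun (X : Fin n × Fin n → ℂ) (ij : Fin n × Fin n) =>
      (Matrix.of fun i j => X (i, j) : Matrix (Fin n) (Fin n) ℂ) ij.1 ij.2)
      (Measure.pi fun _ => complexGaussian ν) Q := by
    refine ⟨aemeasurable_id, ?_⟩
    rw [← hQ]
    exact Measure.map_id
  have hm : Measurable fun q : (Fin n × Fin n → ℂ) × ℝ =>
      correctedPoly O a₀ t p y (Matrix.of fun i j => q.1 (i, j)) (circleMap 0 r q.2) := by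
    have h2 : Continuous fun q : (Fin n × Fin n → ℂ) × ℝ => (q.1, circleMap 0 r q.2) :=
      continuous_fst.prodMk ((continuous_circleMap 0 r).comp continuous_snd)
    have h3 := (continuous_correctedPoly_uncurry O a₀ t p y).comp h2
    simp only [Function.comp_def] at h3
    exact h3.measurable
  have hb : ∀ z : ℂ, ‖z‖ = r → ∫⁻ X, ENNReal.ofReal (‖correctedPoly O a₀ t p y
      (Matrix.of fun i j => X (i, j)) z‖ ^ 2) ∂Q ≤ ENNReal.ofReal (1 + B) := by
    intro z hz
    refine le_trans ?_ (ENNReal.ofReal_le_ofReal hB)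
    refine lintegral_correctedPoly_le hν hlaw hO hcol ?_ ?_ hp hp1 hpy hy1 hy
    · rw [← norm_pos_iff, hz]; exact hr0
    · rw [ht, hz]
  have key := measure_exists_zero_le (Q := Q) (B := B) (H := fun X => correctedPoly O a₀ t p y
      (Matrix.of fun i j => X (i, j))) hr0 hρr hm
    (fun X => differentiable_correctedPoly _ _ _ _ _ _) (fun X => correctedPoly_zero _ _ _ _ _ _) hB0
    hb
  refine le_trans ?_ key
  rw [hQ, ← hW.map_eq]
  -- Measurability of the set of matrices having a zero is not established; this inequality between
  -- a law and its preimages holds for arbitrary sets.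
  refine le_trans (measure_mono ?_) (Measure.le_map_apply hW.aemeasurable _)
  rintro ω ⟨z, hz, hz0⟩
  refine ⟨z, hz, ?_⟩
  change permPoly (W ω) z * _ = 0
  rw [hz0, zero_mul]

/-- The equation is a quadratic in y with a root near 2p. Rewritten as y = 2p - 2py² + p²y, it gives
the lower bound with 18p³ from y² ≤ 9p². -/
theorem exists_tilt {p : ℝ} (hp0 : 0 < p) (hp : p ≤ 1 / 12) :
    ∃ y, p ≤ y ∧ y ≤ 3 * p ∧ 2 * p - 18 * p ^ 3 ≤ y ∧ y / (1 - y ^ 2) = 2 * (p / (1 - p ^ 2)) := by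
  have hc : ContinuousOn (fun y : ℝ => 2 * p * y ^ 2 + (1 - p ^ 2) * y - 2 * p) (Set.Icc p (3 * p)) := by
    fun_prop
  have hp2 : p ^ 2 ≤ 1 / 144 := by nlinarith
  obtain ⟨y, ⟨hy1, hy2⟩, hy⟩ := intermediate_value_Icc (by linarith : p ≤ 3 * p) hc
    (show (0 : ℝ) ∈ Set.Icc _ _ from ⟨by nlinarith [mul_pos hp0 hp0], by nlinarith [mul_pos hp0 hp0, mul_pos hp0 (mul_pos hp0 hp0)]⟩)
  simp only at hy
  have hy9 : y ^ 2 ≤ 9 * p ^ 2 := by nlinarith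
  refine ⟨y, hy1, hy2, by nlinarith [mul_le_mul_of_nonneg_left hy9 hp0.le, mul_nonneg (hp0.le.trans hy1) (sq_nonneg p)], ?_⟩
  have h1 : 1 - y ^ 2 ≠ 0 := by nlinarith
  have h2 : 1 - p ^ 2 ≠ 0 := by nlinarith
  field_simp
  linarith

/-! ### Numerical estimate of the tilted second moment. -/

theorem inv_one_sub_le_exp {x : ℝ} (h : x ≤ 1 / 2) :
    (1 - x)⁻¹ ≤ Real.exp (x + 2 * x ^ 2) := by
  have h1 := Real.add_one_le_exp (x + 2 * x ^ 2)
  refine le_trans ?_ h1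
  rw [inv_le_iff_one_le_mul₀ (by linarith)]
  nlinarith [mul_nonneg (sq_nonneg x) (by linarith : 0 ≤ 1 - 2 * x)]

theorem one_sub_le_exp_cubic {x : ℝ} (h0 : 0 ≤ x) (h : x ≤ 1 / 2) :
    1 - x ≤ Real.exp (-x - x ^ 2 / 2 + 2 * x ^ 3) := by
  have h1 := Real.abs_log_sub_add_sum_range_le (x := x) (by rw [abs_of_nonneg h0]; linarith) 2
  rw [abs_of_nonneg h0] at h1
  have h2 := (abs_le.1 h1).2
  simp only [Finset.sum_range_succ, Finset.sum_range_zero] at h2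
  have h3 : x ^ (2 + 1) / (1 - x) ≤ 2 * x ^ 3 := by
    rw [div_le_iff₀ (by linarith)]
    norm_num only
    nlinarith [mul_nonneg (pow_nonneg h0 3) (by linarith : 0 ≤ 1 - 2 * x)]
  rw [← Real.exp_log (by linarith : 0 < 1 - x)]
  refine Real.exp_le_exp.2 ?_
  norm_num at h2 h3 ⊢
  linarith

/-- With t = np and y ≈ 2p, the exponents np² + (1 - 2p)np - 2np - np² + np(1 + 2p) cancel in the
first and second order in p. What remains is a multiple of np³: 30, 9 and 4 from the last factor,
from y² and from (1 - p)^(2n), plus quartic terms, so 60 is generous. -/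
theorem tiltedBound_le_exp {n : ℕ} {t p y : ℝ} (hp0 : 0 < p) (hp : p ≤ 1 / 12) (hpn : p * n = t)
    (ht : 1 ≤ t) (hpy : p ≤ y) (hy3 : y ≤ 3 * p) (hy2 : 2 * p - 18 * p ^ 3 ≤ y) :
    tiltedBound n t p y ≤ Real.exp (60 * (n * p ^ 3)) := by
  have hp2 : p ^ 2 ≤ 1 / 144 := by nlinarith
  have hn0 : (0 : ℝ) ≤ n := Nat.cast_nonneg n
  have hy9 : y ^ 2 ≤ 9 * p ^ 2 := by nlinarith
  have hy0 : 0 ≤ y := hp0.le.trans hpy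
  have hy16 : y ^ 2 ≤ 1 / 16 := by nlinarith
  have b1 : (1 - p ^ 2)⁻¹ ^ (n - 1) ≤ Real.exp (n * (p ^ 2 + 2 * (p ^ 2) ^ 2)) := by
    rw [Real.exp_nat_mul]
    have h1 : 1 ≤ (1 - p ^ 2)⁻¹ := (one_le_inv₀ (by linarith)).2 (by nlinarith)
    refine (pow_le_pow_right₀ h1 (Nat.sub_le n 1)).trans ?_
    exact pow_le_pow_left₀ (by positivity) (inv_one_sub_le_exp (by linarith)) n
  have b2 : √(1 - y ^ 2)⁻¹ ≤ Real.exp (y ^ 2) := by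
    rw [Real.sqrt_le_left (Real.exp_pos _).le, ← Real.exp_nat_mul]
    refine (inv_one_sub_le_exp (by linarith)).trans (Real.exp_le_exp.2 ?_)
    push_cast
    nlinarith [sq_nonneg y]
  have b4 : (1 - p) ^ (2 * n) ≤ Real.exp (2 * n * (-p - p ^ 2 / 2 + 2 * p ^ 3)) := by
    have : (2 : ℝ) * n = ((2 * n : ℕ) : ℝ) := by push_cast; ring
    rw [this, Real.exp_nat_mul]
    exact pow_le_pow_left₀ (by linarith) (one_sub_le_exp_cubic hp0.le (by linarith)) _
  have b5 : t / (1 - y ^ 2) / (1 - p) ^ 2 ≤ t * (1 + 2 * p + 30 * p ^ 2) := by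
    rw [div_div, div_le_iff₀ (by have : 0 < 1 - y ^ 2 := by linarith
                                 have : 0 < 1 - p := by linarith
                                 positivity)]
    rw [mul_assoc]
    refine le_mul_of_one_le_right (by linarith) ?_
    have c1 : 1 - 9 * p ^ 2 ≤ 1 - y ^ 2 := by linarith
    have c2 : (1 - 9 * p ^ 2) * (1 - p) ^ 2 ≤ (1 - y ^ 2) * (1 - p) ^ 2 :=
      mul_le_mul_of_nonneg_right c1 (sq_nonneg _)
    have c3 : (1 + 2 * p + 30 * p ^ 2) * ((1 - 9 * p ^ 2) * (1 - p) ^ 2)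
        ≤ (1 + 2 * p + 30 * p ^ 2) * ((1 - y ^ 2) * (1 - p) ^ 2) :=
      mul_le_mul_of_nonneg_left c2 (by positivity)
    refine le_trans ?_ c3
    have : (1 + 2 * p + 30 * p ^ 2) * ((1 - 9 * p ^ 2) * (1 - p) ^ 2) - 1
        = p ^ 2 * (18 - 58 * p - 213 * p ^ 2 + 522 * p ^ 3 - 270 * p ^ 4) := by ring
    have h2 : 0 ≤ 18 - 58 * p - 213 * p ^ 2 + 522 * p ^ 3 - 270 * p ^ 4 := by
      have h4 : p ^ 4 ≤ p ^ 2 := by nlinarith [sq_nonneg p]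
      have h3 : 0 ≤ p ^ 3 := by positivity
      nlinarith
    nlinarith [mul_nonneg (sq_nonneg p) h2]
  unfold tiltedBound
  calc (1 - p ^ 2)⁻¹ ^ (n - 1) * √(1 - y ^ 2)⁻¹ * Real.exp ((1 - y) * t) * (1 - p) ^ (2 * n)
          * Real.exp (t / (1 - y ^ 2) / (1 - p) ^ 2)
      ≤ Real.exp (n * (p ^ 2 + 2 * (p ^ 2) ^ 2)) * Real.exp (y ^ 2) * Real.exp ((1 - y) * t)
          * Real.exp (2 * n * (-p - p ^ 2 / 2 + 2 * p ^ 3))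
          * Real.exp (t * (1 + 2 * p + 30 * p ^ 2)) := by
        have : 0 ≤ (1 - p ^ 2)⁻¹ := inv_nonneg.2 (by linarith)
        have : 0 ≤ 1 - p := by linarith
        gcongr
    _ ≤ _ := by
        rw [← Real.exp_add, ← Real.exp_add, ← Real.exp_add, ← Real.exp_add]
        refine Real.exp_le_exp.2 ?_
        -- The single mode of tilt y costs order p², with no factor n. It is absorbed because t = np
        -- ≥ 1.
        have k1 : y ^ 2 ≤ 9 * (n * p ^ 3) := by
          have : p ^ 2 ≤ p ^ 2 * t := le_mul_of_one_le_right (sq_nonneg p) ht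
          calc y ^ 2 ≤ 9 * p ^ 2 := hy9
            _ ≤ 9 * (p ^ 2 * t) := by linarith
            _ = _ := by rw [← hpn]; ring
        have k2 : (1 - y) * t ≤ (1 - (2 * p - 18 * p ^ 3)) * t :=
          mul_le_mul_of_nonneg_right (by linarith) (by linarith)
        have k3 : n * p ^ 4 ≤ (n * p ^ 3) * (1 / 12) := by
          calc n * p ^ 4 = n * p ^ 3 * p := by ring
            _ ≤ _ := mul_le_mul_of_nonneg_left hp (by positivity)
        have k4 : 0 ≤ n * p ^ 3 := by positivity
        subst hpn
        nlinarith

theorem measure_hasZeroInDisk_zeroFreeRadius_le {ε β ν : ℝ} (hε0 : 0 < ε) (hβ0 : 0 < β)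
    (hβ : β < 1 / 3) (hν : 0 < ν) {n : ℕ} (hn : 1728 ≤ n) {Ω : Type*} [MeasurableSpace Ω]
    {μ : Measure Ω} [IsProbabilityMeasure μ] {W : Ω → Matrix (Fin n) (Fin n) ℂ}
    (hlaw : ∀ i j, HasLaw (fun ω => W ω i j) (complexGaussian ν) μ)
    (hind : iIndepFun (fun (p : Fin n × Fin n) ω => W ω p.1 p.2) μ) :
    μ {ω | HasZeroInDisk (W ω) ((1 - ε / 2) * zeroFreeRadius β ν n)}
      ≤ ENNReal.ofReal (2 / ε * (60 * Real.exp 60) * (n : ℝ) ^ (-6 * β)) := by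
  have hn' : (1728 : ℝ) ≤ n := by exact_mod_cast hn
  have hn0 : (0 : ℝ) < n := by linarith
  set r := zeroFreeRadius β ν n with hr
  have hr0 : 0 < r := div_pos (Real.rpow_pos_of_pos hn0 _) (Real.sqrt_pos.2 hν)
  set t := (n : ℝ) ^ (2 / 3 - 2 * β) with ht
  set p := (n : ℝ) ^ (-(1 / 3) - 2 * β) with hp
  have hp0 : 0 < p := Real.rpow_pos_of_pos hn0 _
  have hpt : p * n = t := by
    rw [hp, ht, ← Real.rpow_add_one hn0.ne']
    congr 1
    ring
  have htr : t = ν * r ^ 2 := by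
    rw [hr, zeroFreeRadius, div_pow, Real.sq_sqrt hν.le, ← Real.rpow_natCast, ← Real.rpow_mul hn0.le, ht,
      mul_div_cancel₀ _ hν.ne']
    congr 1
    push_cast
    ring
  have ht1 : 1 ≤ t := Real.one_le_rpow (by linarith) (by linarith)
  -- The threshold 1728 = 12³ is chosen for this bound, which holds uniformly in β.
  have hp12 : p ≤ 1 / 12 := by
    calc p ≤ (n : ℝ) ^ (-(1 / 3) : ℝ) := Real.rpow_le_rpow_of_exponent_le (by linarith) (by linarith)
      _ ≤ (1728 : ℝ) ^ (-(1 / 3) : ℝ) := Real.rpow_le_rpow_of_nonpos (by norm_num) hn' (by norm_num)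
      _ = 1 / 12 := by
        rw [show (1728 : ℝ) = 12 ^ (3 : ℝ) by norm_num, ← Real.rpow_mul (by norm_num)]
        norm_num [Real.rpow_neg_one]
  have hnp : n * p ^ 3 = (n : ℝ) ^ (-6 * β) := by
    rw [hp, ← Real.rpow_natCast, ← Real.rpow_mul hn0.le]
    nth_rewrite 1 [← Real.rpow_one (n : ℝ)]
    rw [← Real.rpow_add hn0]
    congr 1
    push_cast
    ring
  have hnp1 : (n : ℝ) ^ (-6 * β) ≤ 1 := Real.rpow_le_one_of_one_le_of_nonpos (by linarith) (by linarith)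
  have hnp0 : 0 ≤ (n : ℝ) ^ (-6 * β) := Real.rpow_nonneg hn0.le _
  obtain ⟨y, hy1, hy2, hy3, hy⟩ := exists_tilt hp0 hp12
  have hB := tiltedBound_le_exp hp0 hp12 hpt ht1 hy1 hy2 hy3
  rw [hnp] at hB
  -- From e^x (1 - x) ≤ 1 one gets e^x ≤ 1 + x e^x, and here x ≤ 60.
  have hB2 : Real.exp (60 * (n : ℝ) ^ (-6 * β)) ≤ 1 + 60 * Real.exp 60 * (n : ℝ) ^ (-6 * β) := by
    set x := 60 * (n : ℝ) ^ (-6 * β) with hx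
    have h1 := Real.add_one_le_exp (-x)
    have h2 : Real.exp x * (-x + 1) ≤ 1 := by
      calc Real.exp x * (-x + 1) ≤ Real.exp x * Real.exp (-x) :=
            mul_le_mul_of_nonneg_left h1 (Real.exp_pos x).le
        _ = 1 := by rw [← Real.exp_add]; simp
    have h3 : Real.exp x ≤ Real.exp 60 := Real.exp_le_exp.2 (by linarith)
    have h4 : Real.exp x * x ≤ Real.exp 60 * x := mul_le_mul_of_nonneg_right h3 (by positivity)
    calc Real.exp x ≤ 1 + Real.exp 60 * x := by linarith
      _ = _ := by rw [hx]; ring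
  have hW := iIndepFun.hasLaw_pi (fun p : Fin n × Fin n => hlaw p.1 p.2) hind
  refine (measure_hasZeroInDisk_le hν hW (by omega) hr0 (ρ := (1 - ε / 2) * r)
    (by nlinarith) htr hpt (by linarith) hy1 (by linarith) hy (B := 60 * Real.exp 60 * (n : ℝ) ^ (-6 * β))
    (by positivity) (hB.trans hB2)).trans (le_of_eq ?_)
  congr 1
  have : (r - (1 - ε / 2) * r) / r = ε / 2 := by field_simp; ring
  rw [this]
  field_simp

end Zeros

/-! ### The logarithm of a polynomial in terms of its roots -/

section LogPoly

open Polynomial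

theorem permanent_eq_factorial_mul_permPoly {n : ℕ} (W : Matrix (Fin n) (Fin n) ℂ) {ρ : ℂ} (hρ : ρ ≠ 0) :
    (ρ • allOnes n + W).permanent = (n.factorial : ℂ) * ρ ^ n * permPoly W ρ⁻¹ := by
  have hn : ((n.factorial : ℕ) : ℂ) ≠ 0 := by exact_mod_cast n.factorial_ne_zero
  have h : ρ • allOnes n + W = ρ • (allOnes n + ρ⁻¹ • W) := by
    rw [smul_add, smul_smul, mul_inv_cancel₀ hρ, one_smul]
  rw [h, Matrix.permanent_smul, permPoly, Fintype.card_fin]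
  field_simp

theorem norm_le_of_not_hasZeroInDisk {n : ℕ} (hn : 0 < n) {W : Matrix (Fin n) (Fin n) ℂ}
    {ε β ν : ℝ} (hε : ε < 1) (hν : 0 < ν)
    (hW : ¬ HasZeroInDisk W ((1 - ε) * zeroFreeRadius β ν n)) {ρ : ℂ}
    (h0 : (ρ • allOnes n + W).permanent = 0) :
    ‖ρ‖ ≤ (1 - ε)⁻¹ * Real.sqrt ν * (n : ℝ) ^ (-1 / 3 + β) := by
  have hn' : (0 : ℝ) < n := by exact_mod_cast hn
  have hε' : 0 < 1 - ε := by linarith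
  have hs := Real.sqrt_pos.2 hν
  have hp := Real.rpow_pos_of_pos hn' (-1 / 3 + β)
  by_cases hρ : ρ = 0
  · rw [hρ, norm_zero]; positivity
  by_contra! hlt
  refine hW ⟨ρ⁻¹, ?_, ?_⟩
  · have e : (1 - ε) * zeroFreeRadius β ν n = ((1 - ε)⁻¹ * Real.sqrt ν * (n : ℝ) ^ (-1 / 3 + β))⁻¹ := by
      have : (n : ℝ) ^ (1 / 3 - β) = ((n : ℝ) ^ (-1 / 3 + β))⁻¹ := by
        rw [← Real.rpow_neg hn'.le]
        congr 1
        ring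
      rw [zeroFreeRadius, this]
      field_simp
    rw [e, norm_inv]
    exact inv_strictAnti₀ (by positivity) hlt
  · rw [permanent_eq_factorial_mul_permPoly W hρ] at h0
    have hf : ((n.factorial : ℕ) : ℂ) ≠ 0 := by exact_mod_cast n.factorial_ne_zero
    simpa [hf, hρ] using h0

/-- `G_W` as a polynomial. -/
def permPolynomial {n : ℕ} (W : Matrix (Fin n) (Fin n) ℂ) : ℂ[X] :=
  C ((n.factorial : ℂ)⁻¹) * ∑ σ : Equiv.Perm (Fin n), ∏ i, (1 + C (W (σ i) i) * X)

theorem eval_permPolynomial {n : ℕ} (W : Matrix (Fin n) (Fin n) ℂ) (z : ℂ) :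
    (permPolynomial W).eval z = permPoly W z := by
  have h : ∀ a : ℂ, 1 + a * z = 1 + z * a := fun a => by rw [mul_comm]
  simp only [permPolynomial, permPoly, Matrix.permanent, eval_mul, eval_C, eval_finsetSum, eval_prod,
    eval_add, eval_one, eval_X, allOnes, Matrix.add_apply, Matrix.smul_apply, Matrix.of_apply,
    smul_eq_mul, h]
  rw [div_eq_inv_mul]

theorem natDegree_permPolynomial_le {n : ℕ} (W : Matrix (Fin n) (Fin n) ℂ) :
    (permPolynomial W).natDegree ≤ n := by
  refine (natDegree_C_mul_le _ _).trans (natDegree_sum_le_of_forall_le _ _ fun σ _ => ?_)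
  refine (natDegree_prod_le _ _).trans ?_
  refine (Finset.sum_le_card_nsmul _ _ 1 fun i _ => ?_).trans (by simp)
  compute_degree

/-! ### Inverse roots and the Taylor coefficients of the logarithm. -/

theorem exists_eq_prod_one_sub {P : ℂ[X]} (h1 : P.eval 0 = 1) :
    ∃ (N : ℕ) (l : Fin N → ℂ), N ≤ P.natDegree ∧ P = ∏ i, (1 - C (l i) * X) := by
  have hs := IsAlgClosed.splits P
  obtain ⟨L, hL⟩ := Quot.exists_rep P.roots
  have hprod : P = C P.leadingCoeff * (L.map fun a => X - C a).prod := by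
    conv_lhs => rw [hs.eq_prod_roots, ← hL]
    simp
  have hlen : L.length ≤ P.natDegree := by
    have := P.card_roots'
    rw [← hL] at this
    simpa using this
  rw [← Fin.prod_univ_fun_getElem] at hprod
  refine ⟨L.length, fun i => (L[i.1])⁻¹, hlen, ?_⟩
  have h0 := congrArg (eval 0) hprod
  rw [h1] at h0
  simp only [eval_mul, eval_C, eval_prod, eval_sub, eval_X, zero_sub] at h0
  have hne : ∀ i : Fin L.length, L[i.1] ≠ 0 := by
    intro i hi
    rw [Finset.prod_eq_zero (Finset.mem_univ i) (by rw [hi, neg_zero]), mul_zero] at h0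
    exact one_ne_zero h0
  have e : ∀ i : Fin L.length, (X - C L[i.1] : ℂ[X]) = C (-L[i.1]) * (1 - C (L[i.1])⁻¹ * X) := by
    intro i
    rw [mul_sub, ← mul_assoc, ← C_mul, neg_mul, mul_inv_cancel₀ (hne i)]
    simp
    ring
  calc P = C P.leadingCoeff * ∏ i : Fin L.length, (X - C L[i.1]) := hprod
    _ = C (P.leadingCoeff * ∏ i : Fin L.length, (-L[i.1])) * ∏ i : Fin L.length, (1 - C (L[i.1])⁻¹ * X) := by
        simp only [e]
        rw [Finset.prod_mul_distrib, C_mul, map_prod, mul_assoc]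
    _ = _ := by rw [← h0]; simp

theorem iteratedDeriv_log_one_sub {l : ℂ} {k : ℕ} (hk : 1 ≤ k) :
    iteratedDeriv k (fun t => Complex.log (1 - l * t)) 0 / (k.factorial : ℂ) = -(l ^ k / k) := by
  obtain ⟨k, rfl⟩ : ∃ j, k = j + 1 := ⟨k - 1, by omega⟩
  have h_eq : deriv (fun t => Complex.log (1 - l * t)) =ᶠ[nhds 0] fun t => -l * ((-l) * t + 1)⁻¹ := by
    have hopen : ∀ᶠ t in nhds (0 : ℂ), 1 - l * t ∈ Complex.slitPlane := by
      have hc : ContinuousAt (fun t : ℂ => 1 - l * t) 0 := by fun_prop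
      exact hc.eventually_mem (Complex.isOpen_slitPlane.mem_nhds (by simp))
    filter_upwards [hopen] with t ht
    have h1 : HasDerivAt (fun t : ℂ => 1 - l * t) (-l) t := by
      simpa using ((hasDerivAt_id t).const_mul l).const_sub 1
    rw [(h1.clog ht).deriv, div_eq_mul_inv]
    congr 2
    ring
  rw [iteratedDeriv_succ', h_eq.iteratedDeriv_eq, iteratedDeriv_const_mul_field,
    iteratedDeriv_eq_iterate, iter_deriv_inv_linear, Nat.factorial_succ]
  have h2 : ((k.factorial : ℕ) : ℂ) ≠ 0 := by exact_mod_cast k.factorial_ne_zero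
  have h3 : ((k : ℂ) + 1) ≠ 0 := by exact_mod_cast k.succ_ne_zero
  have h4 : (-1 : ℂ) ^ k * (-1) ^ k = 1 := by rw [← mul_pow]; simp
  simp only [mul_zero, zero_add, one_zpow, mul_one]
  rw [neg_pow l k]
  push_cast
  field_simp
  linear_combination (-l ^ k * l) * h4

theorem iteratedDeriv_sum_log_one_sub {N : ℕ} (l : Fin N → ℂ) {k : ℕ} (hk : 1 ≤ k) :
    iteratedDeriv k (fun t => ∑ i, Complex.log (1 - l i * t)) 0 / (k.factorial : ℂ)
      = -((∑ i, l i ^ k) / k) := by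
  rw [iteratedDeriv_fun_sum, Finset.sum_div, Finset.sum_div, ← Finset.sum_neg_distrib]
  · exact Finset.sum_congr rfl fun i _ => iteratedDeriv_log_one_sub hk
  · intro i _
    have h : AnalyticAt ℂ (fun t => Complex.log (1 - l i * t)) 0 :=
      AnalyticAt.clog (by fun_prop) (by simp)
    exact h.contDiffAt

theorem logTaylor_eq {n N : ℕ} {W : Matrix (Fin n) (Fin n) ℂ} {l : Fin N → ℂ}
    (hl : ∀ z, permPoly W z = ∏ i, (1 - l i * z)) (m : ℕ) (z : ℂ) :
    logTaylor W m z = ∑ k ∈ Finset.Icc 1 m, -((∑ i, l i ^ k) / k) * z ^ k := by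
  -- The principal logarithm of a product is the sum of the logarithms only while the imaginary part
  -- of the sum stays in (-π, π), which continuity ensures near 0.
  have hloc : (fun t => Complex.log (permPoly W t)) =ᶠ[nhds 0] fun t => ∑ i, Complex.log (1 - l i * t) := by
    have hc : ∀ i, ContinuousAt (fun t : ℂ => Complex.log (1 - l i * t)) 0 := fun i =>
      ContinuousAt.clog (by fun_prop) (by simp)
    have hs : ContinuousAt (fun t : ℂ => (∑ i, Complex.log (1 - l i * t)).im) 0 :=
      Complex.continuous_im.continuousAt.comp (tendsto_finsetSum _ fun i _ => hc i)
    have h1 : ∀ᶠ t in nhds (0 : ℂ), (∑ i, Complex.log (1 - l i * t)).im ∈ Set.Ioo (-Real.pi) Real.pi :=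
      hs.eventually_mem (isOpen_Ioo.mem_nhds (by simp [Real.pi_pos]))
    have h2 : ∀ᶠ t in nhds (0 : ℂ), ∀ i, 1 - l i * t ≠ 0 := by
      rw [Filter.eventually_all]
      intro i
      have hc : ContinuousAt (fun t : ℂ => 1 - l i * t) 0 := by fun_prop
      exact hc.eventually_ne (by simp)
    filter_upwards [h1, h2] with t ht1 ht2
    rw [← Complex.log_exp ht1.1 ht1.2.le, Complex.exp_sum, hl]
    congr 1
    exact Finset.prod_congr rfl fun i _ => (Complex.exp_log (ht2 i)).symm
  unfold logTaylor
  refine Finset.sum_congr rfl fun k hk => ?_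
  rw [hloc.iteratedDeriv_eq, iteratedDeriv_sum_log_one_sub l (Finset.mem_Icc.1 hk).1]

/-! ### Truncation error and size of the Taylor polynomial of the logarithm. -/

theorem norm_log_one_sub_add_sum_le {z : ℂ} {q : ℝ} (hz : ‖z‖ ≤ q) (hq : q < 1) (m : ℕ) :
    ‖Complex.log (1 - z) - ∑ k ∈ Finset.Icc 1 m, -(z ^ k / k)‖ ≤ q ^ (m + 1) / (1 - q) := by
  have h := Complex.norm_log_sub_logTaylor_le m (z := -z) (by rw [norm_neg]; linarith)
  have e : Complex.logTaylor (m + 1) (-z) = ∑ k ∈ Finset.Icc 1 m, -(z ^ k / k) := by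
    rw [Complex.logTaylor, Finset.range_eq_Ico, Finset.sum_eq_sum_Ico_succ_bot (by omega)]
    simp only [Nat.cast_zero, div_zero, zero_add]
    refine Finset.sum_congr (by ext; simp) fun k _ => ?_
    rw [neg_pow z k, ← mul_assoc, ← pow_add, show k + 1 + k = 2 * k + 1 by ring, pow_succ, pow_mul]
    simp [neg_div]
  rw [← sub_eq_add_neg, e, norm_neg] at h
  refine h.trans ?_
  have hq0 : 0 ≤ q := (norm_nonneg z).trans hz
  have h1 : ‖z‖ ^ (m + 1) * (1 - ‖z‖)⁻¹ ≤ q ^ (m + 1) / (1 - q) := by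
    rw [div_eq_mul_inv]
    have : 0 < 1 - q := by linarith
    have : 0 ≤ (1 - ‖z‖)⁻¹ := inv_nonneg.2 (by linarith)
    gcongr
  have h0 : 0 ≤ q ^ (m + 1) / (1 - q) := by
    have : 0 < 1 - q := by linarith
    positivity
  refine (div_le_div_of_nonneg_right h1 (by positivity)).trans ?_
  exact div_le_self h0 (by linarith [Nat.cast_nonneg (α := ℝ) m])

theorem norm_sum_log_sub_logTaylor_le {n N : ℕ} {W : Matrix (Fin n) (Fin n) ℂ} {l : Fin N → ℂ}
    (hl : ∀ z, permPoly W z = ∏ i, (1 - l i * z)) (hN : N ≤ n) {z : ℂ} {q : ℝ}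
    (hz : ∀ i, ‖l i * z‖ ≤ q) (hq0 : 0 ≤ q) (hq : q < 1) (m : ℕ) :
    ‖∑ i, Complex.log (1 - l i * z) - logTaylor W m z‖ ≤ n * (q ^ (m + 1) / (1 - q)) := by
  have e : logTaylor W m z = ∑ i, ∑ k ∈ Finset.Icc 1 m, -((l i * z) ^ k / k) := by
    rw [logTaylor_eq hl, Finset.sum_comm]
    refine Finset.sum_congr rfl fun k _ => ?_
    rw [Finset.sum_div, neg_mul, Finset.sum_mul, ← Finset.sum_neg_distrib]
    refine Finset.sum_congr rfl fun i _ => ?_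
    rw [mul_pow]
    ring
  rw [e, ← Finset.sum_sub_distrib]
  have h0 : 0 ≤ q ^ (m + 1) / (1 - q) := by
    have : 0 < 1 - q := by linarith
    positivity
  calc _ ≤ ∑ i, ‖Complex.log (1 - l i * z) - ∑ k ∈ Finset.Icc 1 m, -((l i * z) ^ k / k)‖ :=
        norm_sum_le _ _
    _ ≤ ∑ _i : Fin N, q ^ (m + 1) / (1 - q) :=
        Finset.sum_le_sum fun i _ => norm_log_one_sub_add_sum_le (hz i) hq m
    _ = N * (q ^ (m + 1) / (1 - q)) := by simp
    _ ≤ _ := mul_le_mul_of_nonneg_right (by exact_mod_cast hN) h0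

/-- This bound, independent of m, determines how large K must be for (1 + T/K)^K to replace the
exponential. -/
theorem norm_logTaylor_le {n N : ℕ} {W : Matrix (Fin n) (Fin n) ℂ} {l : Fin N → ℂ}
    (hl : ∀ z, permPoly W z = ∏ i, (1 - l i * z)) (hN : N ≤ n) {z : ℂ} {q : ℝ}
    (hz : ∀ i, ‖l i * z‖ ≤ q) (hq0 : 0 ≤ q) (hq : q < 1) (m : ℕ) :
    ‖logTaylor W m z‖ ≤ n * (1 - q)⁻¹ := by
  rw [logTaylor_eq hl]
  have h1 : ∀ k ∈ Finset.Icc 1 m, ‖-((∑ i, l i ^ k) / k) * z ^ k‖ ≤ n * q ^ k := by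
    intro k hk
    have hk1 : 1 ≤ (k : ℝ) := by exact_mod_cast (Finset.mem_Icc.1 hk).1
    have e : -((∑ i, l i ^ k) / (k : ℂ)) * z ^ k = -((∑ i, (l i * z) ^ k) / k) := by
      simp only [mul_pow, ← Finset.sum_mul]
      ring
    rw [e, norm_neg, norm_div, Complex.norm_natCast]
    refine (div_le_self (norm_nonneg _) hk1).trans ((norm_sum_le _ _).trans ?_)
    calc ∑ i, ‖(l i * z) ^ k‖ ≤ ∑ _i : Fin N, q ^ k := Finset.sum_le_sum fun i _ => by
          rw [norm_pow]; exact pow_le_pow_left₀ (norm_nonneg _) (hz i) k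
      _ = N * q ^ k := by simp
      _ ≤ _ := mul_le_mul_of_nonneg_right (by exact_mod_cast hN) (by positivity)
  refine (norm_sum_le _ _).trans ((Finset.sum_le_sum h1).trans ?_)
  rw [← Finset.mul_sum]
  refine mul_le_mul_of_nonneg_left ?_ (Nat.cast_nonneg n)
  calc ∑ k ∈ Finset.Icc 1 m, q ^ k ≤ ∑ k ∈ Finset.range (m + 1), q ^ k :=
        Finset.sum_le_sum_of_subset_of_nonneg (fun k hk => by simp at hk ⊢; omega)
          fun _ _ _ => by positivity
    _ ≤ ∑' k, q ^ k := (summable_geometric_of_lt_one hq0 hq).sum_le_tsum _ fun _ _ => by positivity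
    _ = _ := tsum_geometric_of_lt_one hq0 hq

/-- Newton's identities. -/
theorem natCast_mul_coeff_prod_one_sub {ι : Type*} (s : Finset ι) (l : ι → ℂ) (k : ℕ) :
    (k : ℂ) * (∏ i ∈ s, (1 - C (l i) * X)).coeff k
      = ∑ j ∈ Finset.Icc 1 k, -(∑ i ∈ s, l i ^ j) * (∏ i ∈ s, (1 - C (l i) * X)).coeff (k - j) := by
  classical
  induction s using Finset.induction_on generalizing k with
  | empty =>
    rcases k with _ | k
    · simp
    · simp [coeff_one]
  | insert a s ha ih =>
    rw [Finset.prod_insert ha]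
    set Q := ∏ i ∈ s, (1 - C (l i) * X) with hQ
    have hc : ∀ k, ((1 - C (l a) * X) * Q).coeff (k + 1) = Q.coeff (k + 1) - l a * Q.coeff k := by
      intro k
      rw [sub_mul, one_mul, coeff_sub, mul_assoc, coeff_C_mul, coeff_X_mul]
    have hc0 : ((1 - C (l a) * X) * Q).coeff 0 = Q.coeff 0 := by
      rw [sub_mul, one_mul, coeff_sub, mul_assoc, coeff_C_mul, coeff_X_mul_zero, mul_zero, sub_zero]
    -- telescoping of the geometric part
    have htel : ∀ k, ∑ j ∈ Finset.Icc 1 k, l a ^ j * ((1 - C (l a) * X) * Q).coeff (k - j)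
        = if k = 0 then 0 else l a * Q.coeff (k - 1) := by
      intro k
      induction k with
      | zero => simp
      | succ k ihk =>
        rw [← Finset.add_sum_Ioc_eq_sum_Icc (by omega)]
        have e : ∑ j ∈ Finset.Ioc 1 (k + 1), l a ^ j * ((1 - C (l a) * X) * Q).coeff (k + 1 - j)
            = l a * ∑ j ∈ Finset.Icc 1 k, l a ^ j * ((1 - C (l a) * X) * Q).coeff (k - j) := by
          rw [Finset.mul_sum]
          refine Finset.sum_bij' (fun j _ => j - 1) (fun j _ => j + 1) ?_ ?_ ?_ ?_ ?_
          · intro j hj; simp at hj ⊢; omega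
          · intro j hj; simp at hj ⊢; omega
          · intro j hj; simp at hj ⊢; omega
          · intro j hj; simp
          · intro j hj
            obtain ⟨j, rfl⟩ : ∃ i, j = i + 1 := ⟨j - 1, by simp at hj; omega⟩
            simp only [Nat.add_sub_cancel, Nat.add_sub_add_right, pow_succ]
            ring
        rw [e, ihk]
        rcases k with _ | k
        · simp [hc0]
        · simp only [pow_one, Nat.add_sub_cancel, hc, Nat.add_eq_zero_iff, one_ne_zero, and_false, if_false]
          ring
    have hsplit : ∀ j ∈ Finset.Icc 1 k, -(∑ i ∈ insert a s, l i ^ j) * ((1 - C (l a) * X) * Q).coeff (k - j)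
        = -(l a ^ j * ((1 - C (l a) * X) * Q).coeff (k - j))
          + -(∑ i ∈ s, l i ^ j) * ((1 - C (l a) * X) * Q).coeff (k - j) := by
      intro j _
      rw [Finset.sum_insert ha]
      ring
    rw [Finset.sum_congr rfl hsplit, Finset.sum_add_distrib, Finset.sum_neg_distrib, htel]
    rcases k with _ | k
    · simp
    -- The coefficients of (1 - aX)Q are differences of those of Q, so this sum is the identity for
    -- Q in degree k + 1 minus `l a` times the identity in degree k.
    · have hS : ∑ j ∈ Finset.Icc 1 (k + 1), -(∑ i ∈ s, l i ^ j) * ((1 - C (l a) * X) * Q).coeff (k + 1 - j)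
          = ((k + 1 : ℕ) : ℂ) * Q.coeff (k + 1) - l a * ((k : ℂ) * Q.coeff k) := by
        rw [ih (k + 1), ih k, Finset.sum_Icc_succ_top (by omega), Finset.sum_Icc_succ_top (by omega),
          Nat.sub_self, hc0, Finset.mul_sum, add_sub_right_comm, ← Finset.sum_sub_distrib]
        congr 1
        refine Finset.sum_congr rfl fun j hj => ?_
        obtain ⟨i, hi⟩ : ∃ i, k = j + i := ⟨k - j, by simp at hj; omega⟩
        rw [show k + 1 - j = i + 1 by omega, show k - j = i by omega, hc]
        ring
      rw [hS, hc]
      simp only [Nat.add_eq_zero_iff, one_ne_zero, and_false, if_false, Nat.add_sub_cancel]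
      push_cast
      ring

end LogPoly

/-! ### The coefficients of `G_W` as sums over pairs of injective tuples -/

section Coefficients

open Polynomial

/-- The row-major list of the entries of a matrix. -/
def entryArray {n : ℕ} (W : Matrix (Fin n) (Fin n) ℂ) (d : ℕ) : ℂ :=
  if h : d < n * n then W (finProdFinEquiv.symm ⟨d, h⟩).1 (finProdFinEquiv.symm ⟨d, h⟩).2 else 0

/-- The digits of `c` in base `n²`, each of which encodes a position in an `n × n` matrix. -/
def cellDigit (n c l : ℕ) : ℕ := c / (n * n) ^ l % (n * n)

/-- Whether two positions share a row or a column. -/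
def Conflict (n d d' : ℕ) : Prop := d / n = d' / n ∨ d % n = d' % n

instance (n d d' : ℕ) : Decidable (Conflict n d d') := by unfold Conflict; infer_instance

/-- The product of the entries at the `k` positions encoded by `c`, or `0` if two of these share a
row or a column. -/
def tupleWeight (n : ℕ) (w : ℕ → ℂ) (c k : ℕ) : ℂ :=
  ∏ l ∈ Finset.range k, (w (cellDigit n c l) *
    ∏ l' ∈ Finset.range l, if Conflict n (cellDigit n c l) (cellDigit n c l') then 0 else 1)

/-- The sum of the weights of all `k`-tuples of positions. -/
def tupleSum (n : ℕ) (w : ℕ → ℂ) (k : ℕ) : ℂ :=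
  ∑ c ∈ Finset.range ((n * n) ^ k), tupleWeight n w c k

/-- The product `k! n (n - 1) ⋯ (n - k + 1)`, with the factors below `1` replaced by `1`. -/
def tupleDivisor (n k : ℕ) : ℕ := ∏ i ∈ Finset.range k, (i + 1) * (n - (i + 1) + 1)

/-- Summing F(g • y) over both g and y in either order avoids computing stabilizers: by transitivity
the sum over g does not depend on y. -/
theorem card_mul_sum_smul {G X R : Type*} [Group G] [Fintype G] [Fintype X] [MulAction G X]
    [MulAction.IsPretransitive G X] [CommSemiring R] (F : X → R) (x : X) :
    (Fintype.card X : R) * ∑ g : G, F (g • x) = Fintype.card G * ∑ y, F y := by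
  have h1 : ∑ g : G, ∑ y, F (g • y) = Fintype.card G * ∑ y, F y := by
    have h : ∀ g : G, ∑ y, F (g • y) = ∑ y, F y := fun g => Equiv.sum_comp (MulAction.toPerm g) F
    simp [h]
  rw [← h1, Finset.sum_comm]
  have h2 : ∀ y, ∑ g : G, F (g • y) = ∑ g : G, F (g • x) := by
    intro y
    obtain ⟨h, rfl⟩ := MulAction.exists_smul_eq G x y
    simp only [smul_smul]
    exact Equiv.sum_comp (Equiv.mulRight h) fun g => F (g • x)
  simp [h2]

theorem factorial_mul_sum_powersetCard {ι R : Type*} [Fintype ι] [DecidableEq ι] [CommSemiring R]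
    (g : ι → R) (k : ℕ) :
    (k.factorial : R) * ∑ S ∈ Finset.powersetCard k Finset.univ, ∏ i ∈ S, g i
      = ∑ I : Fin k ↪ ι, ∏ l, g (I l) := by
  have hmap : ∀ I ∈ (Finset.univ : Finset (Fin k ↪ ι)), Finset.univ.map I
      ∈ Finset.powersetCard k (Finset.univ : Finset ι) := fun I _ => by
    simp [Finset.mem_powersetCard]
  rw [← Finset.sum_fiberwise_of_maps_to hmap, Finset.mul_sum]
  refine Finset.sum_congr rfl fun S hS => ?_
  have hSk := (Finset.mem_powersetCard.1 hS).2
  have hcard : (Finset.univ.filter fun I : Fin k ↪ ι => Finset.univ.map I = S).card = k.factorial := by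
    have himg : (Finset.univ.filter fun I : Fin k ↪ ι => Finset.univ.map I = S)
        = Finset.univ.image fun J : Fin k ↪ S => J.trans (Function.Embedding.subtype (· ∈ S)) := by
      ext I
      simp only [Finset.mem_filter, Finset.mem_univ, true_and, Finset.mem_image]
      constructor
      · rintro h
        have hm : ∀ l, I l ∈ S := fun l => by rw [← h]; simp
        exact ⟨Function.Embedding.codRestrict (· ∈ S) I hm, by ext; rfl⟩
      · rintro ⟨J, rfl⟩
        refine Finset.eq_of_subset_of_card_le ?_ (by simp [hSk])
        intro x hx
        obtain ⟨l, -, rfl⟩ := Finset.mem_map.1 hx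
        exact (J l).2
    rw [himg, Finset.card_image_of_injective, Finset.card_univ, Fintype.card_embedding_eq]
    · simp [hSk, Nat.descFactorial_self]
    · intro J J' h
      ext l
      exact congrArg (fun e : Fin k ↪ ι => e l) h
  calc (k.factorial : R) * ∏ i ∈ S, g i
      = ∑ I ∈ Finset.univ.filter (fun I : Fin k ↪ ι => Finset.univ.map I = S), ∏ i ∈ S, g i := by
        rw [Finset.sum_const, hcard, nsmul_eq_mul]
    _ = _ := Finset.sum_congr rfl fun I hI => by
        rw [← (Finset.mem_filter.1 hI).2, Finset.prod_map]

theorem coeff_prod_one_add {ι : Type*} [Fintype ι] [DecidableEq ι] (g : ι → ℂ) (k : ℕ) :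
    (∏ i, (1 + C (g i) * X)).coeff k = ∑ S ∈ Finset.powersetCard k Finset.univ, ∏ i ∈ S, g i := by
  rw [Finset.prod_one_add, Polynomial.finsetSum_coeff, Finset.powerset_univ]
  have h : ∀ S : Finset ι, (∏ i ∈ S, (C (g i) * X)).coeff k = if S.card = k then ∏ i ∈ S, g i else 0 := by
    intro S
    rw [Finset.prod_mul_distrib, Finset.prod_const, ← map_prod, coeff_C_mul, coeff_X_pow]
    by_cases h : S.card = k
    · simp [h]
    · rw [if_neg h, if_neg (fun e => h e.symm), mul_zero]
  simp only [h]
  rw [← Finset.sum_filter]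
  refine Finset.sum_congr ?_ fun _ _ => rfl
  ext S
  simp [Finset.mem_powersetCard]

/-- The coefficient averages over permutations the sum over k-sets of columns. The factor k! orders
the columns; the falling factorial appears because permutations act transitively on injective
k-tuples, so the rows σ(I) are equidistributed among them. -/
theorem factorial_mul_coeff_permPolynomial {n : ℕ} (W : Matrix (Fin n) (Fin n) ℂ) (k : ℕ) :
    (k.factorial : ℂ) * n.descFactorial k * (permPolynomial W).coeff k
      = ∑ J : Fin k ↪ Fin n, ∑ I : Fin k ↪ Fin n, ∏ l, W (J l) (I l) := by
  have hn : ((n.factorial : ℕ) : ℂ) ≠ 0 := by exact_mod_cast n.factorial_ne_zero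
  have : MulAction.IsMultiplyPretransitive (Equiv.Perm (Fin n)) (Fin n) k :=
    Equiv.Perm.isMultiplyPretransitive _ _
  have h1 : ∀ I : Fin k ↪ Fin n, (n.descFactorial k : ℂ) * ∑ σ : Equiv.Perm (Fin n), ∏ l, W (σ (I l)) (I l)
      = n.factorial * ∑ J : Fin k ↪ Fin n, ∏ l, W (J l) (I l) := by
    intro I
    have := card_mul_sum_smul (G := Equiv.Perm (Fin n)) (fun J : Fin k ↪ Fin n => ∏ l, W (J l) (I l)) I
    rw [Fintype.card_embedding_eq, Fintype.card_fin, Fintype.card_fin, Fintype.card_perm,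
      Fintype.card_fin] at this
    exact this
  have h2 : (n.factorial : ℂ) * (permPolynomial W).coeff k
      = ∑ σ : Equiv.Perm (Fin n), ∑ S ∈ Finset.powersetCard k Finset.univ, ∏ i ∈ S, W (σ i) i := by
    rw [permPolynomial, coeff_C_mul, mul_inv_cancel_left₀ hn, Polynomial.finsetSum_coeff]
    exact Finset.sum_congr rfl fun σ _ => coeff_prod_one_add _ k
  refine mul_left_cancel₀ hn ?_
  calc (n.factorial : ℂ) * (k.factorial * n.descFactorial k * (permPolynomial W).coeff k)
      = n.descFactorial k * (k.factorial * (n.factorial * (permPolynomial W).coeff k)) := by ring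
    _ = n.descFactorial k * ∑ σ : Equiv.Perm (Fin n), ∑ I : Fin k ↪ Fin n, ∏ l, W (σ (I l)) (I l) := by
        rw [h2, Finset.mul_sum]
        congr 1
        exact Finset.sum_congr rfl fun σ _ => factorial_mul_sum_powersetCard (fun i => W (σ i) i) k
    _ = _ := by
        rw [Finset.sum_comm, Finset.mul_sum, Finset.sum_comm (γ := Fin k ↪ Fin n), Finset.mul_sum]
        exact Finset.sum_congr rfl fun I _ => h1 I

theorem tupleWeight_eq {n k : ℕ} (W : Matrix (Fin n) (Fin n) ℂ) (J I : Fin k → Fin n) :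
    tupleWeight n (entryArray W) (finFunctionFinEquiv fun l => finProdFinEquiv (J l, I l)) k
      = if Function.Injective J ∧ Function.Injective I then ∏ l, W (J l) (I l) else 0 := by
  set c := finFunctionFinEquiv fun l => finProdFinEquiv (J l, I l) with hc
  have hd : ∀ l : Fin k, cellDigit n c l = finProdFinEquiv (J l, I l) := by
    intro l
    have := congrArg (fun f => ((f l : Fin (n * n)) : ℕ)) (finFunctionFinEquiv.symm_apply_apply
      fun l => finProdFinEquiv (J l, I l))
    exact this
  have hrow : ∀ l : Fin k, cellDigit n c l / n = J l := by
    intro l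
    have := congrArg (fun q => (q.1 : ℕ)) (finProdFinEquiv.symm_apply_apply (J l, I l))
    rw [hd]; exact this
  have hcol : ∀ l : Fin k, cellDigit n c l % n = I l := by
    intro l
    have := congrArg (fun q => (q.2 : ℕ)) (finProdFinEquiv.symm_apply_apply (J l, I l))
    rw [hd]; exact this
  have hentry : ∀ l : Fin k, entryArray W (cellDigit n c l) = W (J l) (I l) := by
    intro l
    rw [hd, entryArray, dif_pos (finProdFinEquiv (J l, I l)).2, Fin.eta, Equiv.symm_apply_apply]
  unfold tupleWeight
  rw [Finset.prod_range]
  simp only [hentry]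
  split_ifs with h
  · refine Finset.prod_congr rfl fun l _ => ?_
    rw [Finset.prod_eq_one, mul_one]
    intro l' hl'
    have hlt : l' < l := Finset.mem_range.1 hl'
    have e := hrow ⟨l', hlt.trans l.2⟩
    have e2 := hcol ⟨l', hlt.trans l.2⟩
    simp only at e e2
    rw [if_neg]
    unfold Conflict
    rw [hrow, hcol, e, e2]
    rintro (h1 | h1)
    · have := h.1 (Fin.ext h1)
      exact hlt.ne (congrArg Fin.val this).symm
    · have := h.2 (Fin.ext h1)
      exact hlt.ne (congrArg Fin.val this).symm
  · obtain ⟨l, l', hlt, hcf⟩ : ∃ l l' : Fin k, l' < l ∧ (J l = J l' ∨ I l = I l') := by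
      by_contra! hno
      refine h ⟨fun a b hab => ?_, fun a b hab => ?_⟩
      · rcases lt_trichotomy a b with h1 | h1 | h1
        · exact absurd hab.symm (hno b a h1).1
        · exact h1
        · exact absurd hab (hno a b h1).1
      · rcases lt_trichotomy a b with h1 | h1 | h1
        · exact absurd hab.symm (hno b a h1).2
        · exact h1
        · exact absurd hab (hno a b h1).2
    refine Finset.prod_eq_zero (Finset.mem_univ l) ?_
    rw [Finset.prod_eq_zero (i := (l' : ℕ)) (Finset.mem_range.2 hlt), mul_zero]
    rw [if_pos]
    unfold Conflict
    rw [hrow, hrow, hcol, hcol]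
    exact hcf.imp (fun h => by rw [h]) (fun h => by rw [h])

theorem sum_injective_eq_sum_embedding {α ι : Type*} [Fintype α] [Fintype ι] [DecidableEq α]
    [DecidableEq ι] {R : Type*} [AddCommMonoid R] (F : (α → ι) → R) :
    ∑ f : α → ι, (if Function.Injective f then F f else 0) = ∑ e : α ↪ ι, F e := by
  rw [← Finset.sum_filter, Finset.sum_subtype (p := Function.Injective) _ (by simp)]
  exact (Equiv.subtypeInjectiveEquivEmbedding α ι).symm.sum_comp (fun f => F f.1) |>.symm

theorem tupleSum_eq {n : ℕ} (W : Matrix (Fin n) (Fin n) ℂ) (k : ℕ) :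
    tupleSum n (entryArray W) k = ∑ J : Fin k ↪ Fin n, ∑ I : Fin k ↪ Fin n, ∏ l, W (J l) (I l) := by
  unfold tupleSum
  rw [Finset.sum_range fun c => tupleWeight n (entryArray W) c k]
  let e : (Fin k → Fin n) × (Fin k → Fin n) ≃ Fin ((n * n) ^ k) :=
    ((Equiv.arrowProdEquivProdArrow (Fin k) (fun _ => Fin n) (fun _ => Fin n)).symm.trans
      (Equiv.arrowCongr (Equiv.refl _) finProdFinEquiv)).trans finFunctionFinEquiv
  rw [← e.sum_comp, Fintype.sum_prod_type]
  have h : ∀ J I, tupleWeight n (entryArray W) (e (J, I)) k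
      = if Function.Injective J then (if Function.Injective I then ∏ l, W (J l) (I l) else 0) else 0 := by
    intro J I
    rw [← ite_and]
    exact tupleWeight_eq W J I
  simp only [h]
  rw [← sum_injective_eq_sum_embedding fun J => ∑ I : Fin k ↪ Fin n, ∏ l, W (J l) (I l)]
  refine Finset.sum_congr rfl fun J _ => ?_
  split_ifs
  · exact sum_injective_eq_sum_embedding fun I => ∏ l, W (J l) (I l)
  · simp

theorem tupleDivisor_pos (n k : ℕ) : 0 < tupleDivisor n k :=
  Finset.prod_pos fun i _ => by positivity

theorem tupleDivisor_eq {n k : ℕ} (hk : k ≤ n) : tupleDivisor n k = k.factorial * n.descFactorial k := by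
  rw [tupleDivisor, Finset.prod_mul_distrib, Finset.prod_range_add_one_eq_factorial,
    Nat.descFactorial_eq_prod_range]
  congr 1
  refine Finset.prod_congr rfl fun i hi => ?_
  have := Finset.mem_range.1 hi
  omega

theorem coeff_permPolynomial_eq {n : ℕ} (W : Matrix (Fin n) (Fin n) ℂ) (k : ℕ) :
    (permPolynomial W).coeff k = tupleSum n (entryArray W) k / tupleDivisor n k := by
  rw [tupleSum_eq]
  by_cases hk : k ≤ n
  · have h := factorial_mul_coeff_permPolynomial W k
    have hpos : ((tupleDivisor n k : ℕ) : ℂ) ≠ 0 := by exact_mod_cast (tupleDivisor_pos n k).ne'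
    rw [eq_div_iff hpos, ← h, tupleDivisor_eq hk]
    push_cast
    ring
  -- Beyond degree n both sides vanish: no injective k-tuples exist, and the divisor stays nonzero
  -- by its truncation. The algorithm may therefore run past degree n.
  · rw [coeff_eq_zero_of_natDegree_lt ((natDegree_permPolynomial_le W).trans_lt (not_le.1 hk))]
    have : IsEmpty (Fin k ↪ Fin n) := by
      refine ⟨fun e => hk ?_⟩
      simpa using Fintype.card_le_of_embedding e
    simp

end Coefficients

/-! ### Accuracy of the interpolation -/

section Accuracy

open Polynomial

theorem exists_prod_of_not_hasZeroInDisk {n : ℕ} (hn : 0 < n) {W : Matrix (Fin n) (Fin n) ℂ}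
    {ε β ν : ℝ} (hε0 : 0 < ε) (hε : ε < 1) (hν : 0 < ν)
    (hW : ¬ HasZeroInDisk W ((1 - ε / 2) * zeroFreeRadius β ν n)) {ρ : ℂ}
    (hρ : (1 - ε)⁻¹ * Real.sqrt ν * (n : ℝ) ^ (-1 / 3 + β) ≤ ‖ρ‖) :
    ∃ (N : ℕ) (l : Fin N → ℂ), N ≤ n ∧ permPolynomial W = ∏ i, (1 - C (l i) * X) ∧
      ∀ i, ‖l i * ρ⁻¹‖ ≤ 1 - ε / 2 := by
  have hn' : (0 : ℝ) < n := by exact_mod_cast hn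
  have hε' : 0 < 1 - ε := by linarith
  obtain ⟨N, l, hN, hP⟩ := exists_eq_prod_one_sub (P := permPolynomial W)
    (by rw [eval_permPolynomial, permPoly_zero])
  refine ⟨N, l, hN.trans (natDegree_permPolynomial_le W), hP, fun i => ?_⟩
  set R := zeroFreeRadius β ν n with hR
  have hR0 : 0 < R := div_pos (Real.rpow_pos_of_pos hn' _) (Real.sqrt_pos.2 hν)
  have hRinv : Real.sqrt ν * (n : ℝ) ^ (-1 / 3 + β) = R⁻¹ := by
    have : (n : ℝ) ^ (1 / 3 - β) = ((n : ℝ) ^ (-1 / 3 + β))⁻¹ := by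
      rw [← Real.rpow_neg hn'.le]
      congr 1
      ring
    have h0 := Real.rpow_pos_of_pos hn' (-1 / 3 + β)
    rw [hR, zeroFreeRadius, this]
    field_simp
  rw [mul_assoc, hRinv, ← mul_inv] at hρ
  have hρ' : ‖ρ⁻¹‖ ≤ (1 - ε) * R := by
    rw [norm_inv]
    exact inv_le_of_inv_le₀ (by positivity) hρ
  by_cases hl : l i = 0
  · rw [hl, zero_mul, norm_zero]; linarith
  have hroot : permPoly W (l i)⁻¹ = 0 := by
    rw [← eval_permPolynomial, hP, eval_prod]
    refine Finset.prod_eq_zero (Finset.mem_univ i) ?_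
    simp [hl]
  have hlow : (1 - ε / 2) * R ≤ ‖(l i)⁻¹‖ := by
    by_contra! h
    exact hW ⟨_, h, hroot⟩
  have hq : 0 < (1 - ε / 2) * R := mul_pos (by linarith) hR0
  have hl' : ‖l i‖ ≤ ((1 - ε / 2) * R)⁻¹ := by
    rw [norm_inv] at hlow
    exact le_inv_of_le_inv₀ hq hlow
  rw [norm_mul]
  calc ‖l i‖ * ‖ρ⁻¹‖ ≤ ((1 - ε / 2) * R)⁻¹ * ((1 - ε) * R) := by gcongr
    _ = (1 - ε) / (1 - ε / 2) := by
        have : 1 - ε / 2 ≠ 0 := by linarith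
        field_simp
    -- Here (1 - ε/2)² = 1 - ε + ε²/4 ≥ 1 - ε; this is the gain from having two different radii.
    _ ≤ 1 - ε / 2 := by
        rw [div_le_iff₀ (by linarith)]
        nlinarith

theorem permPoly_eq_prod {n N : ℕ} {W : Matrix (Fin n) (Fin n) ℂ} {l : Fin N → ℂ}
    (h : permPolynomial W = ∏ i, (1 - C (l i) * X)) (z : ℂ) : permPoly W z = ∏ i, (1 - l i * z) := by
  rw [← eval_permPolynomial, h, eval_prod]
  simp

theorem exp_sum_log_eq_permPoly {n N : ℕ} {W : Matrix (Fin n) (Fin n) ℂ} {l : Fin N → ℂ}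
    (hl : ∀ z, permPoly W z = ∏ i, (1 - l i * z)) {z : ℂ} {q : ℝ} (hz : ∀ i, ‖l i * z‖ ≤ q)
    (hq : q < 1) : Complex.exp (∑ i, Complex.log (1 - l i * z)) = permPoly W z := by
  rw [Complex.exp_sum, hl]
  refine Finset.prod_congr rfl fun i _ => Complex.exp_log fun h => ?_
  have : l i * z = 1 := (sub_eq_zero.1 h).symm
  have h2 := hz i
  rw [this, norm_one] at h2
  linarith

/-- Truncation receives only half of the error allowance; the other half pays for the replacement of
the exponential. The constant 4n/ε is twice n/(1 - q) for q = 1 - ε/2. -/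
theorem norm_sum_log_sub_logTaylor_le_half {n N : ℕ} {W : Matrix (Fin n) (Fin n) ℂ} {l : Fin N → ℂ}
    (hl : ∀ z, permPoly W z = ∏ i, (1 - l i * z)) (hN : N ≤ n) {z : ℂ} {ε η : ℝ} (hε0 : 0 < ε)
    (hε : ε < 1) (hz : ∀ i, ‖l i * z‖ ≤ 1 - ε / 2) {m : ℕ}
    (hm : 4 * n / ε * (1 - ε / 2) ^ m ≤ η) :
    ‖∑ i, Complex.log (1 - l i * z) - logTaylor W m z‖ ≤ η / 2 := by
  refine (norm_sum_log_sub_logTaylor_le hl hN hz (by linarith) (by linarith) m).trans ?_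
  have h1 : (1 - ε / 2) ^ (m + 1) ≤ (1 - ε / 2) ^ m :=
    pow_le_pow_of_le_one (by linarith) (by linarith) (Nat.le_succ m)
  have e : 1 - (1 - ε / 2) = ε / 2 := by ring
  rw [e]
  calc (n : ℝ) * ((1 - ε / 2) ^ (m + 1) / (ε / 2)) ≤ n * ((1 - ε / 2) ^ m / (ε / 2)) := by gcongr
    _ = (4 * n / ε * (1 - ε / 2) ^ m) / 2 := by field_simp; ring
    _ ≤ _ := by linarith

theorem isMulApprox_barvinokApprox {n N : ℕ} {W : Matrix (Fin n) (Fin n) ℂ} {l : Fin N → ℂ}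
    (hl : ∀ z, permPoly W z = ∏ i, (1 - l i * z)) (hN : N ≤ n) {ρ : ℂ} (hρ : ρ ≠ 0) {ε η : ℝ}
    (hε0 : 0 < ε) (hε : ε < 1) (hz : ∀ i, ‖l i * ρ⁻¹‖ ≤ 1 - ε / 2) (hη : 0 < η) {m : ℕ}
    (hm : 4 * n / ε * (1 - ε / 2) ^ m ≤ η) :
    IsMulApprox η (barvinokApprox W m ρ) (ρ • allOnes n + W).permanent := by
  have h := norm_sum_log_sub_logTaylor_le_half hl hN hε0 hε hz hm
  refine ⟨logTaylor W m ρ⁻¹ - ∑ i, Complex.log (1 - l i * ρ⁻¹), ?_, ?_⟩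
  · rw [norm_sub_rev]; linarith
  · rw [permanent_eq_factorial_mul_permPoly W hρ,
      ← exp_sum_log_eq_permPoly hl hz (by linarith), barvinokApprox, Complex.exp_sub]
    have := Complex.exp_ne_zero (∑ i, Complex.log (1 - l i * ρ⁻¹))
    field_simp

/-- The exponent K log(1 + T/K) differs from T by at most |T|²/K once |T/K| is small. With |T| ≤ τ =
2n/ε the hypothesis `hK` reads K ≥ 2τ²/η, so this error is at most η/2. -/
theorem isMulApprox_compound {n N : ℕ} {W : Matrix (Fin n) (Fin n) ℂ} {l : Fin N → ℂ}
    (hl : ∀ z, permPoly W z = ∏ i, (1 - l i * z)) (hN : N ≤ n) (hn : 0 < n) {ρ : ℂ} (hρ : ρ ≠ 0)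
    {ε η : ℝ} (hε0 : 0 < ε) (hε : ε < 1) (hz : ∀ i, ‖l i * ρ⁻¹‖ ≤ 1 - ε / 2) (hη : 0 < η)
    (hη1 : η ≤ 1) {m : ℕ} (hm : 4 * n / ε * (1 - ε / 2) ^ m ≤ η) {K : ℕ}
    (hK : (4 * n / ε) ^ 2 / (2 * η) ≤ K) :
    IsMulApprox η ((n.factorial : ℂ) * ρ ^ n * (1 + logTaylor W m ρ⁻¹ / K) ^ K)
      (ρ • allOnes n + W).permanent := by
  have hn' : (1 : ℝ) ≤ n := by exact_mod_cast hn
  have h := norm_sum_log_sub_logTaylor_le_half hl hN hε0 hε hz hm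
  set T := logTaylor W m ρ⁻¹ with hT
  have hTn : ‖T‖ ≤ 2 * n / ε := by
    refine (norm_logTaylor_le hl hN hz (by linarith) (by linarith) m).trans (le_of_eq ?_)
    rw [show 1 - (1 - ε / 2) = ε / 2 by ring]
    field_simp
  set τ := 2 * n / ε with hτ
  have hτ1 : 2 ≤ τ := by
    rw [hτ, le_div_iff₀ hε0]
    nlinarith
  have hK' : 2 * τ ^ 2 ≤ K * η := by
    rw [div_le_iff₀ (by positivity)] at hK
    have : (4 * n / ε) = 2 * τ := by rw [hτ]; ring
    rw [this] at hK
    nlinarith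
  have hKpos : (0 : ℝ) < K := by
    by_contra! h0
    have : (K : ℝ) * η ≤ 0 := mul_nonpos_of_nonpos_of_nonneg h0 hη.le
    nlinarith
  have hK4 : 4 * τ ≤ K := by nlinarith
  have hKc : (K : ℂ) ≠ 0 := by
    have : (K : ℝ) ≠ 0 := hKpos.ne'
    exact_mod_cast this
  have hx : ‖T / K‖ ≤ 1 / 4 := by
    rw [norm_div, Complex.norm_natCast, div_le_iff₀ hKpos]
    linarith
  have hne : 1 + T / K ≠ 0 := by
    intro h0
    have : T / K = -1 := by linear_combination h0
    rw [this] at hx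
    norm_num at hx
  have hlog : ‖K * Complex.log (1 + T / K) - T‖ ≤ η / 2 := by
    have h1 := Complex.norm_log_one_add_sub_self_le (z := T / K) (by linarith)
    have e : K * Complex.log (1 + T / K) - T = K * (Complex.log (1 + T / K) - T / K) := by
      field_simp
    rw [e, norm_mul, Complex.norm_natCast]
    have h2 : (1 - ‖T / K‖)⁻¹ ≤ 2 := inv_le_of_inv_le₀ (by norm_num) (by linarith)
    have h3 : ‖T / K‖ ^ 2 * (1 - ‖T / K‖)⁻¹ / 2 ≤ ‖T / K‖ ^ 2 := by
      have := mul_le_mul_of_nonneg_left h2 (sq_nonneg ‖T / K‖)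
      linarith
    calc (K : ℝ) * ‖Complex.log (1 + T / K) - T / K‖ ≤ K * ‖T / K‖ ^ 2 :=
          mul_le_mul_of_nonneg_left (h1.trans h3) hKpos.le
      _ = ‖T‖ ^ 2 / K := by
          rw [norm_div, Complex.norm_natCast]
          field_simp
      _ ≤ τ ^ 2 / K := by gcongr
      _ ≤ η / 2 := by
          rw [div_le_iff₀ hKpos]
          linarith
  refine ⟨K * Complex.log (1 + T / K) - ∑ i, Complex.log (1 - l i * ρ⁻¹), ?_, ?_⟩
  · calc _ = ‖(K * Complex.log (1 + T / K) - T) - (∑ i, Complex.log (1 - l i * ρ⁻¹) - T)‖ := by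
          congr 1; ring
      _ ≤ _ := norm_sub_le _ _
      _ ≤ η := by linarith
  · rw [permanent_eq_factorial_mul_permPoly W hρ,
      ← exp_sum_log_eq_permPoly hl hz (by linarith), Complex.exp_sub, Complex.exp_nat_mul,
      Complex.exp_log hne]
    have := Complex.exp_ne_zero (∑ i, Complex.log (1 - l i * ρ⁻¹))
    field_simp

/-- The degree is large enough for the accuracy, and `n ^ m` dominates the parameters. -/
theorem degree_bounds {n m A : ℕ} (hn : 4 ≤ n) (hA : 4 ≤ A) {ε η : ℝ} (hε0 : 0 < ε) (hε : ε < 1)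
    (hη : 0 < η) (hη1 : η ≤ 1) (hm : m = ⌈(A : ℝ) / ε * Real.log ((n : ℝ) / (η * ε))⌉₊) :
    4 * n / ε * (1 - ε / 2) ^ m ≤ η ∧ 0 < m ∧ (4 * n / ε) ^ 2 / (2 * η) ≤ 8 * (n : ℝ) ^ m := by
  have hn' : (4 : ℝ) ≤ n := by exact_mod_cast hn
  have hA' : (4 : ℝ) ≤ A := by exact_mod_cast hA
  set x := (n : ℝ) / (η * ε) with hx
  have hηε : 0 < η * ε := by positivity
  have hηε1 : η * ε ≤ 1 := by nlinarith
  have hx4 : 4 ≤ x := by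
    rw [hx, le_div_iff₀ hηε]
    nlinarith
  set L := Real.log x with hL
  have hL0 : 0 < L := Real.log_pos (by linarith)
  have hexp : Real.exp L = x := Real.exp_log (by linarith)
  have hm1 : A / ε * L ≤ m := hm ▸ Nat.le_ceil _
  have hmε : 4 * L ≤ ε * m := by
    have := mul_le_mul_of_nonneg_left hm1 hε0.le
    have e : ε * (A / ε * L) = A * L := by field_simp
    rw [e] at this
    nlinarith
  have hmL : 4 * L ≤ m := by
    have : ε * m ≤ 1 * m := mul_le_mul_of_nonneg_right hε.le (Nat.cast_nonneg m)
    linarith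
  have hmpos : 0 < m := by
    have : (0 : ℝ) < m := by linarith
    exact_mod_cast this
  refine ⟨?_, hmpos, ?_⟩
  -- Since A ≥ 4 gives εm ≥ 4L, the power is at most e^(-2L) = (ηε/n)², leaving a spare factor 4/n ≤
  -- 1.
  · have h1 : (1 - ε / 2) ^ m ≤ Real.exp (-(2 * L)) := by
      calc (1 - ε / 2) ^ m ≤ Real.exp (-(ε / 2)) ^ m :=
            pow_le_pow_left₀ (by linarith) (Real.one_sub_le_exp_neg _) m
        _ = Real.exp (m * (-(ε / 2))) := (Real.exp_nat_mul _ _).symm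
        _ ≤ _ := Real.exp_le_exp.2 (by linarith)
    have h2 : Real.exp (-(2 * L)) = (η * ε) ^ 2 / n ^ 2 := by
      rw [Real.exp_neg, two_mul, Real.exp_add, hexp, hx]
      field_simp
    rw [h2] at h1
    calc 4 * n / ε * (1 - ε / 2) ^ m ≤ 4 * n / ε * ((η * ε) ^ 2 / n ^ 2) := by gcongr
      _ = η * (η * ε) * (4 / n) := by field_simp
      _ ≤ η * 1 * 1 := by
          have : 4 / (n : ℝ) ≤ 1 := (div_le_one (by linarith)).2 hn'
          gcongr
      _ = η := by ring
  · have h1 : x ^ 2 ≤ (n : ℝ) ^ m := by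
      calc x ^ 2 = Real.exp (2 * L) := by rw [two_mul, Real.exp_add, hexp]; ring
        _ ≤ Real.exp m := Real.exp_le_exp.2 (by linarith)
        _ = Real.exp 1 ^ m := by rw [← Real.exp_nat_mul, mul_one]
        _ ≤ (n : ℝ) ^ m := pow_le_pow_left₀ (Real.exp_pos 1).le
            (by linarith [Real.exp_one_lt_d9]) m
    calc (4 * n / ε) ^ 2 / (2 * η) = 8 * (η * x ^ 2) := by rw [hx]; field_simp; ring
      _ ≤ 8 * (1 * x ^ 2) := by gcongr
      _ ≤ _ := by linarith

end Accuracy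

/-! ### Reasoning about programs -/

section Programs

/-- Started in `s`, the program `p` halts within `T` steps in a configuration satisfying `Q`. -/
def Runs (p : RamProg) (s : RamState) (T : ℕ) (Q : RamState → Prop) : Prop :=
  ∃ t s', RamExec p s t s' ∧ t ≤ T ∧ Q s'

theorem Runs.mono {p : RamProg} {s : RamState} {T T' : ℕ} {Q Q' : RamState → Prop} (h : Runs p s T Q)
    (hT : T ≤ T') (hQ : ∀ s', Q s' → Q' s') : Runs p s T' Q' := by
  obtain ⟨t, s', he, ht, hq⟩ := h
  exact ⟨t, s', he, ht.trans hT, hQ s' hq⟩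

theorem Runs.instr {a : RamInstr} {s : RamState} {Q : RamState → Prop} (hd : a.Defined s)
    (h : Q (a.apply s)) : Runs (.instr a) s 1 Q :=
  ⟨1, _, .instr a s hd, le_rfl, h⟩

theorem Runs.seq {p q : RamProg} {s : RamState} {T T' : ℕ} {Q R : RamState → Prop}
    (hp : Runs p s T Q) (hq : ∀ s', Q s' → Runs q s' T' R) : Runs (.seq p q) s (T + T') R := by
  obtain ⟨t, s', he, ht, h⟩ := hp
  obtain ⟨t', s'', he', ht', h'⟩ := hq s' h
  exact ⟨t + t', s'', .seq p q s s' s'' t t' he he', Nat.add_le_add ht ht', h'⟩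

theorem Runs.ite {b : RamTest} {p q : RamProg} {s : RamState} {T : ℕ} {Q : RamState → Prop}
    (hp : b.Holds s → Runs p s T Q) (hq : ¬ b.Holds s → Runs q s T Q) :
    Runs (.ite b p q) s (T + 1) Q := by
  by_cases hb : b.Holds s
  · obtain ⟨t, s', he, ht, h⟩ := hp hb
    exact ⟨t + 1, s', .iteTrue b p q s s' t hb he, Nat.add_le_add_right ht 1, h⟩
  · obtain ⟨t, s', he, ht, h⟩ := hq hb
    exact ⟨t + 1, s', .iteFalse b p q s s' t hb he, Nat.add_le_add_right ht 1, h⟩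

/-- The invariant is indexed by the number of completed rounds, which must be known in advance. Each
round costs one test besides the body, and one last test ends the loop. -/
theorem Runs.loop {b : RamTest} {p : RamProg} {m T : ℕ} (I : ℕ → RamState → Prop)
    (hstep : ∀ i < m, ∀ s, I i s → b.Holds s ∧ Runs p s T (I (i + 1)))
    (hend : ∀ s, I m s → ¬ b.Holds s) {s : RamState} (h0 : I 0 s) :
    Runs (.loop b p) s (m * (T + 1) + 1) (I m) := by
  have h : ∀ j i, i + j = m → ∀ s, I i s → Runs (.loop b p) s (j * (T + 1) + 1) (I m) := by
    intro j
    induction j with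
    | zero =>
      intro i hi s hs
      obtain rfl : i = m := by omega
      exact ⟨1, s, .loopFalse b p s (hend s hs), by omega, hs⟩
    | succ j ih =>
      intro i hi s hs
      obtain ⟨hb, t, s', he, ht, hs'⟩ := hstep i (by omega) s hs
      obtain ⟨t', s'', he', ht', hs''⟩ := ih (i + 1) (by omega) s' hs'
      refine ⟨t + t' + 1, s'', .loopTrue b p s s' s'' t t' hb he he', ?_, hs''⟩
      rw [Nat.add_mul]
      omega
  exact h m 0 (by omega) s h0

/-- Straight-line code: the instruction `a` followed by the instructions in `l`. -/
def straight (a : RamInstr) : List RamInstr → RamProg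
  | [] => .instr a
  | b :: l => .seq (.instr a) (straight b l)

/-- Every instruction can be executed when its turn comes. -/
def DefinedList : List RamInstr → RamState → Prop
  | [], _ => True
  | a :: l, s => a.Defined s ∧ DefinedList l (a.apply s)

theorem Runs.straight {a : RamInstr} {l : List RamInstr} {s : RamState} (h : DefinedList (a :: l) s) :
    Runs (straight a l) s (l.length + 1) (fun s' => s' = l.foldl (fun s a => a.apply s) (a.apply s)) := by
  induction l generalizing a s with
  | nil => exact Runs.instr h.1 rfl
  | cons b l ih =>
    refine (Runs.seq (Q := fun s' => s' = a.apply s) (Runs.instr h.1 rfl) ?_ (T' := l.length + 1)).mono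
      (by simp; omega) fun _ h => h
    rintro s' rfl
    exact ih h.2

/-- The registers below `b` agree. -/
def SameBelow (b : ℕ) (s s' : RamState) : Prop := ∀ r < b, s'.idx r = s.idx r

theorem SameBelow.trans {b : ℕ} {s s' s'' : RamState} (h : SameBelow b s s') (h' : SameBelow b s' s'') :
    SameBelow b s s'' := fun r hr => (h' r hr).trans (h r hr)

theorem SameBelow.mono {b b' : ℕ} {s s' : RamState} (h : SameBelow b s s') (hb : b' ≤ b) :
    SameBelow b' s s' := fun r hr => h r (hr.trans_le hb)

/-- The registers that hold the constants `n`, `0, …, 16` and `n²`. -/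
structure Consts (n : ℕ) (s : RamState) : Prop where
  r0 : s.idx 0 = n
  r1 : s.idx 1 = 0
  r2 : s.idx 2 = 1
  r3 : s.idx 3 = 2
  r4 : s.idx 4 = 3
  r5 : s.idx 5 = 4
  r6 : s.idx 6 = 5
  r7 : s.idx 7 = 6
  r8 : s.idx 8 = 7
  r9 : s.idx 9 = 8
  r10 : s.idx 10 = 9
  r11 : s.idx 11 = 10
  r12 : s.idx 12 = 11
  r13 : s.idx 13 = 12
  r14 : s.idx 14 = 13
  r15 : s.idx 15 = 14
  r16 : s.idx 16 = 15
  r17 : s.idx 17 = 16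
  r18 : s.idx 18 = n * n

theorem Consts.of_sameBelow {n b : ℕ} {s s' : RamState} (h : Consts n s) (hs : SameBelow b s s')
    (hb : 19 ≤ b) : Consts n s' := by
  have h' := hs.mono hb
  cases h
  constructor <;> (rw [h' _ (by norm_num)]; assumption)

/-! ### Division with remainder -/

/-- Divides register `51` by register `m`; the quotient is left in register `60`, the remainder
plus `1` in register `61`. -/
def divModProg (m : ℕ) : RamProg :=
  .seq (straight (.izero 60) [.icopy 61 51, .isucc 61])
    (.loop (.idxLt m 61) (straight (.isub 61 61 m) [.isucc 60]))

/-- Repeated subtraction. The only test is strict, so the remainder is stored increased by 1: v < r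
+ 1 means v ≤ r. Working registers are layered by depth of call, so a routine preserves all
registers below a threshold and with them its caller's counters. -/
theorem runs_divModProg {m v x Y : ℕ} (hm : m < 50) {s : RamState} (hv : s.idx m = v) (hv0 : 0 < v)
    (hx : s.idx 51 = x) (hxY : x ≤ Y) :
    Runs (divModProg m) s (3 * Y + 4) fun s' =>
      s'.idx 60 = x / v ∧ s'.idx 61 = x % v + 1 ∧ SameBelow 60 s s' ∧ s'.cell = s.cell := by
  have hm60 : m ≠ 60 := by omega
  have hm61 : m ≠ 61 := by omega
  refine (Runs.seq (Runs.straight (by exact ⟨trivial, trivial, trivial, trivial⟩)) (T' := (x / v) * (2 + 1) + 1)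
    (R := fun s' => (s'.idx 60 = x / v ∧ s'.idx 61 + (x / v) * v = x + 1) ∧ SameBelow 60 s s'
      ∧ s'.cell = s.cell) ?_).mono ?_ ?_
  · rintro s₁ rfl
    refine Runs.loop (fun i s' => (s'.idx 60 = i ∧ s'.idx 61 + i * v = x + 1) ∧ SameBelow 60 s s'
      ∧ s'.cell = s.cell) ?_ ?_ ?_
    · rintro i hi s' ⟨⟨h1, h2⟩, h3, h4⟩
      have hvm : s'.idx m = v := (h3 m (by omega)).trans hv
      have hiv : (i + 1) * v ≤ x := (Nat.mul_le_mul_right v hi).trans (Nat.div_mul_le_self x v)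
      rw [Nat.add_mul, one_mul] at hiv
      refine ⟨?_, (Runs.straight (by exact ⟨trivial, trivial, trivial⟩)).mono le_rfl ?_⟩
      · simp only [RamTest.Holds, hvm]
        omega
      · rintro s'' rfl
        refine ⟨⟨?_, ?_⟩, fun r hr => ?_, ?_⟩
        · simp [RamInstr.apply, h1]
        · simp [RamInstr.apply, hvm, Nat.add_mul]
          omega
        · have := h3 r hr
          simpa [RamInstr.apply, show r ≠ 60 by omega, show r ≠ 61 by omega] using this
        · simpa [RamInstr.apply] using h4
    · rintro s' ⟨⟨h1, h2⟩, h3, h4⟩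
      have hvm : s'.idx m = v := (h3 m (by omega)).trans hv
      have := Nat.div_add_mod x v
      have hlt := Nat.mod_lt x hv0
      rw [mul_comm] at this
      simp only [RamTest.Holds, hvm]
      omega
    · refine ⟨⟨?_, ?_⟩, fun r hr => ?_, ?_⟩
      · simp [RamInstr.apply]
      · simp [RamInstr.apply, hx]
      · simp [RamInstr.apply, show r ≠ 60 by omega, show r ≠ 61 by omega]
      · simp [RamInstr.apply]
  · have := Nat.div_le_self x v
    simp only [List.length_cons, List.length_nil]
    omega
  · rintro s' ⟨⟨h1, h2⟩, h3, h4⟩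
    refine ⟨h1, ?_, h3, h4⟩
    have := Nat.div_add_mod x v
    rw [mul_comm] at this
    omega

/-! ### Decoding a tuple of positions -/

/-- Computes digit number `idx[rl]` of the code in register `30`, with its row and column, in the
registers `52`, `53`, `54`. -/
def digitProg (rl : ℕ) : RamProg :=
  .seq (straight (.icopy 51 30) [.izero 50]) <|
  .seq (.loop (.idxLt 50 rl) (.seq (divModProg 18) (straight (.icopy 51 60) [.isucc 50]))) <|
  .seq (divModProg 18) <|
  .seq (straight (.isub 52 61 2) [.icopy 51 52]) <|
  .seq (divModProg 0) (straight (.icopy 53 60) [.isub 54 61 2])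

/-- Dividing l times by n² drops the lower digits, one more division isolates the digit, and a
division by n separates row from column. Here and below, Y ≥ 64 lets a power of Y absorb all
constants in the running time. -/
theorem runs_digitProg {n c l rl Y : ℕ} (hn : 0 < n) (hrl : rl < 50) {s : RamState} (hC : Consts n s)
    (hc : s.idx 30 = c) (hl : s.idx rl = l) (hY : 64 ≤ Y) (hcY : c ≤ Y) (hlY : l ≤ Y) :
    Runs (digitProg rl) s (Y ^ 3) fun s' =>
      s'.idx 52 = cellDigit n c l ∧ s'.idx 53 = cellDigit n c l / n ∧ s'.idx 54 = cellDigit n c l % n ∧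
      SameBelow 50 s s' ∧ s'.cell = s.cell := by
  have hN : 0 < n * n := Nat.mul_pos hn hn
  have hxY : ∀ i, c / (n * n) ^ i ≤ Y := fun i => (Nat.div_le_self _ _).trans hcY
  refine (Runs.seq (Runs.straight (by exact ⟨trivial, trivial, trivial⟩)) (T' := (l * (3 * Y + 4 + 2 + 1) + 1)
    + ((3 * Y + 4) + (2 + ((3 * Y + 4) + 2)))) ?_).mono ?_ fun _ h => h
  · rintro s₁ rfl
    refine Runs.seq (Runs.loop (m := l) (T := 3 * Y + 4 + 2) (fun i s' => (s'.idx 50 = i ∧ s'.idx 51 = c / (n * n) ^ i) ∧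
      SameBelow 50 s s' ∧ s'.cell = s.cell) ?_ ?_ ?_) ?_
    · rintro i hi s' ⟨⟨h1, h2⟩, h3, h4⟩
      have hC' := hC.of_sameBelow h3 (by norm_num)
      refine ⟨?_, Runs.seq (runs_divModProg (by norm_num) hC'.r18 hN h2 (hxY i)) ?_⟩
      · simp only [RamTest.Holds, h1, h3 rl hrl, hl]
        exact hi
      · rintro s'' ⟨g1, g2, g3, g4⟩
        refine (Runs.straight (by exact ⟨trivial, trivial, trivial⟩)).mono le_rfl ?_
        rintro _ rfl
        refine ⟨⟨?_, ?_⟩, fun r hr => ?_, ?_⟩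
        · simp [RamInstr.apply, g3 50 (by norm_num), h1]
        · simp [RamInstr.apply, g1, Nat.div_div_eq_div_mul, pow_succ]
        · have := g3 r (by omega)
          have := h3 r hr
          simp [RamInstr.apply, show r ≠ 50 by omega, show r ≠ 51 by omega, *]
        · simp [RamInstr.apply, *]
    · rintro s' ⟨⟨h1, h2⟩, h3, h4⟩
      simp only [RamTest.Holds, h1, h3 rl hrl, hl]
      omega
    · refine ⟨⟨?_, ?_⟩, fun r hr => ?_, ?_⟩
      · simp [RamInstr.apply]
      · simp [RamInstr.apply, hc]
      · simp [RamInstr.apply, show r ≠ 50 by omega, show r ≠ 51 by omega]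
      · simp [RamInstr.apply]
    · rintro s' ⟨⟨h1, h2⟩, h3, h4⟩
      have hC' := hC.of_sameBelow h3 (by norm_num)
      refine Runs.seq (runs_divModProg (by norm_num) hC'.r18 hN h2 (hxY l)) ?_
      rintro s₂ ⟨g1, g2, g3, g4⟩
      have hC₂ := hC'.of_sameBelow g3 (by norm_num)
      refine Runs.seq (Runs.straight (by exact ⟨trivial, trivial, trivial⟩)) ?_
      rintro _ rfl
      refine Runs.seq (runs_divModProg (v := n) (x := cellDigit n c l) (Y := Y) (by norm_num) ?_ hn ?_ ?_) ?_
      · simp [RamInstr.apply, hC₂.r0]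
      · simp [RamInstr.apply, hC₂.r2, g2, cellDigit]
      · exact (Nat.mod_le _ _).trans (hxY l)
      rintro s₃ ⟨e1, e2, e3, e4⟩
      have e52 := e3 52 (by norm_num)
      have e2' := e3 2 (by norm_num)
      simp [RamInstr.apply, hC₂.r2, g2] at e52 e2'
      refine (Runs.straight (by exact ⟨trivial, trivial, trivial⟩)).mono le_rfl ?_
      rintro _ rfl
      refine ⟨?_, ?_, ?_, fun r hr => ?_, ?_⟩
      · simp [RamInstr.apply, e52, cellDigit]
      · simp [RamInstr.apply, e1]
      · simp [RamInstr.apply, e2, e2']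
      · have a1 := e3 r (by omega)
        have a2 := g3 r (by omega)
        have a3 := h3 r hr
        simp [RamInstr.apply, show r ≠ 51 by omega, show r ≠ 52 by omega] at a1
        simp [RamInstr.apply, show r ≠ 53 by omega, show r ≠ 54 by omega, *]
      · simp [RamInstr.apply, e4, g4, h4]
  · have h1 := Nat.mul_le_mul_right (3 * Y + 4 + 2 + 1) hlY
    have h2 := Nat.mul_le_mul_right Y hY
    have h3 := Nat.mul_le_mul_right (Y * Y) hY
    have e : Y ^ 3 = Y * (Y * Y) := by ring
    rw [e]
    simp only [List.length_cons, List.length_nil]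
    nlinarith

end Programs

/-! ### Summing over all tuples of positions -/

section TupleProgram

/-- Multiplies cell `3` by `0` if the positions described by the registers `42`, `43` and `53`, `54`
share a row or a column, and increments register `44`. -/
def conflictProg : RamProg :=
  .seq (straight (.isub 55 42 53) [.isub 56 53 42, .iadd 55 55 56, .isub 56 43 54, .isub 57 54 43,
    .iadd 56 56 57]) <|
  .ite (.idxLt 1 55)
    (.ite (.idxLt 1 56) (straight (.isucc 44) []) (straight (.arith .sub 4 4 4) [.isucc 44]))
    (straight (.arith .sub 4 4 4) [.isucc 44])

/-- Cells are addressed indirectly: register i + 1 holds i for i ≤ 16, so operand 4 denotes cell 3.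
-/
theorem runs_conflictProg {n d d' : ℕ} {s : RamState} (hC : Consts n s) (h42 : s.idx 42 = d / n)
    (h43 : s.idx 43 = d % n) (h53 : s.idx 53 = d' / n) (h54 : s.idx 54 = d' % n) :
    Runs conflictProg s 10 fun s' => s'.cell 3 = s.cell 3 * (if Conflict n d d' then 0 else 1) ∧
      (∀ a, a ≠ 3 → s'.cell a = s.cell a) ∧ s'.idx 44 = s.idx 44 + 1 ∧ SameBelow 44 s s' := by
  refine (Runs.seq (Runs.straight (by exact ⟨trivial, trivial, trivial, trivial, trivial, trivial, trivial⟩))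
    (T' := 4) ?_).mono (by simp) fun _ h => h
  rintro s₁ rfl
  set s₁ := List.foldl (fun s a => RamInstr.apply a s) ((RamInstr.isub 55 42 53).apply s)
    [RamInstr.isub 56 53 42, .iadd 55 55 56, .isub 56 43 54, .isub 57 54 43, .iadd 56 56 57] with hs₁
  -- With truncated subtraction this sum is the distance, which is positive exactly when the two
  -- rows differ; likewise for the columns.
  have e55 : s₁.idx 55 = (d / n - d' / n) + (d' / n - d / n) := by
    simp [hs₁, RamInstr.apply, h42, h53]
  have e56 : s₁.idx 56 = (d % n - d' % n) + (d' % n - d % n) := by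
    simp [hs₁, RamInstr.apply, h43, h54]
  have e44 : s₁.idx 44 = s.idx 44 := by simp [hs₁, RamInstr.apply]
  have hsb : SameBelow 55 s s₁ := fun r hr => by
    simp [hs₁, RamInstr.apply, show r ≠ 55 by omega, show r ≠ 56 by omega, show r ≠ 57 by omega]
  have hcell : s₁.cell = s.cell := by simp [hs₁, RamInstr.apply]
  have hC₁ := hC.of_sameBelow hsb (by norm_num)
  clear_value s₁
  have hzero : Conflict n d d' → Runs (straight (.arith .sub 4 4 4) [.isucc 44]) s₁ 2 fun s' =>
      s'.cell 3 = s.cell 3 * (if Conflict n d d' then 0 else 1) ∧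
      (∀ a, a ≠ 3 → s'.cell a = s.cell a) ∧ s'.idx 44 = s.idx 44 + 1 ∧ SameBelow 44 s s' := by
    intro h
    refine (Runs.straight (by exact ⟨trivial, trivial, trivial⟩)).mono le_rfl ?_
    rintro _ rfl
    refine ⟨?_, fun a ha => ?_, ?_, fun r hr => ?_⟩
    · simp [RamInstr.apply, hC₁.r4, ArithOp.eval, h]
    · simp [RamInstr.apply, hC₁.r4, ha, hcell]
    · simp [RamInstr.apply, e44]
    · have := hsb r (by omega)
      simp [RamInstr.apply, show r ≠ 44 by omega, this]
  refine Runs.ite (fun hb => Runs.ite (T := 2) (fun hb' => ?_) fun hb' => ?_)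
    fun hb => (hzero ?_).mono (by norm_num) fun _ h => h
  · have hno : ¬ Conflict n d d' := by
      simp only [RamTest.Holds, hC₁.r1, e55, e56] at hb hb'
      unfold Conflict
      omega
    refine (Runs.straight (by exact ⟨trivial, trivial⟩)).mono (by simp) ?_
    rintro _ rfl
    refine ⟨?_, fun a ha => ?_, ?_, fun r hr => ?_⟩
    · simp [RamInstr.apply, hno, hcell]
    · simp [RamInstr.apply, hcell]
    · simp [RamInstr.apply, e44]
    · have := hsb r (by omega)
      simp [RamInstr.apply, show r ≠ 44 by omega, this]
  · refine hzero ?_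
    simp only [RamTest.Holds, hC₁.r1, e55, e56] at hb hb'
    right
    omega
  · simp only [RamTest.Holds, hC₁.r1, e55] at hb
    left
    omega

/-- Computes in cell `3` the weight of the tuple of length `idx[20]` with code `idx[30]`. -/
def weightProg : RamProg :=
  .seq (straight (.one 4) [.izero 40]) <|
  .loop (.idxLt 40 20) <|
    .seq (digitProg 40) <|
    .seq (straight (.iadd 41 17 52) [.icopy 42 53, .icopy 43 54, .arith .mul 4 4 41, .izero 44]) <|
    .seq (.loop (.idxLt 44 40) (.seq (digitProg 44) conflictProg))
      (straight (.isucc 40) [])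

/-- After i rounds cell 3 holds the weight of the first i positions. Earlier positions are decoded
again from the code rather than stored. -/
theorem runs_weightProg {n c k Y : ℕ} {w : ℕ → ℂ} (hn : 0 < n) {s : RamState} (hC : Consts n s)
    (hk : s.idx 20 = k) (hc : s.idx 30 = c) (hw : ∀ d < n * n, s.cell (16 + d) = w d) (hY : 64 ≤ Y)
    (hcY : c ≤ Y) (hkY : k ≤ Y) :
    Runs weightProg s (Y ^ 6) fun s' => s'.cell 3 = tupleWeight n w c k ∧
      (∀ a, a ≠ 3 → s'.cell a = s.cell a) ∧ SameBelow 40 s s' := by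
  have hN : 0 < n * n := Nat.mul_pos hn hn
  refine (Runs.seq (Runs.straight (by exact ⟨trivial, trivial, trivial⟩))
    (T' := k * ((Y ^ 3 + (5 + (Y * (Y ^ 3 + 10 + 1) + 1 + 1))) + 1) + 1) ?_).mono ?_ fun _ h => h
  · rintro _ rfl
    refine (Runs.loop (m := k) (fun i s' => (s'.idx 40 = i ∧ s'.cell 3 = tupleWeight n w c i) ∧
      (∀ a, a ≠ 3 → s'.cell a = s.cell a) ∧ SameBelow 40 s s') ?_ ?_ ?_).mono le_rfl
      fun s' h => ⟨h.1.2, h.2.1, h.2.2⟩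
    · rintro i hi s₁ ⟨⟨h1, h2⟩, h3, h4⟩
      have hC₁ := hC.of_sameBelow h4 (by norm_num)
      have hk₁ := (h4 20 (by norm_num)).trans hk
      have hc₁ := (h4 30 (by norm_num)).trans hc
      refine ⟨by simp only [RamTest.Holds, h1, hk₁]; exact hi, ?_⟩
      refine Runs.seq (runs_digitProg hn (by norm_num) hC₁ hc₁ h1 hY hcY (by omega)) ?_
      rintro s₂ ⟨d1, d2, d3, d4, d5⟩
      have hC₂ := hC₁.of_sameBelow d4 (by norm_num)
      refine Runs.seq (Runs.straight (by exact ⟨trivial, trivial, trivial, trivial, trivial, trivial⟩)) ?_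
      intro s₃ hs₃
      have e40 : s₃.idx 40 = i := by simp [hs₃, RamInstr.apply, d4 40 (by norm_num), h1]
      have e42 : s₃.idx 42 = cellDigit n c i / n := by simp [hs₃, RamInstr.apply, d2]
      have e43 : s₃.idx 43 = cellDigit n c i % n := by simp [hs₃, RamInstr.apply, d3]
      have e44 : s₃.idx 44 = 0 := by simp [hs₃, RamInstr.apply]
      have hsb₃ : SameBelow 40 s₂ s₃ := fun r hr => by
        simp [hs₃, RamInstr.apply, show r ≠ 41 by omega, show r ≠ 42 by omega, show r ≠ 43 by omega,
          show r ≠ 44 by omega]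
      have c3 : s₃.cell 3 = tupleWeight n w c i * w (cellDigit n c i) := by
        simp [hs₃, RamInstr.apply, hC₂.r4, hC₂.r17, ArithOp.eval, d1, d5, h2,
          h3 (16 + cellDigit n c i) (by omega), hw (cellDigit n c i) (Nat.mod_lt _ hN)]
      have ca : ∀ a, a ≠ 3 → s₃.cell a = s.cell a := fun a ha => by
        simp [hs₃, RamInstr.apply, hC₂.r4, ha, d5, h3 a ha]
      clear hs₃
      have hsb₃' : SameBelow 40 s s₃ := (h4.trans (d4.mono (by norm_num))).trans hsb₃
      have hC₃ := hC.of_sameBelow hsb₃' (by norm_num)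
      have hc₃ := (hsb₃' 30 (by norm_num)).trans hc
      refine Runs.seq ((Runs.loop (m := i) (T := Y ^ 3 + 10) (fun i' s' => (s'.idx 44 = i' ∧ s'.cell 3
          = tupleWeight n w c i * (w (cellDigit n c i) * ∏ l' ∈ Finset.range i',
            if Conflict n (cellDigit n c i) (cellDigit n c l') then 0 else 1)) ∧
          (∀ a, a ≠ 3 → s'.cell a = s.cell a) ∧ SameBelow 44 s₃ s') ?_ ?_ ?_).mono ?_
          fun _ h => h) ?_
      · rintro i' hi' s₄ ⟨⟨g1, g2⟩, g3, g4⟩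
        have hC₄ := hC₃.of_sameBelow g4 (by norm_num)
        refine ⟨by simp only [RamTest.Holds, g1, g4 40 (by norm_num), e40]; exact hi', ?_⟩
        refine Runs.seq (runs_digitProg hn (by norm_num) hC₄ ((g4 30 (by norm_num)).trans hc₃) g1 hY hcY
          (by omega)) ?_
        rintro s₅ ⟨f1, f2, f3, f4, f5⟩
        refine (runs_conflictProg (hC₄.of_sameBelow f4 (by norm_num))
          (((f4 42 (by norm_num)).trans (g4 42 (by norm_num))).trans e42)
          (((f4 43 (by norm_num)).trans (g4 43 (by norm_num))).trans e43) f2 f3).mono le_rfl ?_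
        rintro s₆ ⟨k1, k2, k3, k4⟩
        refine ⟨⟨?_, ?_⟩, fun a ha => ?_, ?_⟩
        · rw [k3, f4 44 (by norm_num), g1]
        · rw [k1, f5, g2, Finset.prod_range_succ]
          ring
        · rw [k2 a ha, f5, g3 a ha]
        · exact (g4.trans (f4.mono (by norm_num))).trans k4
      · rintro s₄ ⟨⟨g1, g2⟩, g3, g4⟩
        simp only [RamTest.Holds, g1, g4 40 (by norm_num), e40]
        omega
      · exact ⟨⟨e44, by simp [c3]⟩, ca, fun _ _ => rfl⟩
      · have := Nat.mul_le_mul_right (Y ^ 3 + 10 + 1) (hi.le.trans hkY)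
        omega
      · rintro s₄ ⟨⟨g1, g2⟩, g3, g4⟩
        refine (Runs.straight (by exact ⟨trivial, trivial⟩)).mono (by simp) ?_
        rintro _ rfl
        refine ⟨⟨?_, ?_⟩, fun a ha => ?_, fun r hr => ?_⟩
        · simp [RamInstr.apply, g4 40 (by norm_num), e40]
        · simp only [List.foldl_nil, RamInstr.apply, g2]
          rw [tupleWeight, tupleWeight, Finset.prod_range_succ]
        · simpa [RamInstr.apply] using g3 a ha
        · have a1 := g4 r (by omega)
          have a2 := hsb₃' r hr
          simp [RamInstr.apply, show r ≠ 40 by omega, a1, a2]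
    · rintro s₁ ⟨⟨h1, h2⟩, h3, h4⟩
      simp only [RamTest.Holds, h1, h4 20 (by norm_num), hk]
      omega
    · refine ⟨⟨?_, ?_⟩, fun a ha => ?_, fun r hr => ?_⟩
      · simp [RamInstr.apply]
      · simp [RamInstr.apply, hC.r4, tupleWeight]
      · simp [RamInstr.apply, hC.r4, ha]
      · simp [RamInstr.apply, show r ≠ 40 by omega]
  · have h1 := Nat.mul_le_mul_right (Y ^ 3 + (5 + (Y * (Y ^ 3 + 10 + 1) + 1 + 1)) + 1) hkY
    have hp : ∀ j, 64 * Y ^ j ≤ Y ^ (j + 1) := fun j => by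
      rw [pow_succ, mul_comm]; exact Nat.mul_le_mul_left _ hY
    have h2 := hp 1; have h3 := hp 2; have h4 := hp 3; have h5 := hp 4; have h6 := hp 5
    have e : Y * (Y ^ 3 + (5 + (Y * (Y ^ 3 + 10 + 1) + 1 + 1)) + 1) = Y ^ 5 + Y ^ 4 + 11 * Y ^ 2 + 8 * Y := by ring
    rw [e] at h1
    simp only [List.length_cons, List.length_nil]
    norm_num at h2 h3 h4 h5 h6
    omega

/-- Computes in cell `4` the sum of the weights of all tuples of length `idx[20]`. -/
def tupleSumProg : RamProg :=
  .seq (straight (.arith .sub 5 5 5) [.izero 30]) <|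
  .loop (.idxLt 30 21) (.seq weightProg (straight (.arith .add 5 5 4) [.isucc 30]))

theorem runs_tupleSumProg {n k Y : ℕ} {w : ℕ → ℂ} (hn : 0 < n) {s : RamState} (hC : Consts n s)
    (hk : s.idx 20 = k) (hM : s.idx 21 = (n * n) ^ k) (hw : ∀ d < n * n, s.cell (16 + d) = w d)
    (hY : 64 ≤ Y) (hMY : (n * n) ^ k ≤ Y) (hkY : k ≤ Y) :
    Runs tupleSumProg s (Y ^ 8) fun s' => s'.cell 4 = tupleSum n w k ∧
      (∀ a, a ≠ 3 → a ≠ 4 → s'.cell a = s.cell a) ∧ SameBelow 30 s s' := by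
  refine (Runs.seq (Runs.straight (by exact ⟨trivial, trivial, trivial⟩))
    (T' := (n * n) ^ k * ((Y ^ 6 + 2) + 1) + 1) ?_).mono ?_ fun _ h => h
  · rintro _ rfl
    refine (Runs.loop (m := (n * n) ^ k) (fun i s' => (s'.idx 30 = i ∧
      s'.cell 4 = ∑ c ∈ Finset.range i, tupleWeight n w c k) ∧
      (∀ a, a ≠ 3 → a ≠ 4 → s'.cell a = s.cell a) ∧ SameBelow 30 s s') ?_ ?_ ?_).mono le_rfl
      fun s' h => ⟨h.1.2, h.2.1, h.2.2⟩
    · rintro i hi s₁ ⟨⟨h1, h2⟩, h3, h4⟩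
      have hC₁ := hC.of_sameBelow h4 (by norm_num)
      refine ⟨by simp only [RamTest.Holds, h1, h4 21 (by norm_num), hM]; exact hi, ?_⟩
      refine Runs.seq (runs_weightProg hn hC₁ ((h4 20 (by norm_num)).trans hk) h1
        (fun d hd => (h3 (16 + d) (by omega) (by omega)).trans (hw d hd)) hY (by omega) hkY) ?_
      rintro s₂ ⟨d1, d2, d3⟩
      have hC₂ := hC₁.of_sameBelow d3 (by norm_num)
      refine (Runs.straight (by exact ⟨trivial, trivial, trivial⟩)).mono (by simp) ?_
      rintro _ rfl
      refine ⟨⟨?_, ?_⟩, fun a ha ha' => ?_, fun r hr => ?_⟩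
      · simp [RamInstr.apply, d3 30 (by norm_num), h1]
      · simp [RamInstr.apply, hC₂.r5, hC₂.r4, ArithOp.eval, Finset.sum_range_succ, d1, d2 4, h2]
      · simp [RamInstr.apply, hC₂.r5, ha', d2 a ha, h3 a ha ha']
      · have a1 := d3 r (by omega)
        have a2 := h4 r hr
        simp [RamInstr.apply, show r ≠ 30 by omega, a1, a2]
    · rintro s₁ ⟨⟨h1, h2⟩, h3, h4⟩
      simp only [RamTest.Holds, h1, h4 21 (by norm_num), hM]
      omega
    · refine ⟨⟨?_, ?_⟩, fun a ha ha' => ?_, fun r hr => ?_⟩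
      · simp [RamInstr.apply]
      · simp [RamInstr.apply, hC.r5, ArithOp.eval]
      · simp [RamInstr.apply, hC.r5, ha']
      · simp [RamInstr.apply, show r ≠ 30 by omega]
  · have h1 := Nat.mul_le_mul_right (Y ^ 6 + 2 + 1) hMY
    have hp : ∀ j, 64 * Y ^ j ≤ Y ^ (j + 1) := fun j => by
      rw [pow_succ, mul_comm]; exact Nat.mul_le_mul_left _ hY
    have h6 := hp 6; have h7 := hp 7
    have h8 : Y ^ 1 ≤ Y ^ 7 := Nat.pow_le_pow_right (by omega) (by norm_num)
    have e : Y * (Y ^ 6 + 2 + 1) = Y ^ 7 + 3 * Y := by ring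
    rw [e] at h1
    simp only [List.length_cons, List.length_nil]
    norm_num at h6 h7 h8
    omega

/-- Writes the number in register `r` into the cell addressed by register `C`. -/
def natToCellProg (r C : ℕ) : RamProg :=
  .seq (straight (.arith .sub C C C) [.izero 30])
    (.loop (.idxLt 30 r) (straight (.arith .add C C 7) [.isucc 30]))

/-- No instruction turns a counter into a complex number, so the value is built by adding the 1 kept
in cell 6. -/
theorem runs_natToCellProg {n r C a x Y : ℕ} {s : RamState} (hC : Consts n s) (hr : r < 30) (hC30 : C < 30)
    (hx : s.idx r = x) (ha : s.idx C = a) (ha6 : a ≠ 6) (h6 : s.cell 6 = 1) (hxY : x ≤ Y) :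
    Runs (natToCellProg r C) s (3 * Y + 3) fun s' => s'.cell a = x ∧
      (∀ b, b ≠ a → s'.cell b = s.cell b) ∧ SameBelow 30 s s' := by
  refine (Runs.seq (Runs.straight (by exact ⟨trivial, trivial, trivial⟩))
    (T' := x * (2 + 1) + 1) ?_).mono (by simp only [List.length_cons, List.length_nil]; omega) fun _ h => h
  rintro _ rfl
  refine (Runs.loop (m := x) (fun i s' => (s'.idx 30 = i ∧ s'.cell a = i) ∧
      (∀ b, b ≠ a → s'.cell b = s.cell b) ∧ SameBelow 30 s s') ?_ ?_ ?_).mono le_rfl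
      fun s' h => ⟨h.1.2, h.2.1, h.2.2⟩
  · rintro i hi s₁ ⟨⟨h1, h2⟩, h3, h4⟩
    have hC₁ := hC.of_sameBelow (h4.mono (by norm_num : 19 ≤ 30)) le_rfl
    have ha₁ := (h4 C hC30).trans ha
    refine ⟨by simp only [RamTest.Holds, h1, h4 r hr, hx]; exact hi, ?_⟩
    refine (Runs.straight (by exact ⟨trivial, trivial, trivial⟩)).mono (by simp) ?_
    rintro _ rfl
    refine ⟨⟨?_, ?_⟩, fun b hb => ?_, fun q hq => ?_⟩
    · simp [RamInstr.apply, h1]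
    · simp [RamInstr.apply, ha₁, hC₁.r7, ArithOp.eval, h2, h3 6 ha6.symm, h6]
    · simp [RamInstr.apply, ha₁, hb, h3 b hb]
    · simp [RamInstr.apply, show q ≠ 30 by omega, h4 q hq]
  · rintro s₁ ⟨⟨h1, h2⟩, h3, h4⟩
    simp only [RamTest.Holds, h1, h4 r hr, hx]
    omega
  · refine ⟨⟨?_, ?_⟩, fun b hb => ?_, fun q hq => ?_⟩
    · simp [RamInstr.apply]
    · simp [RamInstr.apply, ha, ArithOp.eval]
    · simp [RamInstr.apply, ha, hb]
    · simp [RamInstr.apply, show q ≠ 30 by omega]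

end TupleProgram

/-! ### Computing the power series of the logarithm -/

section SeriesProgram

/-- Increments the degree in register `20`, multiplies register `21` by `n²` and moves the array
pointers in the registers `22` and `23`. -/
def advanceProg : RamProg :=
  .seq (straight (.isucc 20) [.icopy 31 21, .izero 21, .izero 30]) <|
  .seq (.loop (.idxLt 30 18) (straight (.iadd 21 21 31) [.isucc 30]))
    (straight (.isucc 22) [.isucc 22, .icopy 23 22, .isucc 23])

/-- Counters have no multiplication: the next power of n² is formed by n² additions of the previous
one. -/
theorem runs_advanceProg {n i p Y : ℕ} {s : RamState} (hC : Consts n s) (h20 : s.idx 20 = i)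
    (h21 : s.idx 21 = (n * n) ^ i) (h22 : s.idx 22 = p) (hY : n * n ≤ Y) :
    Runs advanceProg s (3 * Y + 9) fun s' => s'.idx 20 = i + 1 ∧ s'.idx 21 = (n * n) ^ (i + 1) ∧
      s'.idx 22 = p + 2 ∧ s'.idx 23 = p + 3 ∧ SameBelow 19 s s' ∧ s'.cell = s.cell := by
  refine (Runs.seq (Runs.straight (by exact ⟨trivial, trivial, trivial, trivial, trivial⟩))
    (T' := (n * n * (2 + 1) + 1) + 4) ?_).mono
    (by simp only [List.length_cons, List.length_nil]; omega) fun _ h => h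
  rintro _ rfl
  refine Runs.seq (Runs.loop (m := n * n) (T := 2) (fun j s' => (s'.idx 30 = j ∧ s'.idx 21 = j * (n * n) ^ i ∧
    s'.idx 31 = (n * n) ^ i ∧ s'.idx 20 = i + 1 ∧ s'.idx 22 = p) ∧ SameBelow 19 s s' ∧
    s'.cell = s.cell) ?_ ?_ ?_) ?_
  · rintro j hj s₁ ⟨⟨h1, h2, h3, h4, h5⟩, h6, h7⟩
    have hC₁ := hC.of_sameBelow h6 le_rfl
    refine ⟨by simp only [RamTest.Holds, h1, hC₁.r18]; exact hj, ?_⟩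
    refine (Runs.straight (by exact ⟨trivial, trivial, trivial⟩)).mono (by simp) ?_
    rintro _ rfl
    refine ⟨⟨?_, ?_, ?_, ?_, ?_⟩, fun r hr => ?_, ?_⟩
    · simp [RamInstr.apply, h1]
    · simp [RamInstr.apply, h2, h3, Nat.add_mul]
    · simp [RamInstr.apply, h3]
    · simp [RamInstr.apply, h4]
    · simp [RamInstr.apply, h5]
    · simp [RamInstr.apply, show r ≠ 21 by omega, show r ≠ 30 by omega, h6 r hr]
    · simp [RamInstr.apply, h7]
  · rintro s₁ ⟨⟨h1, h2, h3, h4, h5⟩, h6, h7⟩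
    have hC₁ := hC.of_sameBelow h6 le_rfl
    simp only [RamTest.Holds, h1, hC₁.r18]
    omega
  · refine ⟨⟨?_, ?_, ?_, ?_, ?_⟩, fun r hr => ?_, ?_⟩
    · simp [RamInstr.apply]
    · simp [RamInstr.apply]
    · simp [RamInstr.apply, h21]
    · simp [RamInstr.apply, h20]
    · simp [RamInstr.apply, h22]
    · simp [RamInstr.apply, show r ≠ 20 by omega, show r ≠ 21 by omega, show r ≠ 30 by omega,
        show r ≠ 31 by omega]
    · simp [RamInstr.apply]
  · rintro s₁ ⟨⟨h1, h2, h3, h4, h5⟩, h6, h7⟩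
    refine (Runs.straight (by exact ⟨trivial, trivial, trivial, trivial, trivial⟩)).mono (by simp) ?_
    rintro _ rfl
    refine ⟨?_, ?_, ?_, ?_, fun r hr => ?_, ?_⟩
    · simp [RamInstr.apply, h4]
    · simp [RamInstr.apply, h2, pow_succ, mul_comm]
    · simp [RamInstr.apply, h5]
    · simp [RamInstr.apply, h5]
    · simp [RamInstr.apply, show r ≠ 22 by omega, show r ≠ 23 by omega, h6 r hr]
    · simp [RamInstr.apply, h7]

/-- Computes the coefficient of degree `idx[20]` of `G_W`. -/
def coeffProg : RamProg :=
  .seq tupleSumProg <|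
  .seq (natToCellProg 20 8) <|
  .seq (straight (.arith .mul 6 6 8) [.isub 24 0 20, .isucc 24]) <|
  .seq (natToCellProg 24 9) <|
    straight (.arith .mul 6 6 9) [.arith .div 22 5 6]

theorem runs_coeffProg {n i Y : ℕ} {w : ℕ → ℂ} (hn : 0 < n) {s : RamState} (hC : Consts n s)
    (h20 : s.idx 20 = i + 1) (h21 : s.idx 21 = (n * n) ^ (i + 1))
    (h22 : s.idx 22 = 16 + n * n + 2 * (i + 1)) (hw : ∀ d < n * n, s.cell (16 + d) = w d)
    (h5 : s.cell 5 = tupleDivisor n i) (h6 : s.cell 6 = 1)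
    (hY : 64 ≤ Y) (hMY : (n * n) ^ (i + 1) ≤ Y) (hkY : i + 1 ≤ Y) (hnY : n ≤ Y) :
    Runs coeffProg s (Y ^ 8 + (3 * Y + 3) + 3 + (3 * Y + 3) + 2) fun s' =>
      s'.cell (16 + n * n + 2 * (i + 1)) = tupleSum n w (i + 1) / tupleDivisor n (i + 1) ∧
      s'.cell 5 = tupleDivisor n (i + 1) ∧ s'.cell 7 = (i + 1 : ℕ) ∧
      (∀ a, a ≠ 3 → a ≠ 4 → a ≠ 5 → a ≠ 7 → a ≠ 8 → a ≠ 16 + n * n + 2 * (i + 1) →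
        s'.cell a = s.cell a) ∧ SameBelow 24 s s' := by
  -- The normalizing product is kept in cell 5 and extended by two factors per degree. The truncated
  -- subtraction keeps it nonzero, so the later division is legal.
  have hdiv : (tupleDivisor n (i + 1) : ℂ) = tupleDivisor n i * (i + 1 : ℕ) * (n - (i + 1) + 1 : ℕ) := by
    rw [tupleDivisor, Finset.prod_range_succ, ← tupleDivisor]
    push_cast
    ring
  have hdiv0 : (tupleDivisor n (i + 1) : ℂ) ≠ 0 := by exact_mod_cast (tupleDivisor_pos n (i + 1)).ne'
  refine (Runs.seq (runs_tupleSumProg hn hC h20 h21 hw hY hMY hkY) (T' := (3 * Y + 3) + (3 + ((3 * Y + 3) + 2)))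
    ?_).mono (by omega) fun _ h => h
  rintro s₁ ⟨a1, a2, a3⟩
  have hC₁ := hC.of_sameBelow a3 (by norm_num)
  refine Runs.seq (runs_natToCellProg hC₁ (by norm_num) (by norm_num) ((a3 20 (by norm_num)).trans h20)
    hC₁.r8 (by norm_num) ((a2 6 (by norm_num) (by norm_num)).trans h6) hkY) ?_
  rintro s₂ ⟨b1, b2, b3⟩
  have hC₂ := hC₁.of_sameBelow b3 (by norm_num)
  have hsb₂ := a3.trans b3
  refine Runs.seq (Runs.straight (by exact ⟨trivial, trivial, trivial, trivial⟩)) ?_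
  intro s₃ hs₃
  have e24 : s₃.idx 24 = n - (i + 1) + 1 := by
    simp [hs₃, RamInstr.apply, hC₂.r0, hsb₂ 20 (by norm_num), h20]
  have c5 : s₃.cell 5 = tupleDivisor n i * (i + 1 : ℕ) := by
    simp [hs₃, RamInstr.apply, hC₂.r6, hC₂.r8, ArithOp.eval, b1, b2 5, a2 5, h5]
  have ca : ∀ a, a ≠ 5 → s₃.cell a = s₂.cell a := fun a ha => by
    simp [hs₃, RamInstr.apply, hC₂.r6, ha]
  have hsb₃ : SameBelow 24 s s₃ := (hsb₂.mono (by norm_num)).trans fun r hr => by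
    simp [hs₃, RamInstr.apply, show r ≠ 24 by omega]
  have hC₃ := hC.of_sameBelow hsb₃ (by norm_num)
  clear hs₃
  refine Runs.seq (runs_natToCellProg hC₃ (r := 24) (C := 9) (Y := Y) (by norm_num) (by norm_num) e24
    hC₃.r9 (by norm_num) ?_ (by omega)) ?_
  · rw [ca 6 (by norm_num), b2 6 (by norm_num), a2 6 (by norm_num) (by norm_num), h6]
  rintro s₄ ⟨d1, d2, d3⟩
  have hC₄ := hC₃.of_sameBelow d3 (by norm_num)
  have hsb₄ := hsb₃.trans (d3.mono (by norm_num))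
  have g22 : s₄.idx 22 = 16 + n * n + 2 * (i + 1) := (hsb₄ 22 (by norm_num)).trans h22
  have g5 : s₄.cell 5 * s₄.cell 8 = tupleDivisor n (i + 1) := by
    rw [hdiv, d1, d2 5 (by norm_num), c5]
  have g4 : s₄.cell 4 = tupleSum n w (i + 1) := by
    rw [d2 4 (by norm_num), ca 4 (by norm_num), b2 4 (by norm_num), a1]
  have g7 : s₄.cell 7 = (i + 1 : ℕ) := by
    rw [d2 7 (by norm_num), ca 7 (by norm_num), b1]
  refine (Runs.straight ?_).mono (by simp) ?_
  · refine ⟨trivial, ?_, trivial⟩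
    simp only [RamInstr.Defined, RamInstr.apply, hC₄.r6, hC₄.r9, ArithOp.eval, Function.update_self, g5]
    exact hdiv0
  rintro _ rfl
  refine ⟨?_, ?_, ?_, fun a h1 h2 h3 h4 h5 h6 => ?_, fun r hr => ?_⟩
  · simp [RamInstr.apply, hC₄.r6, hC₄.r9, hC₄.r5, ArithOp.eval, g22, g5, g4]
  · simp [RamInstr.apply, hC₄.r6, hC₄.r9, hC₄.r5, ArithOp.eval, g22, g5,
      show 5 ≠ 16 + n * n + 2 * (i + 1) by omega]
  · simpa [RamInstr.apply, hC₄.r6, hC₄.r9, hC₄.r5, ArithOp.eval, g22,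
      show 7 ≠ 16 + n * n + 2 * (i + 1) by omega] using g7
  · simp [RamInstr.apply, hC₄.r6, g22, h3, h6, d2 a h5, ca a h3, b2 a h4, a2 a h1 h2]
  · simp [RamInstr.apply, hsb₄ r hr]

/-- Computes `k` times the coefficient of degree `k = idx[20]` of `log G_W`, by Newton's identities. -/
def newtonProg : RamProg :=
  .seq (straight (.arith .mul 9 8 22) [.iadd 30 17 18, .iadd 30 30 4, .isub 31 22 3]) <|
  .seq (.loop (.idxLt 30 22) (straight (.arith .mul 10 30 31)
    [.arith .sub 9 9 10, .isucc 30, .isucc 30, .isub 31 31 3]))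
    (straight (.arith .mul 23 9 7) [])

/-- The coefficients a of G_W and d of the Newton recursion are interleaved, d l right after a l.
One pointer ascends through d 1, d 2, … in steps of 2 while the other descends through a (k - 1), a
(k - 2), …; the loop ends when the first passes the cell of a k. -/
theorem runs_newtonProg {n k Y : ℕ} {a d : ℕ → ℂ} {s : RamState} (hC : Consts n s) (hk : 0 < k)
    (h22 : s.idx 22 = 16 + n * n + 2 * k) (h23 : s.idx 23 = 16 + n * n + 2 * k + 1)
    (h6 : s.cell 6 = 1) (h7 : s.cell 7 = k)
    (ha : ∀ l, 1 ≤ l → l ≤ k → s.cell (16 + n * n + 2 * l) = a l)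
    (hd : ∀ l, 1 ≤ l → l < k → s.cell (16 + n * n + 2 * l + 1) = d l)
    (hdk : d k = k * a k - ∑ j ∈ Finset.Ico 1 k, d j * a (k - j)) (hkY : k ≤ Y) :
    Runs newtonProg s (6 * Y + 6) fun s' => s'.cell (16 + n * n + 2 * k + 1) = d k ∧ s'.cell 8 = d k ∧
      (∀ b, b ≠ 8 → b ≠ 9 → b ≠ 16 + n * n + 2 * k + 1 → s'.cell b = s.cell b) ∧ SameBelow 24 s s' := by
  refine (Runs.seq (Runs.straight (by exact ⟨trivial, trivial, trivial, trivial, trivial⟩))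
    (T' := ((k - 1) * (5 + 1) + 1) + 1) ?_).mono
    (by simp only [List.length_cons, List.length_nil]; omega) fun _ h => h
  rintro _ rfl
  refine Runs.seq (Runs.loop (m := k - 1) (T := 5) (fun j s' => (s'.idx 30 = 19 + n * n + 2 * j ∧
    s'.idx 31 + 2 * (j + 1) = 16 + n * n + 2 * k ∧
    s'.cell 8 = k * a k - ∑ j' ∈ Finset.Ico 1 (j + 1), d j' * a (k - j')) ∧
    (∀ b, b ≠ 8 → b ≠ 9 → s'.cell b = s.cell b) ∧ SameBelow 24 s s') ?_ ?_ ?_) ?_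
  · rintro j hj s₁ ⟨⟨h1, h2, h3⟩, h4, h5⟩
    have hC₁ := hC.of_sameBelow h5 (by norm_num)
    refine ⟨by simp only [RamTest.Holds, h1, h5 22 (by norm_num), h22]; omega, ?_⟩
    refine (Runs.straight (by exact ⟨trivial, trivial, trivial, trivial, trivial, trivial⟩)).mono (by simp) ?_
    rintro _ rfl
    have e31 : s₁.idx 31 = 16 + n * n + 2 * (k - (j + 1)) := by omega
    have f1 : s₁.cell (19 + n * n + 2 * j) = d (j + 1) := by
      rw [h4 _ (by omega) (by omega), ← hd (j + 1) (by omega) (by omega)]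
      congr 1
      omega
    have f2 : s₁.cell (16 + n * n + 2 * (k - (j + 1))) = a (k - (j + 1)) := by
      rw [h4 _ (by omega) (by omega), ha _ (by omega) (by omega)]
    refine ⟨⟨?_, ?_, ?_⟩, fun b hb hb' => ?_, fun r hr => ?_⟩
    · simp [RamInstr.apply, h1]
      omega
    · simp [RamInstr.apply, hC₁.r3]
      omega
    · rw [Finset.sum_Ico_succ_top (by omega)]
      simp [RamInstr.apply, hC₁.r9, hC₁.r10, ArithOp.eval, h1, e31, f1, f2, h3]
      ring
    · simp [RamInstr.apply, hC₁.r9, hC₁.r10, hb, hb', h4 b hb hb']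
    · simp [RamInstr.apply, show r ≠ 30 by omega, show r ≠ 31 by omega, h5 r hr]
  · rintro s₁ ⟨⟨h1, h2, h3⟩, h4, h5⟩
    simp only [RamTest.Holds, h1, h5 22 (by norm_num), h22]
    omega
  · refine ⟨⟨?_, ?_, ?_⟩, fun b hb hb' => ?_, fun r hr => ?_⟩
    · simp [RamInstr.apply, hC.r17, hC.r18, hC.r4]
      omega
    · simp [RamInstr.apply, hC.r3, h22]
      omega
    · simp [RamInstr.apply, hC.r9, hC.r8, ArithOp.eval, h7, h22, ha k hk le_rfl]
    · simp [RamInstr.apply, hC.r9, hb]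
    · simp [RamInstr.apply, show r ≠ 30 by omega, show r ≠ 31 by omega]
  · rintro s₁ ⟨⟨h1, h2, h3⟩, h4, h5⟩
    have hC₁ := hC.of_sameBelow h5 (by norm_num)
    rw [Nat.sub_add_cancel hk, ← hdk] at h3
    have e23 := (h5 23 (by norm_num)).trans h23
    have e6 : s₁.cell 6 = 1 := (h4 6 (by norm_num) (by norm_num)).trans h6
    refine (Runs.straight (by exact ⟨trivial, trivial⟩)).mono (by simp) ?_
    rintro _ rfl
    refine ⟨?_, ?_, fun b hb hb' hb'' => ?_, fun r hr => ?_⟩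
    · simp [RamInstr.apply, hC₁.r9, hC₁.r7, ArithOp.eval, e23, h3, e6]
    · simp [RamInstr.apply, e23, show 8 ≠ 16 + n * n + 2 * k + 1 by omega, h3]
    · simp [RamInstr.apply, e23, hb'', h4 b hb hb']
    · simp [RamInstr.apply, h5 r hr]

/-- One round of the main loop. -/
def seriesStepProg : RamProg :=
  .seq advanceProg <|
  .seq coeffProg <|
  .seq newtonProg <|
    straight (.arith .div 10 9 8) [.arith .add 11 11 10, .arith .mul 12 12 13]

/-- The configuration after `i` rounds of the main loop: the cells from `16` on hold the array `w`
and the coefficients computed so far; the cells `10`, `11` hold the partial sum of the logarithmic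
series and the current error bound. -/
structure SeriesState (n : ℕ) (w d : ℕ → ℂ) (ρ η b u q : ℂ) (i : ℕ) (s : RamState) : Prop where
  consts : Consts n s
  r20 : s.idx 20 = i
  r21 : s.idx 21 = (n * n) ^ i
  r22 : s.idx 22 = 16 + n * n + 2 * i
  c0 : s.cell 0 = ρ
  c1 : s.cell 1 = η
  c5 : s.cell 5 = tupleDivisor n i
  c6 : s.cell 6 = 1
  c10 : s.cell 10 = ∑ k ∈ Finset.Icc 1 i, d k / k
  c11 : s.cell 11 = u * q ^ i
  c12 : s.cell 12 = q
  c13 : s.cell 13 = b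
  entries : ∀ x < n * n, s.cell (16 + x) = w x
  coeffs : ∀ k, 1 ≤ k → k ≤ i → s.cell (16 + n * n + 2 * k) = tupleSum n w k / tupleDivisor n k
  logCoeffs : ∀ k, 1 ≤ k → k ≤ i → s.cell (16 + n * n + 2 * k + 1) = d k

theorem runs_seriesStepProg {n i Y : ℕ} {w d : ℕ → ℂ} {ρ η b u q : ℂ} (hn : 0 < n) {s : RamState}
    (hs : SeriesState n w d ρ η b u q i s)
    (hd : ∀ k, 1 ≤ k → d k = k * (tupleSum n w k / tupleDivisor n k)
      - ∑ j ∈ Finset.Ico 1 k, d j * (tupleSum n w (k - j) / tupleDivisor n (k - j)))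
    (hY : 64 ≤ Y) (hNY : n * n ≤ Y) (hMY : (n * n) ^ (i + 1) ≤ Y) (hkY : i + 1 ≤ Y) :
    Runs seriesStepProg s (Y ^ 9) (SeriesState n w d ρ η b u q (i + 1)) := by
  have hnY : n ≤ Y := (Nat.le_mul_self n).trans hNY
  refine (Runs.seq (runs_advanceProg hs.consts hs.r20 hs.r21 hs.r22 hNY)
    (T' := (Y ^ 8 + (3 * Y + 3) + 3 + (3 * Y + 3) + 2) + ((6 * Y + 6) + 3)) ?_).mono ?_ fun _ h => h
  · rintro s₁ ⟨a1, a2, a3, a4, a5, a6⟩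
    have hC₁ := hs.consts.of_sameBelow a5 le_rfl
    refine Runs.seq (runs_coeffProg hn hC₁ a1 a2 (w := w) (Y := Y) (by rw [a3]; ring)
      (fun x hx => by rw [a6, hs.entries x hx]) (by rw [a6, hs.c5]) (by rw [a6, hs.c6]) hY hMY hkY hnY) ?_
    rintro s₂ ⟨b1, b2, b3, b4, b5⟩
    rw [a6] at b4
    have hC₂ := hC₁.of_sameBelow b5 (by norm_num)
    refine Runs.seq (runs_newtonProg (k := i + 1) (a := fun k => tupleSum n w k / tupleDivisor n k) (d := d)
      hC₂ (Nat.succ_pos i) ?_ ?_ ?_ b3 ?_ ?_ (hd (i + 1) (by omega)) hkY) ?_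
    · rw [b5 22 (by norm_num), a3]; ring
    · rw [b5 23 (by norm_num), a4]; ring
    · rw [b4 6 (by norm_num) (by norm_num) (by norm_num) (by norm_num) (by norm_num) (by omega), hs.c6]
    · intro l hl hl'
      rcases Nat.lt_or_ge l (i + 1) with h | h
      · rw [b4 _ (by omega) (by omega) (by omega) (by omega) (by omega) (by omega),
          hs.coeffs l hl (by omega)]
      · obtain rfl : l = i + 1 := by omega
        exact b1
    · intro l hl hl'
      rw [b4 _ (by omega) (by omega) (by omega) (by omega) (by omega) (by omega),
        hs.logCoeffs l hl (by omega)]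
    rintro s₃ ⟨d1, d2, d3, d4⟩
    have hC₃ := hC₂.of_sameBelow d4 (by norm_num)
    have hcell : ∀ a, a ≠ 3 → a ≠ 4 → a ≠ 5 → a ≠ 7 → a ≠ 8 → a ≠ 9 → a ≠ 16 + n * n + 2 * (i + 1) →
        a ≠ 16 + n * n + 2 * (i + 1) + 1 → s₃.cell a = s.cell a :=
      fun a h1 h2 h3 h4 h5 h6 h7 h8 => (d3 a h5 h6 h8).trans (b4 a h1 h2 h3 h4 h5 h7)
    have e7 : s₃.cell 7 = (i + 1 : ℕ) := by
      rw [d3 7 (by norm_num) (by norm_num) (by omega), b3]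
    have hk0 : ((i + 1 : ℕ) : ℂ) ≠ 0 := by exact_mod_cast i.succ_ne_zero
    refine (Runs.straight ?_).mono (by simp) ?_
    · refine ⟨?_, trivial, trivial, trivial⟩
      simp only [RamInstr.Defined, hC₃.r8, e7]
      exact hk0
    intro s₄ hs₄
    have hidx : s₄.idx = s₃.idx := by simp [hs₄, RamInstr.apply]
    have f10 : s₄.cell 10 = s₃.cell 10 + s₃.cell 8 / s₃.cell 7 := by
      simp [hs₄, RamInstr.apply, hC₃.r8, hC₃.r9, hC₃.r10, hC₃.r11, hC₃.r12, ArithOp.eval]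
    have f11 : s₄.cell 11 = s₃.cell 11 * s₃.cell 12 := by
      simp [hs₄, RamInstr.apply, hC₃.r10, hC₃.r11, hC₃.r12, hC₃.r13, ArithOp.eval]
    have fa : ∀ a, a ≠ 9 → a ≠ 10 → a ≠ 11 → s₄.cell a = s₃.cell a := fun a h1 h2 h3 => by
      simp [hs₄, RamInstr.apply, hC₃.r10, hC₃.r11, hC₃.r12, h1, h2, h3]
    clear hs₄
    have hlow : ∀ a, a < 16 → a ≠ 3 → a ≠ 4 → a ≠ 5 → a ≠ 7 → a ≠ 8 → a ≠ 9 → s₃.cell a = s.cell a :=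
      fun a h h1 h2 h3 h4 h5 h6 => hcell a h1 h2 h3 h4 h5 h6 (by omega) (by omega)
    constructor
    · exact hC₃.of_sameBelow (b := 19) (fun r _ => by rw [hidx]) le_rfl
    · rw [hidx, d4 20 (by norm_num), b5 20 (by norm_num), a1]
    · rw [hidx, d4 21 (by norm_num), b5 21 (by norm_num), a2]
    · rw [hidx, d4 22 (by norm_num), b5 22 (by norm_num), a3]; ring
    · rw [fa 0 (by norm_num) (by norm_num) (by norm_num), hlow 0 (by norm_num) (by norm_num) (by norm_num)
        (by norm_num) (by norm_num) (by norm_num) (by norm_num), hs.c0]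
    · rw [fa 1 (by norm_num) (by norm_num) (by norm_num), hlow 1 (by norm_num) (by norm_num) (by norm_num)
        (by norm_num) (by norm_num) (by norm_num) (by norm_num), hs.c1]
    · rw [fa 5 (by norm_num) (by norm_num) (by norm_num), d3 5 (by norm_num) (by norm_num) (by omega), b2]
    · rw [fa 6 (by norm_num) (by norm_num) (by norm_num), hlow 6 (by norm_num) (by norm_num) (by norm_num)
        (by norm_num) (by norm_num) (by norm_num) (by norm_num), hs.c6]
    · rw [f10, hlow 10 (by norm_num) (by norm_num) (by norm_num)
        (by norm_num) (by norm_num) (by norm_num) (by norm_num), hs.c10, d2, e7,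
        Finset.sum_Icc_succ_top (by omega)]
    · rw [f11, hlow 11 (by norm_num) (by norm_num) (by norm_num)
        (by norm_num) (by norm_num) (by norm_num) (by norm_num), hlow 12 (by norm_num) (by norm_num) (by norm_num)
        (by norm_num) (by norm_num) (by norm_num) (by norm_num), hs.c11, hs.c12, pow_succ, mul_assoc]
    · rw [fa 12 (by norm_num) (by norm_num) (by norm_num), hlow 12 (by norm_num) (by norm_num) (by norm_num)
        (by norm_num) (by norm_num) (by norm_num) (by norm_num), hs.c12]
    · rw [fa 13 (by norm_num) (by norm_num) (by norm_num), hlow 13 (by norm_num) (by norm_num) (by norm_num)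
        (by norm_num) (by norm_num) (by norm_num) (by norm_num), hs.c13]
    · intro x hx
      rw [fa _ (by omega) (by omega) (by omega), hcell _ (by omega) (by omega) (by omega) (by omega)
        (by omega) (by omega) (by omega) (by omega), hs.entries x hx]
    · intro k hk hk'
      rw [fa _ (by omega) (by omega) (by omega)]
      rcases Nat.lt_or_ge k (i + 1) with h | h
      · rw [hcell _ (by omega) (by omega) (by omega) (by omega)
          (by omega) (by omega) (by omega) (by omega), hs.coeffs k hk (by omega)]
      · obtain rfl : k = i + 1 := by omega
        rw [d3 _ (by omega) (by omega) (by omega), b1]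
    · intro k hk hk'
      rw [fa _ (by omega) (by omega) (by omega)]
      rcases Nat.lt_or_ge k (i + 1) with h | h
      · rw [hcell _ (by omega) (by omega) (by omega) (by omega)
          (by omega) (by omega) (by omega) (by omega), hs.logCoeffs k hk (by omega)]
      · obtain rfl : k = i + 1 := by omega
        exact d1
  · have hp : ∀ j, 64 * Y ^ j ≤ Y ^ (j + 1) := fun j => by
      rw [pow_succ, mul_comm]; exact Nat.mul_le_mul_left _ hY
    have h8 := hp 8
    have h1 : Y ^ 1 ≤ Y ^ 8 := Nat.pow_le_pow_right (by omega) (by norm_num)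
    norm_num at h8 h1
    omega

end SeriesProgram

/-! ### The interpolation algorithm -/

section InterpolationProgram

/-- Writes the numbers `0, …, v` into the registers `1, …, v + 1`. -/
def constProg : ℕ → RamProg
  | 0 => straight (.izero 1) []
  | v + 1 => .seq (constProg v) (straight (.icopy (v + 2) (v + 1)) [.isucc (v + 2)])

theorem runs_constProg (v : ℕ) (s : RamState) : Runs (constProg v) s (2 * v + 1) fun s' =>
    (∀ i ≤ v, s'.idx (i + 1) = i) ∧ s'.idx 0 = s.idx 0 ∧ s'.cell = s.cell := by
  induction v with
  | zero =>
    refine (Runs.straight (by exact ⟨trivial, trivial⟩)).mono (by simp) ?_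
    rintro _ rfl
    refine ⟨fun i hi => ?_, ?_, ?_⟩
    · obtain rfl : i = 0 := by omega
      simp [RamInstr.apply]
    · simp [RamInstr.apply]
    · simp [RamInstr.apply]
  | succ v ih =>
    refine (Runs.seq ih (T' := 2) ?_).mono (by omega) fun _ h => h
    rintro s₁ ⟨h1, h2, h3⟩
    refine (Runs.straight (by exact ⟨trivial, trivial, trivial⟩)).mono (by simp) ?_
    rintro _ rfl
    refine ⟨fun i hi => ?_, ?_, ?_⟩
    · rcases Nat.lt_or_ge i (v + 1) with h | h
      · have e : i + 1 ≠ v + 2 := by omega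
        simp only [List.foldl_cons, List.foldl_nil, RamInstr.apply]
        rw [Function.update_of_ne e, Function.update_of_ne e, h1 i (by omega)]
      · obtain rfl : i = v + 1 := by omega
        simp [RamInstr.apply, h1 v le_rfl]
    · simp [RamInstr.apply, h2]
    · simp [RamInstr.apply, h3]

/-- Writes the constants into the registers `1` to `18`. -/
def setupProg : RamProg :=
  .seq (constProg 16) <|
  .seq (straight (.izero 18) [.izero 20]) <|
  .loop (.idxLt 20 0) (straight (.iadd 18 18 0) [.isucc 20])

theorem runs_setupProg {n Y : ℕ} {s : RamState} (h0 : s.idx 0 = n) (hn : n ≤ Y) :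
    Runs setupProg s (3 * Y + 36) fun s' => Consts n s' ∧ s'.cell = s.cell := by
  refine (Runs.seq (runs_constProg 16 s) (T' := 2 + (n * (2 + 1) + 1)) ?_).mono (by omega) fun _ h => h
  rintro s₁ ⟨h1, h2, h3⟩
  refine Runs.seq (Runs.straight (by exact ⟨trivial, trivial, trivial⟩)) ?_
  rintro _ rfl
  refine (Runs.loop (m := n) (T := 2) (fun j s' => s'.idx 20 = j ∧ s'.idx 18 = j * n ∧ SameBelow 18 s₁ s' ∧
    s'.cell = s.cell) ?_ ?_ ?_).mono le_rfl ?_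
  · rintro j hj s₂ ⟨g1, g2, g3, g4⟩
    have e0 : s₂.idx 0 = n := by rw [g3 0 (by norm_num), h2, h0]
    refine ⟨by simp only [RamTest.Holds, g1, e0]; exact hj, ?_⟩
    refine (Runs.straight (by exact ⟨trivial, trivial, trivial⟩)).mono (by simp) ?_
    rintro _ rfl
    refine ⟨?_, ?_, fun r hr => ?_, ?_⟩
    · simp [RamInstr.apply, g1]
    · simp [RamInstr.apply, g2, e0, Nat.add_mul]
    · simp [RamInstr.apply, show r ≠ 18 by omega, show r ≠ 20 by omega, g3 r hr]
    · simp [RamInstr.apply, g4]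
  · rintro s₂ ⟨g1, g2, g3, g4⟩
    have e0 : s₂.idx 0 = n := by rw [g3 0 (by norm_num), h2, h0]
    simp only [RamTest.Holds, g1, e0]
    omega
  · refine ⟨?_, ?_, fun r hr => ?_, ?_⟩
    · simp [RamInstr.apply]
    · simp [RamInstr.apply]
    · simp [RamInstr.apply, show r ≠ 18 by omega, show r ≠ 20 by omega]
    · simp [RamInstr.apply, h3]
  · rintro s₂ ⟨g1, g2, g3, g4⟩
    refine ⟨?_, g4⟩
    have hr : ∀ i ≤ 16, s₂.idx (i + 1) = i := fun i hi => (g3 (i + 1) (by omega)).trans (h1 i hi)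
    exact ⟨by rw [g3 0 (by norm_num), h2, h0], hr 0 (by norm_num), hr 1 (by norm_num),
      hr 2 (by norm_num), hr 3 (by norm_num), hr 4 (by norm_num), hr 5 (by norm_num),
      hr 6 (by norm_num), hr 7 (by norm_num), hr 8 (by norm_num), hr 9 (by norm_num),
      hr 10 (by norm_num), hr 11 (by norm_num), hr 12 (by norm_num), hr 13 (by norm_num),
      hr 14 (by norm_num), hr 15 (by norm_num), hr 16 (by norm_num), g2⟩

/-- Divides the entries of the matrix by cell `0` and moves them to the cells from `16` on. -/
def scaleProg : RamProg :=
  .seq (straight (.icopy 20 18) []) <|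
  .loop (.idxLt 1 20) (straight (.isub 20 20 2) [.iadd 21 4 20, .iadd 22 17 20, .arith .div 22 21 1])

/-- Source and target ranges overlap, so entries are moved from the last to the first and no unread
entry is overwritten. Dividing by ρ beforehand means that the logarithmic series need only be
evaluated at 1, and cells below 16 become workspace. -/
theorem runs_scaleProg {n Y : ℕ} {ρ : ℂ} {s : RamState} (hC : Consts n s) (h0 : s.cell 0 = ρ) (hρ : ρ ≠ 0)
    (hN : n * n ≤ Y) : Runs scaleProg s (5 * Y + 2) fun s' => Consts n s' ∧
      (∀ x < n * n, s'.cell (16 + x) = s.cell (3 + x) / ρ) ∧ ∀ a < 16, s'.cell a = s.cell a := by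
  refine (Runs.seq (Runs.straight (by exact ⟨trivial, trivial⟩)) (T' := n * n * (4 + 1) + 1) ?_).mono
    (by simp only [List.length_nil]; omega) fun _ h => h
  rintro _ rfl
  refine (Runs.loop (m := n * n) (T := 4) (fun j s' => (s'.idx 20 = n * n - j ∧ SameBelow 19 s s') ∧
    (∀ x < n * n, n * n - j ≤ x → s'.cell (16 + x) = s.cell (3 + x) / ρ) ∧
    ∀ a < 16 + (n * n - j), s'.cell a = s.cell a) ?_ ?_ ?_).mono le_rfl ?_
  · rintro j hj s₁ ⟨⟨g1, g2⟩, g3, g4⟩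
    have hC₁ := hC.of_sameBelow g2 le_rfl
    refine ⟨by simp only [RamTest.Holds, g1, hC₁.r1]; omega, ?_⟩
    have e0 : s₁.cell 0 = ρ := (g4 0 (by omega)).trans h0
    refine (Runs.straight ?_).mono (by simp) ?_
    · refine ⟨trivial, trivial, trivial, ?_, trivial⟩
      simp [RamInstr.Defined, RamInstr.apply, hC₁.r1, e0, hρ]
    intro s₂ hs₂
    have f20 : s₂.idx 20 = n * n - (j + 1) := by
      simp [hs₂, RamInstr.apply, g1, hC₁.r2]
      omega
    have fsb : SameBelow 19 s₁ s₂ := fun r hr => by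
      simp [hs₂, RamInstr.apply, show r ≠ 20 by omega, show r ≠ 21 by omega, show r ≠ 22 by omega]
    have fc : s₂.cell = Function.update s₁.cell (16 + (n * n - (j + 1)))
        (s₁.cell (3 + (n * n - (j + 1))) / ρ) := by
      simp [hs₂, RamInstr.apply, g1, hC₁.r1, hC₁.r2, hC₁.r4, hC₁.r17, ArithOp.eval, e0, Nat.sub_sub]
    clear hs₂
    refine ⟨⟨f20, g2.trans fsb⟩, fun x hx hx' => ?_, fun a ha => ?_⟩
    · rw [fc]
      rcases Nat.lt_or_ge x (n * n - j) with h | h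
      · obtain rfl : x = n * n - (j + 1) := by omega
        rw [Function.update_self, g4 _ (by omega)]
      · rw [Function.update_of_ne (by omega), g3 x hx h]
    · rw [fc, Function.update_of_ne (by omega), g4 a (by omega)]
  · rintro s₁ ⟨⟨g1, g2⟩, g3, g4⟩
    have hC₁ := hC.of_sameBelow g2 le_rfl
    simp only [RamTest.Holds, g1, hC₁.r1]
    omega
  · refine ⟨⟨?_, fun r hr => ?_⟩, fun x hx hx' => ?_, fun a ha => ?_⟩
    · simp [RamInstr.apply, hC.r18]
    · simp [RamInstr.apply, show r ≠ 20 by omega]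
    · omega
    · simp [RamInstr.apply]
  · rintro s₁ ⟨⟨g1, g2⟩, g3, g4⟩
    exact ⟨hC.of_sameBelow g2 le_rfl, fun x hx => g3 x hx (by omega), fun a ha => g4 a (by omega)⟩

/-- Initializes the variables of the main loop. -/
def initProg : RamProg :=
  .seq (straight (.one 7) []) <|
  .seq (natToCellProg 0 9) <|
  .seq (straight (.arith .add 12 9 9) [.arith .add 12 12 12, .arith .div 12 12 3, .arith .mul 14 12 12]) <|
  .seq (straight (.arith .add 10 7 7) [.arith .div 10 3 10, .arith .sub 13 7 10]) <|
  .seq (straight (.arith .add 10 2 2) [.arith .div 14 14 10, .arith .sub 11 11 11]) <|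
    straight (.one 6) [.izero 20, .izero 21, .isucc 21, .iadd 22 17 18]

theorem runs_initProg {n Y : ℕ} {w d : ℕ → ℂ} {ρ η ε : ℂ} {s : RamState} (hC : Consts n s)
    (h0 : s.cell 0 = ρ) (h1 : s.cell 1 = η) (h2 : s.cell 2 = ε) (hη : η ≠ 0) (hε : ε ≠ 0)
    (hw : ∀ x < n * n, s.cell (16 + x) = w x) (hn : n ≤ Y) :
    Runs initProg s (3 * Y + 20) (SeriesState n w d ρ η ((4 * n / ε) ^ 2 / (2 * η)) (4 * n / ε)
      (1 - ε / 2) 0) := by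
  refine (Runs.seq (Runs.straight (by exact ⟨trivial, trivial⟩)) (T' := (3 * Y + 3) + (4 + (3 + (3 + 5))))
    ?_).mono (by simp only [List.length_nil]; omega) fun _ h => h
  intro s₁ hs₁
  have hsb₁ : SameBelow 30 s s₁ := fun r _ => by simp [hs₁, RamInstr.apply]
  have a6 : s₁.cell 6 = 1 := by simp [hs₁, RamInstr.apply, hC.r7]
  have aa : ∀ a, a ≠ 6 → s₁.cell a = s.cell a := fun a ha => by simp [hs₁, RamInstr.apply, hC.r7, ha]
  clear hs₁
  have hC₁ := hC.of_sameBelow hsb₁ (by norm_num)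
  refine Runs.seq (runs_natToCellProg hC₁ (r := 0) (C := 9) (Y := Y) (by norm_num) (by norm_num) hC₁.r0
    hC₁.r9 (by norm_num) a6 hn) ?_
  rintro s₂ ⟨b8, ba, hsb₂⟩
  have hC₂ := hC₁.of_sameBelow hsb₂ (by norm_num)
  have b1 : s₂.cell 1 = η := by rw [ba 1 (by norm_num), aa 1 (by norm_num), h1]
  have b2 : s₂.cell 2 = ε := by rw [ba 2 (by norm_num), aa 2 (by norm_num), h2]
  have b6 : s₂.cell 6 = 1 := by rw [ba 6 (by norm_num), a6]
  refine Runs.seq (Runs.straight ?_) ?_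
  · refine ⟨trivial, trivial, ?_, trivial, trivial⟩
    simp [RamInstr.Defined, RamInstr.apply, hC₂.r12, hC₂.r3, b2, hε]
  intro s₃ hs₃
  have hsb₃ : SameBelow 30 s₂ s₃ := fun r _ => by simp [hs₃, RamInstr.apply]
  -- The factor 4 is obtained by doubling n twice, as 1 is the only nonzero constant available.
  have c11 : s₃.cell 11 = 4 * n / ε := by
    simp [hs₃, RamInstr.apply, hC₂.r12, hC₂.r9, hC₂.r3, hC₂.r14, ArithOp.eval, b8, b2]
    ring
  have c13 : s₃.cell 13 = (4 * n / ε) ^ 2 := by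
    simp [hs₃, RamInstr.apply, hC₂.r12, hC₂.r9, hC₂.r3, hC₂.r14, ArithOp.eval, b8, b2]
    ring
  have ca : ∀ a, a ≠ 11 → a ≠ 13 → s₃.cell a = s₂.cell a := fun a ha ha' => by
    simp [hs₃, RamInstr.apply, hC₂.r12, hC₂.r14, ha, ha']
  clear hs₃
  have hC₃ := hC₂.of_sameBelow hsb₃ (by norm_num)
  have c1 : s₃.cell 1 = η := (ca 1 (by norm_num) (by norm_num)).trans b1
  have c2 : s₃.cell 2 = ε := (ca 2 (by norm_num) (by norm_num)).trans b2
  have c6 : s₃.cell 6 = 1 := (ca 6 (by norm_num) (by norm_num)).trans b6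
  refine Runs.seq (Runs.straight ?_) ?_
  · refine ⟨trivial, ?_, trivial, trivial⟩
    simp [RamInstr.Defined, RamInstr.apply, hC₃.r10, hC₃.r7, ArithOp.eval, c6]
  intro s₄ hs₄
  have hsb₄ : SameBelow 30 s₃ s₄ := fun r _ => by simp [hs₄, RamInstr.apply]
  have d12 : s₄.cell 12 = 1 - ε / 2 := by
    simp [hs₄, RamInstr.apply, hC₃.r10, hC₃.r7, hC₃.r3, hC₃.r13, ArithOp.eval, c6, c2]
    norm_num
  have da : ∀ a, a ≠ 9 → a ≠ 12 → s₄.cell a = s₃.cell a := fun a ha ha' => by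
    simp [hs₄, RamInstr.apply, hC₃.r10, hC₃.r13, ha, ha']
  clear hs₄
  have hC₄ := hC₃.of_sameBelow hsb₄ (by norm_num)
  have d1 : s₄.cell 1 = η := (da 1 (by norm_num) (by norm_num)).trans c1
  have d11 : s₄.cell 11 = 4 * n / ε := (da 11 (by norm_num) (by norm_num)).trans c11
  have d13 : s₄.cell 13 = (4 * n / ε) ^ 2 := (da 13 (by norm_num) (by norm_num)).trans c13
  refine Runs.seq (Runs.straight ?_) ?_
  · refine ⟨trivial, ?_, trivial, trivial⟩
    simp only [RamInstr.Defined, RamInstr.apply, hC₄.r10, hC₄.r2, ArithOp.eval, d1, Function.update_self]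
    rw [← two_mul]
    exact mul_ne_zero two_ne_zero hη
  intro s₅ hs₅
  have hsb₅ : SameBelow 30 s₄ s₅ := fun r _ => by simp [hs₅, RamInstr.apply]
  have e13 : s₅.cell 13 = (4 * n / ε) ^ 2 / (2 * η) := by
    simp [hs₅, RamInstr.apply, hC₄.r10, hC₄.r2, hC₄.r14, hC₄.r11, ArithOp.eval, d1, d13, two_mul]
  have e10 : s₅.cell 10 = 0 := by
    simp [hs₅, RamInstr.apply, hC₄.r10, hC₄.r2, hC₄.r14, hC₄.r11, ArithOp.eval]
  have ea : ∀ a, a ≠ 9 → a ≠ 10 → a ≠ 13 → s₅.cell a = s₄.cell a := fun a h h' h'' => by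
    simp [hs₅, RamInstr.apply, hC₄.r10, hC₄.r14, hC₄.r11, h, h', h'']
  clear hs₅
  have hC₅ := hC₄.of_sameBelow hsb₅ (by norm_num)
  refine (Runs.straight (by exact ⟨trivial, trivial, trivial, trivial, trivial, trivial⟩)).mono (by simp) ?_
  intro s₆ hs₆
  have fa : ∀ a, a ≠ 5 → s₆.cell a = s₅.cell a := fun a h => by
    simp [hs₆, RamInstr.apply, hC₅.r6, h]
  have hall : ∀ a, a ≠ 5 → a ≠ 6 → a ≠ 8 → a ≠ 9 → a ≠ 10 → a ≠ 11 → a ≠ 12 → a ≠ 13 →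
      s₆.cell a = s.cell a := fun a h5 h6 h8 h9 h10 h11 h12 h13 => by
    rw [fa a h5, ea a h9 h10 h13, da a h9 h12, ca a h11 h13, ba a h8, aa a h6]
  have hsb₆ : SameBelow 19 s₅ s₆ := fun r hr => by
    simp [hs₆, RamInstr.apply, show r ≠ 20 by omega, show r ≠ 21 by omega, show r ≠ 22 by omega]
  constructor
  · exact hC₅.of_sameBelow hsb₆ le_rfl
  · simp [hs₆, RamInstr.apply]
  · simp [hs₆, RamInstr.apply]
  · simp [hs₆, RamInstr.apply, hC₅.r17, hC₅.r18]
  · rw [hall 0 (by norm_num) (by norm_num) (by norm_num) (by norm_num) (by norm_num) (by norm_num)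
      (by norm_num) (by norm_num), h0]
  · rw [hall 1 (by norm_num) (by norm_num) (by norm_num) (by norm_num) (by norm_num) (by norm_num)
      (by norm_num) (by norm_num), h1]
  · simp [hs₆, RamInstr.apply, hC₅.r6, tupleDivisor]
  · rw [fa 6 (by norm_num), ea 6 (by norm_num) (by norm_num) (by norm_num),
      da 6 (by norm_num) (by norm_num), c6]
  · rw [fa 10 (by norm_num), e10]
    simp
  · rw [fa 11 (by norm_num), ea 11 (by norm_num) (by norm_num) (by norm_num), d11, pow_zero, mul_one]
  · rw [fa 12 (by norm_num), ea 12 (by norm_num) (by norm_num) (by norm_num), d12]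
  · rw [fa 13 (by norm_num), e13]
  · intro x hx
    rw [hall _ (by omega) (by omega) (by omega) (by omega) (by omega) (by omega) (by omega) (by omega), hw x hx]
  · intro k hk hk'
    omega
  · intro k hk hk'
    omega

/-- Computes `n! ρⁿ (1 + T / K) ^ K` from the partial sum `T` of the logarithmic series, where `K` is
the least integer above the bound in cell `13`. -/
def outputProg : RamProg :=
  .seq (straight (.izero 21) [.arith .sub 9 9 9]) <|
  .seq (.loop (.reLt 9 14) (straight (.arith .add 9 9 7) [.isucc 21])) <|
  .seq (straight (.arith .div 10 11 9) [.arith .add 10 7 10, .one 4, .izero 20]) <|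
  .seq (.loop (.idxLt 20 21) (straight (.arith .mul 4 4 10) [.isucc 20])) <|
  .seq (straight (.arith .sub 5 5 5) [.izero 20]) <|
  .seq (.loop (.idxLt 20 0) (straight (.arith .add 5 5 7) [.arith .mul 4 4 5, .arith .mul 4 4 1, .isucc 20])) <|
    straight (.arith .mul 1 4 7) []

/-- The ceiling of B is found by counting up while the counter is below B. It is kept both as a
counter and as a complex number, serving as exponent and as divisor. -/
theorem runs_outputProg {n Y : ℕ} {ρ T : ℂ} {B : ℝ} {s : RamState} (hC : Consts n s)
    (h0 : s.cell 0 = ρ) (h6 : s.cell 6 = 1) (h10 : s.cell 10 = T) (h13 : s.cell 13 = B) (hB : 0 < B)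
    (hn : n ≤ Y) (hK : ⌈B⌉₊ ≤ Y) :
    Runs outputProg s (11 * Y + 12) fun s' =>
      s'.cell 0 = n.factorial * ρ ^ n * (1 + T / (⌈B⌉₊ : ℕ)) ^ ⌈B⌉₊ := by
  set K := ⌈B⌉₊ with hKdef
  have hK0 : (K : ℂ) ≠ 0 := by exact_mod_cast (Nat.ceil_pos.2 hB).ne'
  refine (Runs.seq (Runs.straight (by exact ⟨trivial, trivial, trivial⟩))
    (T' := (K * (2 + 1) + 1) + (4 + ((K * (2 + 1) + 1) + (2 + ((n * (4 + 1) + 1) + 1))))) ?_).mono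
    (by simp only [List.length_cons, List.length_nil]; omega) fun _ h => h
  rintro _ rfl
  refine Runs.seq (Runs.loop (m := K) (T := 2) (fun j s' => (s'.idx 21 = j ∧ s'.cell 8 = j) ∧ SameBelow 19 s s' ∧
    ∀ a, a ≠ 8 → s'.cell a = s.cell a) ?_ ?_ ?_) ?_
  · rintro j hj s₁ ⟨⟨g1, g2⟩, g3, g4⟩
    have hC₁ := hC.of_sameBelow g3 le_rfl
    refine ⟨?_, ?_⟩
    · simp only [RamTest.Holds, hC₁.r9, hC₁.r14, g2, g4 13 (by norm_num), h13, Complex.natCast_re,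
        Complex.ofReal_re]
      exact Nat.lt_ceil.1 hj
    refine (Runs.straight (by exact ⟨trivial, trivial, trivial⟩)).mono (by simp) ?_
    rintro _ rfl
    refine ⟨⟨?_, ?_⟩, fun r hr => ?_, fun a ha => ?_⟩
    · simp [RamInstr.apply, g1]
    · simp [RamInstr.apply, hC₁.r9, hC₁.r7, ArithOp.eval, g2, g4 6, h6]
    · simp [RamInstr.apply, show r ≠ 21 by omega, g3 r hr]
    · simp [RamInstr.apply, hC₁.r9, ha, g4 a ha]
  · rintro s₁ ⟨⟨g1, g2⟩, g3, g4⟩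
    have hC₁ := hC.of_sameBelow g3 le_rfl
    simp only [RamTest.Holds, hC₁.r9, hC₁.r14, g2, g4 13 (by norm_num), h13, Complex.natCast_re,
      Complex.ofReal_re, not_lt]
    exact Nat.le_ceil B
  · refine ⟨⟨?_, ?_⟩, fun r hr => ?_, fun a ha => ?_⟩
    · simp [RamInstr.apply]
    · simp [RamInstr.apply, hC.r9, ArithOp.eval]
    · simp [RamInstr.apply, show r ≠ 21 by omega]
    · simp [RamInstr.apply, hC.r9, ha]
  rintro s₁ ⟨⟨g1, g2⟩, g3, g4⟩
  have hC₁ := hC.of_sameBelow g3 le_rfl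
  refine Runs.seq (Runs.straight ?_) ?_
  · refine ⟨?_, trivial, trivial, trivial, trivial⟩
    simpa only [RamInstr.Defined, hC₁.r9, g2] using hK0
  intro s₂ hs₂
  have hsb₂ : SameBelow 19 s s₂ := g3.trans fun r hr => by
    simp [hs₂, RamInstr.apply, show r ≠ 20 by omega]
  have a9 : s₂.cell 9 = 1 + T / K := by
    simp [hs₂, RamInstr.apply, hC₁.r10, hC₁.r11, hC₁.r9, hC₁.r7, hC₁.r4, ArithOp.eval, g2, g4 6, h6, g4 10, h10]
  have a3 : s₂.cell 3 = 1 := by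
    simp [hs₂, RamInstr.apply, hC₁.r10, hC₁.r4]
  have aa : ∀ a, a ≠ 3 → a ≠ 8 → a ≠ 9 → s₂.cell a = s.cell a := fun a h3 h8 h9 => by
    simp [hs₂, RamInstr.apply, hC₁.r10, hC₁.r4, h3, h9, g4 a h8]
  have a20 : s₂.idx 20 = 0 := by simp [hs₂, RamInstr.apply]
  have a21 : s₂.idx 21 = K := by simp [hs₂, RamInstr.apply, g1]
  clear hs₂
  refine Runs.seq (Runs.loop (m := K) (T := 2) (fun j s' => (s'.idx 20 = j ∧ s'.idx 21 = K ∧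
    s'.cell 3 = (1 + T / K) ^ j) ∧ SameBelow 19 s s' ∧ ∀ a, a ≠ 3 → s'.cell a = s₂.cell a) ?_ ?_ ?_) ?_
  · rintro j hj s₃ ⟨⟨b1, b2, b3⟩, b4, b5⟩
    have hC₃ := hC.of_sameBelow b4 le_rfl
    refine ⟨by simp only [RamTest.Holds, b1, b2]; exact hj, ?_⟩
    refine (Runs.straight (by exact ⟨trivial, trivial, trivial⟩)).mono (by simp) ?_
    rintro _ rfl
    refine ⟨⟨?_, ?_, ?_⟩, fun r hr => ?_, fun a ha => ?_⟩
    · simp [RamInstr.apply, b1]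
    · simp [RamInstr.apply, b2]
    · simp [RamInstr.apply, hC₃.r4, hC₃.r10, ArithOp.eval, b3, b5 9, a9, pow_succ]
    · simp [RamInstr.apply, show r ≠ 20 by omega, b4 r hr]
    · simp [RamInstr.apply, hC₃.r4, ha, b5 a ha]
  · rintro s₃ ⟨⟨b1, b2, b3⟩, b4, b5⟩
    simp only [RamTest.Holds, b1, b2]
    omega
  · exact ⟨⟨a20, a21, by rw [a3, pow_zero]⟩, hsb₂, fun _ _ => rfl⟩
  rintro s₃ ⟨⟨b1, b2, b3⟩, b4, b5⟩
  have hC₃ := hC.of_sameBelow b4 le_rfl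
  have b0 : s₃.cell 0 = ρ := by
    rw [b5 0 (by norm_num), aa 0 (by norm_num) (by norm_num) (by norm_num), h0]
  have b6 : s₃.cell 6 = 1 := by
    rw [b5 6 (by norm_num), aa 6 (by norm_num) (by norm_num) (by norm_num), h6]
  refine Runs.seq (Runs.straight (by exact ⟨trivial, trivial, trivial⟩)) ?_
  rintro _ rfl
  refine Runs.seq (Runs.loop (m := n) (T := 4) (fun j s' => (s'.idx 20 = j ∧ s'.cell 4 = j ∧
    s'.cell 3 = j.factorial * ρ ^ j * (1 + T / K) ^ K) ∧ SameBelow 19 s s' ∧ s'.cell 0 = ρ ∧ s'.cell 6 = 1)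
    ?_ ?_ ?_) ?_
  · rintro j hj s₄ ⟨⟨d1, d2, d3⟩, d4, d5, d6⟩
    have hC₄ := hC.of_sameBelow d4 le_rfl
    refine ⟨by simp only [RamTest.Holds, d1, hC₄.r0]; exact hj, ?_⟩
    refine (Runs.straight (by exact ⟨trivial, trivial, trivial, trivial, trivial⟩)).mono (by simp) ?_
    rintro _ rfl
    refine ⟨⟨?_, ?_, ?_⟩, fun r hr => ?_, ?_, ?_⟩
    · simp [RamInstr.apply, d1]
    · simp [RamInstr.apply, hC₄.r4, hC₄.r5, hC₄.r7, ArithOp.eval, d2, d6]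
    · simp [RamInstr.apply, hC₄.r4, hC₄.r5, hC₄.r7, hC₄.r1, ArithOp.eval, d2, d3, d5, d6, Nat.factorial_succ,
        pow_succ]
      ring
    · simp [RamInstr.apply, show r ≠ 20 by omega, d4 r hr]
    · simp [RamInstr.apply, hC₄.r4, hC₄.r5, d5]
    · simp [RamInstr.apply, hC₄.r4, hC₄.r5, d6]
  · rintro s₄ ⟨⟨d1, d2, d3⟩, d4, d5, d6⟩
    have hC₄ := hC.of_sameBelow d4 le_rfl
    simp only [RamTest.Holds, d1, hC₄.r0]
    omega
  · refine ⟨⟨?_, ?_, ?_⟩, fun r hr => ?_, ?_, ?_⟩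
    · simp [RamInstr.apply]
    · simp [RamInstr.apply, hC₃.r5, ArithOp.eval]
    · simp [RamInstr.apply, hC₃.r5, b3]
    · simp [RamInstr.apply, show r ≠ 20 by omega, b4 r hr]
    · simp [RamInstr.apply, hC₃.r5, b0]
    · simp [RamInstr.apply, hC₃.r5, b6]
  rintro s₄ ⟨⟨d1, d2, d3⟩, d4, d5, d6⟩
  have hC₄ := hC.of_sameBelow d4 le_rfl
  refine (Runs.straight (by exact ⟨trivial, trivial⟩)).mono (by simp) ?_
  rintro _ rfl
  simp [RamInstr.apply, hC₄.r1, hC₄.r4, hC₄.r7, ArithOp.eval, d3, d6]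

/-- The interpolation algorithm. -/
def interpolationProg : RamProg :=
  .seq setupProg <|
  .seq scaleProg <|
  .seq initProg <|
  .seq (.loop (.reLt 2 12) seriesStepProg)
    outputProg

/-- Here m is the first degree at which the error bound drops to η, which is what the main loop
tests by comparing real parts. The number Y dominates every loop count: n², the number of codes, the
degree and K. -/
theorem runs_interpolationProg {n m Y : ℕ} {W : Matrix (Fin n) (Fin n) ℂ} {d : ℕ → ℂ} {ρ : ℂ} {η ε : ℝ}
    (hn : 0 < n) (hρ : ρ ≠ 0) (hη : 0 < η) (hε : 0 < ε)
    (hlt : ∀ i < m, η < 4 * n / ε * (1 - ε / 2) ^ i) (hle : 4 * n / ε * (1 - ε / 2) ^ m ≤ η)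
    (hd : ∀ k, 1 ≤ k → d k = k * (tupleSum n (entryArray (ρ⁻¹ • W)) k / tupleDivisor n k)
      - ∑ j ∈ Finset.Ico 1 k, d j *
        (tupleSum n (entryArray (ρ⁻¹ • W)) (k - j) / tupleDivisor n (k - j)))
    (hY : 64 ≤ Y) (hNY : n * n ≤ Y) (hMY : (n * n) ^ m ≤ Y) (hmY : m ≤ Y)
    (hKY : ⌈(4 * n / ε) ^ 2 / (2 * η)⌉₊ ≤ Y) :
    Runs interpolationProg (ramInput W ρ η ε) (Y ^ 12) fun s =>
      s.cell 0 = n.factorial * ρ ^ n * (1 + (∑ k ∈ Finset.Icc 1 m, d k / k) /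
        (⌈(4 * n / ε) ^ 2 / (2 * η)⌉₊ : ℕ)) ^ ⌈(4 * n / ε) ^ 2 / (2 * η)⌉₊ := by
  have hnY : n ≤ Y := (Nat.le_mul_self n).trans hNY
  have hn' : (0 : ℝ) < n := by exact_mod_cast hn
  have hNpos : 0 < n * n := Nat.mul_pos hn hn
  refine (Runs.seq (runs_setupProg (n := n) (Y := Y) (by simp [ramInput]) hnY)
    (T' := (5 * Y + 2) + ((3 * Y + 20) + ((m * (Y ^ 9 + 1) + 1) + (11 * Y + 12)))) ?_).mono ?_ fun _ h => h
  · rintro s₁ ⟨hC₁, a1⟩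
    refine Runs.seq (runs_scaleProg hC₁ (ρ := ρ) (by rw [a1]; simp [ramInput]) hρ hNY) ?_
    rintro s₂ ⟨hC₂, b1, b2⟩
    rw [a1] at b1 b2
    have hent : ∀ x < n * n, s₂.cell (16 + x) = entryArray (ρ⁻¹ • W) x := by
      intro x hx
      rw [b1 x hx]
      simp only [ramInput, entryArray, dif_pos hx, Matrix.smul_apply, smul_eq_mul]
      rw [if_neg (by omega), if_neg (by omega), if_neg (by omega)]
      simp only [Nat.add_sub_cancel_left, dif_pos hx]
      rw [div_eq_inv_mul]
    refine Runs.seq (runs_initProg (d := d) (Y := Y) hC₂ (b2 0 (by norm_num)) (b2 1 (by norm_num))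
      (b2 2 (by norm_num)) ?_ ?_ hent hnY) ?_
    · simpa [ramInput] using hη.ne'
    · simpa [ramInput] using hε.ne'
    intro s₃ hs₃
    have e0 : (ramInput W ρ η ε).cell 0 = ρ := by simp [ramInput]
    have e1 : (ramInput W ρ η ε).cell 1 = (η : ℂ) := by simp [ramInput]
    have e2 : (ramInput W ρ η ε).cell 2 = (ε : ℂ) := by simp [ramInput]
    rw [e0, e1, e2] at hs₃
    have hre : ∀ i s, SeriesState n (entryArray (ρ⁻¹ • W)) d ρ η ((4 * n / ε) ^ 2 / (2 * η)) (4 * n / ε)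
        (1 - ε / 2) i s → ((RamTest.reLt 2 12).Holds s ↔ η < 4 * n / ε * (1 - ε / 2) ^ i) := by
      intro i s hs
      have : (4 * (n : ℂ) / ε * (1 - ε / 2) ^ i) = ((4 * n / ε * (1 - ε / 2) ^ i : ℝ) : ℂ) := by
        push_cast; rfl
      simp only [RamTest.Holds, hs.consts.r2, hs.consts.r12, hs.c1, hs.c11, this, Complex.ofReal_re]
    refine Runs.seq (Runs.loop (m := m) (T := Y ^ 9) (SeriesState n (entryArray (ρ⁻¹ • W)) d ρ η
      ((4 * n / ε) ^ 2 / (2 * η)) (4 * n / ε) (1 - ε / 2)) ?_ ?_ hs₃) ?_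
    · intro i hi s hs
      refine ⟨(hre i s hs).2 (hlt i hi), runs_seriesStepProg hn hs hd hY hNY ?_ (by omega)⟩
      exact (Nat.pow_le_pow_right hNpos hi).trans hMY
    · intro s hs
      rw [hre m s hs]
      exact not_lt.2 hle
    intro s₄ hs₄
    exact runs_outputProg hs₄.consts hs₄.c0 hs₄.c6 hs₄.c10 (by rw [hs₄.c13]; push_cast; rfl)
      (by positivity) hnY hKY
  · have hp : ∀ j, 64 * Y ^ j ≤ Y ^ (j + 1) := fun j => by
      rw [pow_succ, mul_comm]; exact Nat.mul_le_mul_left _ hY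
    have h10 := hp 10
    have h11 := hp 11
    have h1 : Y ^ 1 ≤ Y ^ 10 := Nat.pow_le_pow_right (by omega) (by norm_num)
    have h2 := Nat.mul_le_mul_right (Y ^ 9 + 1) hmY
    have e : Y * (Y ^ 9 + 1) = Y ^ 10 + Y := by ring
    rw [e] at h2
    norm_num at h10 h11 h1
    omega

end InterpolationProgram

/-! ### Correctness of the algorithm -/

section Correctness

open Polynomial

theorem permPoly_smul {n : ℕ} (W : Matrix (Fin n) (Fin n) ℂ) (c z : ℂ) :
    permPoly (c • W) z = permPoly W (c * z) := by
  rw [permPoly, permPoly, smul_smul, mul_comm]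

/-- The negated power sums of the scaled inverse roots are k times the logarithmic coefficients. As
the constant coefficient is 1, the term j = k of Newton's identity can be isolated, giving the
recursion that the program runs. -/
theorem newton_tupleSum {n N : ℕ} {W : Matrix (Fin n) (Fin n) ℂ} {l : Fin N → ℂ}
    (hl : ∀ z, permPoly W z = ∏ i, (1 - l i * z)) (c : ℂ) {k : ℕ} (hk : 1 ≤ k) :
    -(∑ i, (l i * c) ^ k) = k * (tupleSum n (entryArray (c • W)) k / tupleDivisor n k)
      - ∑ j ∈ Finset.Ico 1 k, -(∑ i, (l i * c) ^ j) *
        (tupleSum n (entryArray (c • W)) (k - j) / tupleDivisor n (k - j)) := by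
  have hP : permPolynomial (c • W) = ∏ i, (1 - C (l i * c) * X) := by
    refine Polynomial.funext fun z => ?_
    rw [eval_permPolynomial, permPoly_smul, hl, eval_prod]
    simp [mul_assoc]
  simp only [← coeff_permPolynomial_eq, hP]
  have h0 : (∏ i, (1 - C (l i * c) * X) : ℂ[X]).coeff 0 = 1 := by
    rw [coeff_zero_eq_eval_zero, eval_prod]
    simp
  have h := natCast_mul_coeff_prod_one_sub Finset.univ (fun i => l i * c) k
  rw [← Finset.Ico_add_one_right_eq_Icc, Finset.sum_Ico_succ_top hk, Nat.sub_self, h0, mul_one] at h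
  rw [h]
  ring

theorem runs_interpolationProg_isMulApprox {n m A : ℕ} (hn : 4 ≤ n) (hA : 36 ≤ A)
    {W : Matrix (Fin n) (Fin n) ℂ} {ε η β ν : ℝ} (hε0 : 0 < ε) (hε : ε < 1) (hν : 0 < ν)
    (hW : ¬ HasZeroInDisk W ((1 - ε / 2) * zeroFreeRadius β ν n)) {ρ : ℂ}
    (hρ : (1 - ε)⁻¹ * Real.sqrt ν * (n : ℝ) ^ (-1 / 3 + β) ≤ ‖ρ‖) (hη : 0 < η) (hη1 : η ≤ 1)
    (hm : m = ⌈(A : ℝ) / ε * Real.log ((n : ℝ) / (η * ε))⌉₊) :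
    IsMulApprox η (barvinokApprox W m ρ) (ρ • allOnes n + W).permanent ∧
      Runs interpolationProg (ramInput W ρ η ε) (n ^ (A * m))
        fun s => IsMulApprox η (s.cell 0) (ρ • allOnes n + W).permanent := by
  have hn' : (4 : ℝ) ≤ n := by exact_mod_cast hn
  have hρ0 : ρ ≠ 0 := by
    have : 0 < (1 - ε)⁻¹ * Real.sqrt ν * (n : ℝ) ^ (-1 / 3 + β) :=
      mul_pos (mul_pos (inv_pos.2 (by linarith)) (Real.sqrt_pos.2 hν))
        (Real.rpow_pos_of_pos (by linarith) _)
    exact norm_pos_iff.1 (this.trans_le hρ)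
  obtain ⟨N, l, hN, hP, hz⟩ := exists_prod_of_not_hasZeroInDisk (by omega) hε0 hε hν hW hρ
  have hl := permPoly_eq_prod hP
  obtain ⟨hm1, hm0, hK⟩ := degree_bounds hn (by omega) hε0 hε hη hη1 hm
  refine ⟨isMulApprox_barvinokApprox hl hN hρ0 hε0 hε hz hη hm1, ?_⟩
  have hex : ∃ i, 4 * n / ε * (1 - ε / 2) ^ i ≤ η := ⟨m, hm1⟩
  classical
  -- The program stops at this degree, possibly below m; both suffice for accuracy, and m only
  -- bounds the time.
  set m' := Nat.find hex with hm'
  have hm'm : m' ≤ m := Nat.find_min' hex hm1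
  have hle : 4 * n / ε * (1 - ε / 2) ^ m' ≤ η := Nat.find_spec hex
  have hlt : ∀ i < m', η < 4 * n / ε * (1 - ε / 2) ^ i := fun i hi => not_le.1 (Nat.find_min hex hi)
  have hpow : ∀ {a b : ℕ}, a ≤ b → n ^ a ≤ n ^ b := fun h => Nat.pow_le_pow_right (by omega) h
  have h3 : n ^ 3 ≤ n ^ (3 * m) := hpow (by omega)
  have h64 : 64 ≤ n ^ (3 * m) := (Nat.pow_le_pow_left hn 3).trans h3
  have hKY : ⌈(4 * n / ε) ^ 2 / (2 * η)⌉₊ ≤ n ^ (3 * m) := by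
    have h1 : ⌈(4 * n / ε) ^ 2 / (2 * η)⌉₊ ≤ 8 * n ^ m := by
      refine Nat.ceil_le.2 (hK.trans (le_of_eq ?_))
      push_cast
      rfl
    have h2 : 16 ≤ n ^ (2 * m) := (Nat.pow_le_pow_left hn 2).trans (hpow (by omega))
    calc _ ≤ 8 * n ^ m := h1
      _ ≤ n ^ (2 * m) * n ^ m := Nat.mul_le_mul_right _ (by omega)
      _ = _ := by rw [← pow_add]; congr 1; ring
  -- With Y = n^(3m) the time Y¹² is n^(36m), which is where A ≥ 36 is needed.
  refine (runs_interpolationProg (W := W) (d := fun k => -(∑ i, (l i * ρ⁻¹) ^ k)) (m := m') (by omega) hρ0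
    hη hε0 hlt hle (fun k hk => newton_tupleSum hl ρ⁻¹ hk) h64 ?_ ?_ ?_ hKY).mono ?_ ?_
  · calc n * n = n ^ 2 := by ring
      _ ≤ _ := hpow (by omega)
  · calc (n * n) ^ m' = n ^ (2 * m') := by rw [← sq, ← pow_mul]
      _ ≤ _ := hpow (by omega)
  · exact (hm'm.trans (Nat.lt_pow_self (by omega)).le).trans (hpow (by omega : m ≤ 3 * m))
  · rw [← pow_mul]
    refine hpow ?_
    calc 3 * m * 12 = 36 * m := by ring
      _ ≤ A * m := Nat.mul_le_mul_right m hA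
  · intro s hs
    have hT : ∑ k ∈ Finset.Icc 1 m', -(∑ i, (l i * ρ⁻¹) ^ k) / (k : ℂ) = logTaylor W m' ρ⁻¹ := by
      rw [logTaylor_eq hl]
      refine Finset.sum_congr rfl fun k _ => ?_
      simp only [mul_pow, ← Finset.sum_mul]
      ring
    rw [hs, hT]
    exact isMulApprox_compound hl hN (by omega) hρ0 hε0 hε hz hη hη1 hle (Nat.le_ceil _)

end Correctness

end

theorem mainTheorem1 :
    ∃ (P : RamProg) (A : ℕ), 0 < A ∧
    ∀ ε : ℝ, 0 < ε → ε < 1 →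
    ∃ C : ℝ, 0 < C ∧
    ∀ β : ℝ, 0 < β → β < 1 / 3 →
    ∃ n₀ : ℕ, ∀ n : ℕ, n₀ ≤ n → ∀ ν : ℝ, 0 < ν →
      -- the probability of a zero of `G_W` in the disk is `O_ε(n^(-6β))`
      (∀ (Ω : Type*) [MeasurableSpace Ω] (μ : Measure Ω) [IsProbabilityMeasure μ]
        (W : Ω → Matrix (Fin n) (Fin n) ℂ),
        (∀ i j, HasLaw (fun ω => W ω i j) (complexGaussian ν) μ) →
        iIndepFun (fun (p : Fin n × Fin n) ω => W ω p.1 p.2) μ →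
        μ {ω | HasZeroInDisk (W ω) ((1 - ε) * zeroFreeRadius β ν n)}
            ≤ ENNReal.ofReal (C * (n : ℝ) ^ (-6 * β)) ∧
        μ {ω | HasZeroInDisk (W ω) ((1 - ε / 2) * zeroFreeRadius β ν n)}
            ≤ ENNReal.ofReal (C * (n : ℝ) ^ (-6 * β))) ∧
      -- absence of zeros of `G_W` in the disk confines all zeros of `per (ρ J + W)`
      (∀ W : Matrix (Fin n) (Fin n) ℂ,
        ¬ HasZeroInDisk W ((1 - ε) * zeroFreeRadius β ν n) →
        ∀ ρ : ℂ, (ρ • allOnes n + W).permanent = 0 →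
          ‖ρ‖ ≤ (1 - ε)⁻¹ * Real.sqrt ν * (n : ℝ) ^ (-1 / 3 + β)) ∧
      -- absence of zeros in the slightly larger disk makes interpolation succeed for all `ρ`
      (∀ W : Matrix (Fin n) (Fin n) ℂ,
        ¬ HasZeroInDisk W ((1 - ε / 2) * zeroFreeRadius β ν n) →
        ∀ ρ : ℂ, (1 - ε)⁻¹ * Real.sqrt ν * (n : ℝ) ^ (-1 / 3 + β) ≤ ‖ρ‖ →
        ∀ η : ℝ, 0 < η → η ≤ 1 →
        ∀ m : ℕ, m = ⌈(A : ℝ) / ε * Real.log ((n : ℝ) / (η * ε))⌉₊ →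
          IsMulApprox η (barvinokApprox W m ρ) (ρ • allOnes n + W).permanent ∧
          ∃ (t : ℕ) (s : RamState), RamExec P (ramInput W ρ η ε) t s ∧
            t ≤ n ^ (A * m) ∧
            IsMulApprox η (s.cell 0) (ρ • allOnes n + W).permanent) := by
  refine ⟨interpolationProg, 36, by norm_num, fun ε hε0 hε => ⟨2 / ε * (60 * Real.exp 60), by positivity,
    fun β hβ0 hβ => ⟨1728, fun n hn ν hν => ⟨?_, ?_, ?_⟩⟩⟩⟩
  · intro Ω _ μ _ W hlaw hind
    have h := measure_hasZeroInDisk_zeroFreeRadius_le hε0 hβ0 hβ hν hn hlaw hind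
    -- The smaller disk lies inside the larger one, so a single estimate gives both probabilities.
    refine ⟨le_trans (measure_mono ?_) h, h⟩
    rintro ω ⟨z, hz, hz0⟩
    refine ⟨z, hz.trans_le (mul_le_mul_of_nonneg_right (by linarith) ?_), hz0⟩
    exact div_nonneg (Real.rpow_nonneg (Nat.cast_nonneg n) _) (Real.sqrt_nonneg ν)
  · intro W hW ρ h0
    exact norm_le_of_not_hasZeroInDisk (by omega) hε hν hW h0
  · intro W hW ρ hρ η hη hη1 m hm
    exact runs_interpolationProg_isMulApprox (by omega) le_rfl hε0 hε hν hW hρ hη hη1 hm
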